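/- Let $K$ be a field of characteristic $0$, $\mathfrak g$ a Lie superalgebra over $K$ (of any dimension), and $\mathfrak g=\mathfrak g_-\oplus\mathfrak h$ a decomposition as a superspace in which both $\mathfrak h$ and $\mathfrak g_-$ are Lie subsuperalgebras; let $\Pi_{\mathfrak g_-},\Pi_{\mathfrak h}$ be the corresponding projections. Let $U(\mathfrak g)$ be the universal enveloping superalgebra, $S=S(\mathfrak g_-)$ the symmetric superalgebra with its comultiplication $\Delta s=\sum s_1\otimes s_2$, and $\sigma\colon S\to U(\mathfrak g)$, $\sigma(e_1\cdots e_n)=\frac1{n!}\sum_{\tau\in\mathfrak S_n}\pm e_{\tau 1}\cdots e_{\tau n}$, the supersymmetrization map, the sign being that of the permutation induced on the odd elements. For a discrete superspace $W$, formal series in $X$ with coefficients in $W$ are the elements of $S^*\hat\otimes W\cong \mathrm{Hom}_K(S,W)$, where $w\otimes f$ is the map $s\mapsto f(s)w$ and $f\otimes w=(-1)^{|f||w|}w\otimes f$; products, brackets and actions extend to series by the rule of signs, and infinite sums and exponentials of series are taken in the topology of pointwise convergence on $S$. For a homogeneous basis $(P_i)$ of $\mathfrak g_-$, let $X^i$ be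 the dual basis of $\mathfrak g_-^*\subset S^*$, and let $$XP=\sum_i P_i\otimes X^i=\sum_i(-1)^{|P_i|}X^i\otimes P_i$$ be the series corresponding to the identity map of $\mathfrak g_-$ (it does not depend on the basis). Then there are morphisms of superspaces $A\colon\mathfrak g\to S^*\hat\otimes\mathfrak g_-$, $A(g)=\sum_i\varphi^i(X,g)\otimes P_i$, and $B\colon\mathfrak g\to S^*\hat\otimes\mathfrak h$, $B(g)=h(X,g)$, given by the (convergent) series $$\varphi^i(X,g)P_i=-\frac{\mathrm{ad}\,XP}{e^{-\mathrm{ad}\,XP}-1}\,\Pi_{\mathfrak g_-}e^{-\mathrm{ad}\,XP}g,\qquad h(X,g)=\Pi_{\mathfrak h}\,e^{-\mathrm{ad}\,XP}g ,$$ and they have the following properties. 1. For every homogeneous $g\in\mathfrak g$ and an indeterminate $\varepsilon$ with $|\varepsilon|=|g|$, $\varepsilon^2=0$ (supercommuting with the $X^i$ and satisfying the rule of signs with elements of $U(\mathfrak g)$), all the exponentials below exist and $$e^{\varepsilon g}e^{XP}=e^{XP+\varepsilon A(g)}e^{\varepsilon B(g)}$$ as formal series with coefficients in $U(\mathfrak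 g)$. 2. Let $\rho$ be a representation of $\mathfrak h$ in a superspace $V$. Let $T(V)=\mathrm{Hom}_{U(\mathfrak h)}(U(\mathfrak g),V)$ be the coinduced module, i.e. the space of linear maps $f$ with $\rho(y)f(u)=(-1)^{|y||f|}f(yu)$ for $y\in\mathfrak h$, with action $(T_gf)(u)=(-1)^{|g|(|f|+|u|)}f(ug)$. The map $f\mapsto f\circ\sigma$ is a bijection of $T(V)$ onto $\mathrm{Hom}_K(S,V)$, and in this realization, for every $g\in\mathfrak g$ and every homogeneous basis $(P_i)$, $$T_g=\sum_i\varphi^i(-X,g)\,P_i^*+\rho(h(-X,g)),$$ where $(P_i^*\psi)(s)=(-1)^{|P_i||\psi|}\psi(P_is)$ (that is, $P_i^*=(-1)^{|P_i|}\partial/\partial X^i$) and $\rho(h(-X,g))$ is the action on $V$-valued series extended by the rule of signs and continuity. 3. Let $I(V)=U(\mathfrak g)\otimes_{U(\mathfrak h)}V$ be the induced module. The map $s\otimes v\mapsto\sigma(s)\otimes v$ is a bijection of $S\otimes V$ onto $I(V)$, and in this realization, for every $g\in\mathfrak g$ and every homogeneous basis $(P_i)$, $$I_g=\sum_i(-1)^{|\varphi^i||P_i|}P_i\,\varphi^i\big(\tfrac{\partial}{\partial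 P},g\big)+\rho\big(h(\tfrac{\partial}{\partial P},g)\big)$$ (for inhomogeneous $\varphi^i$ the sign is applied to each parity component), where $f(\frac{\partial}{\partial P})s=\sum f(s_1)s_2$ for $f\in S^*$, and $f\otimes y$ ($f\in S^*$, $y\in\mathfrak h$) acts on $S\otimes V$ by $s\otimes v\mapsto(-1)^{|y||s|}f(\frac{\partial}{\partial P})s\otimes\rho(y)v$. 4. Suppose moreover that $\mathfrak g=\bigoplus_{n\ge -l}\mathfrak g_n$ is a $\mathbb Z$-graded Lie superalgebra ($l\ge0$), $\mathfrak g_-=\bigoplus_{n<0}\mathfrak g_n$ is finite-dimensional and $\mathfrak h=\bigoplus_{n\ge0}\mathfrak g_n$, and let $g\in\mathfrak g_d$. Then the series for $\varphi^i(X,g)P_i$ and $h(X,g)$ are finite: $(\mathrm{ad}\,XP)^n g=0$ for $n>l+d$ and $(\mathrm{ad}\,XP)^k\,\Pi_{\mathfrak g_-}(\mathrm{ad}\,XP)^n g=0$ for $n+k>l+d$. The coefficients $\varphi^i(\pm X,g)$ and $h(\pm X,g)$ are polynomials in the $X^i$ of degree at most $l+d$. -/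

import Mathlib

open scoped TensorProduct

namespace SuperRep

universe u v w

/-! Superspaces, sign conventions -/

/-- A superstructure on a vector space over a field of characteristic zero: the parity
operator, equal to `1` on the even part and to `-1` on the odd part. -/
class SuperSpace (K : Type u) [Field K] (V : Type v) [AddCommGroup V] [Module K V] where
  par : V →ₗ[K] V
  par_par : ∀ x, par (par x) = x

section Super

variable (K : Type u) [Field K]

/-- `(-1)^i` for `i ∈ ℤ/2`. -/
def sgn (i : ZMod 2) : K := if i = 0 then 1 else -1

/-- Parity operator. -/
abbrev par {V : Type v} [AddCommGroup V] [Module K V] [SuperSpace K V] : V →ₗ[K] V :=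
  SuperSpace.par

/-- The projection `x ↦ ᵢx` onto the component of parity `i`. -/
def comp {V : Type v} [AddCommGroup V] [Module K V] [SuperSpace K V] (i : ZMod 2) :
    V →ₗ[K] V :=
  (2⁻¹ : K) • (LinearMap.id + sgn K i • par K)

/-- `x` is homogeneous of parity `i` (zero is homogeneous of both parities). -/
def IsHomog {V : Type v} [AddCommGroup V] [Module K V] [SuperSpace K V] (i : ZMod 2) (x : V) :
    Prop :=
  par K x = sgn K i • x

/-- The ground field is purely even. -/
instance instSuperSelf : SuperSpace K K where
  par := LinearMap.id
  par_par _ := rfl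

/-- The superspace of all linear maps. -/
instance instSuperHom {V : Type v} {W : Type w} [AddCommGroup V] [Module K V] [SuperSpace K V]
    [AddCommGroup W] [Module K W] [SuperSpace K W] : SuperSpace K (V →ₗ[K] W) where
  par :=
    { toFun := fun F => par K ∘ₗ F ∘ₗ par K
      map_add' := fun F G => by ext x; simp
      map_smul' := fun c F => by ext x; simp }
  par_par F := by ext x; simp [SuperSpace.par_par]

end Super

/-- A subsuperspace. -/
structure SuperSubmodule (K : Type u) [Field K] (V : Type v) [AddCommGroup V] [Module K V]
    [SuperSpace K V] extends Submodule K V where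
  par_mem : ∀ x ∈ carrier, par K x ∈ carrier

instance instSuperSub {K : Type u} [Field K] {V : Type v} [AddCommGroup V] [Module K V]
    [SuperSpace K V] (W : SuperSubmodule K V) : SuperSpace K W.toSubmodule where
  par := (par K).restrict W.par_mem
  par_par x := Subtype.ext (SuperSpace.par_par (K := K) (x : V))

/-! Lie superalgebras and their modules -/

/-- A Lie superalgebra over a field of characteristic zero. -/
class LieSuper (K : Type u) [Field K] (g : Type v) [AddCommGroup g] [Module K g]
    [SuperSpace K g] where
  br : g →ₗ[K] g →ₗ[K] g
  par_br : ∀ x y, par K (br x y) = br (par K x) (par K y)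
  skew : ∀ x y, br x y = - ∑ i : ZMod 2, ∑ j : ZMod 2,
    sgn K (i * j) • br (comp K i y) (comp K j x)
  jacobi : ∀ (i j k : ZMod 2) (x y z : g),
    sgn K (i * k) • br (comp K i x) (br (comp K j y) (comp K k z)) +
    sgn K (j * i) • br (comp K j y) (br (comp K k z) (comp K i x)) +
    sgn K (k * j) • br (comp K k z) (br (comp K i x) (comp K j y)) = 0

/-- The bracket. -/
abbrev br (K : Type u) [Field K] {g : Type v} [AddCommGroup g] [Module K g]
    [SuperSpace K g] [LieSuper K g] : g →ₗ[K] g →ₗ[K] g := LieSuper.br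

/-- A Lie subsuperalgebra. -/
structure LieSuperSub (K : Type u) [Field K] (g : Type v) [AddCommGroup g] [Module K g]
    [SuperSpace K g] [LieSuper K g] extends SuperSubmodule K g where
  br_mem : ∀ x ∈ carrier, ∀ y ∈ carrier, br K x y ∈ carrier

/-- A module over a Lie subsuperalgebra `h` (a linear representation in the superspace `V`). -/
structure SuperRepr {K : Type u} [Field K] {g : Type v} [AddCommGroup g] [Module K g]
    [SuperSpace K g] [LieSuper K g] (h : LieSuperSub K g)
    (V : Type w) [AddCommGroup V] [Module K V] [SuperSpace K V] where
  act : h.toSubmodule →ₗ[K] V →ₗ[K] V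
  par_act : ∀ x v, par K (act x v) = act (par K x) (par K v)
  act_br : ∀ (x y : h.toSubmodule) (v : V),
    act ⟨br K (x : g) (y : g), h.br_mem x x.2 y y.2⟩ v = act x (act y v) -
      ∑ i : ZMod 2, ∑ j : ZMod 2, sgn K (i * j) • act (comp K i y) (act (comp K j x) v)

/-! The universal enveloping superalgebra -/

section EnvAlg

variable (K : Type u) [Field K] (g : Type v) [AddCommGroup g] [Module K g] [SuperSpace K g]

/-- `xy - (-1)^{|x||y|} yx = [x, y]`. -/
inductive EnvRel [LieSuper K g] : TensorAlgebra K g → TensorAlgebra K g → Prop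
  | mk (x y : g) : EnvRel
      (TensorAlgebra.ι K x * TensorAlgebra.ι K y - ∑ i : ZMod 2, ∑ j : ZMod 2,
        sgn K (i * j) • (TensorAlgebra.ι K (comp K j y) * TensorAlgebra.ι K (comp K i x)))
      (TensorAlgebra.ι K (br K x y))

/-- The universal enveloping superalgebra `U(g)`. -/
def EnvAlg [LieSuper K g] : Type (max u v) := RingQuot (EnvRel K g)

instance instRingEnv [LieSuper K g] : Ring (EnvAlg K g) :=
  inferInstanceAs (Ring (RingQuot (EnvRel K g)))

instance instAlgebraEnv [LieSuper K g] : Algebra K (EnvAlg K g) :=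
  inferInstanceAs (Algebra K (RingQuot (EnvRel K g)))

/-- The quotient map from the tensor algebra. -/
def envMk [LieSuper K g] : TensorAlgebra K g →ₐ[K] EnvAlg K g := RingQuot.mkAlgHom K (EnvRel K g)

/-- The canonical map `g → U(g)`. -/
def envι [LieSuper K g] : g →ₗ[K] EnvAlg K g :=
  (envMk K g).toLinearMap ∘ₗ TensorAlgebra.ι K

/-- `xy = (-1)^{|x||y|} yx`. -/
inductive SymRel : TensorAlgebra K g → TensorAlgebra K g → Prop
  | mk (x y : g) : SymRel
      (TensorAlgebra.ι K x * TensorAlgebra.ι K y)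
      (∑ i : ZMod 2, ∑ j : ZMod 2,
        sgn K (i * j) • (TensorAlgebra.ι K (comp K j y) * TensorAlgebra.ι K (comp K i x)))

/-- The symmetric superalgebra `S(E)` of a superspace. -/
def SymAlg : Type (max u v) := RingQuot (SymRel K g)

instance instRingSym : Ring (SymAlg K g) := inferInstanceAs (Ring (RingQuot (SymRel K g)))

instance instAlgebraSym : Algebra K (SymAlg K g) :=
  inferInstanceAs (Algebra K (RingQuot (SymRel K g)))

/-- The quotient map from the tensor algebra. -/
def symMk : TensorAlgebra K g →ₐ[K] SymAlg K g := RingQuot.mkAlgHom K (SymRel K g)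

/-- The canonical map `E → S(E)`. -/
def symι : g →ₗ[K] SymAlg K g :=
  (symMk K g).toLinearMap ∘ₗ TensorAlgebra.ι K

end EnvAlg

section EnvFacts

variable {K : Type u} [Field K] {g : Type v} [AddCommGroup g] [Module K g] [SuperSpace K g]

theorem par_comp (i : ZMod 2) (x : g) : par K (comp K i x) = comp K i (par K x) := by
  simp [comp]

theorem sum_sgn {M : Type w} [AddCommGroup M] [Module K M] (F : ZMod 2 → ZMod 2 → M) :
    ∑ i : ZMod 2, ∑ j : ZMod 2, sgn K (i * j) • F i j = F 0 0 + F 0 1 + F 1 0 - F 1 1 := by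
  rw [show (Finset.univ : Finset (ZMod 2)) = {0, 1} from rfl]
  simp [sgn]
  abel

theorem comp_add [CharZero K] (x : g) : comp K 0 x + comp K 1 x = x := by
  simp only [comp, sgn, LinearMap.smul_apply, LinearMap.add_apply, LinearMap.id_apply, if_true,
    one_ne_zero, if_false, one_smul, neg_smul, LinearMap.neg_apply]
  rw [← smul_add, add_add_add_comm, add_neg_cancel, add_zero, ← two_smul K x, smul_smul,
    inv_mul_cancel₀ two_ne_zero, one_smul]

theorem comp_sub [CharZero K] (x : g) : comp K 0 x - comp K 1 x = par K x := by
  simp only [comp, sgn, LinearMap.smul_apply, LinearMap.add_apply, LinearMap.id_apply, if_true,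
    one_ne_zero, if_false, one_smul, neg_smul, LinearMap.neg_apply]
  rw [← smul_sub, add_sub_add_left_eq_sub, sub_neg_eq_add, ← two_smul K, smul_smul,
    inv_mul_cancel₀ two_ne_zero, one_smul]

theorem par_comp_zero (x : g) : par K (comp K 0 x) = comp K 0 x := by
  simp [comp, sgn, SuperSpace.par_par, add_comm]

theorem par_comp_one (x : g) : par K (comp K 1 x) = - comp K 1 x := by
  simp only [comp, sgn, LinearMap.smul_apply, LinearMap.add_apply, LinearMap.id_apply,
    one_ne_zero, if_false, neg_smul, one_smul, LinearMap.neg_apply, map_smul, map_add, map_neg,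
    SuperSpace.par_par]
  rw [← smul_neg, neg_add, neg_neg, add_comm]

theorem comp_of_even [CharZero K] {x : g} (h : par K x = x) : comp K 0 x = x ∧ comp K 1 x = 0 := by
  have h1 : comp K 1 x = 0 := by simp [comp, sgn, h]
  refine ⟨?_, h1⟩
  simpa [h1] using comp_add (K := K) x

theorem comp_of_odd [CharZero K] {x : g} (h : par K x = -x) : comp K 0 x = 0 ∧ comp K 1 x = x := by
  have h1 : comp K 0 x = 0 := by simp [comp, sgn, h]
  refine ⟨h1, ?_⟩
  simpa [h1] using comp_add (K := K) x

theorem envι_rel [LieSuper K g] (x y : g) :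
    envι K g x * envι K g y - ∑ i : ZMod 2, ∑ j : ZMod 2,
      sgn K (i * j) • (envι K g (comp K j y) * envι K g (comp K i x)) =
    envι K g (br K x y) := by
  have h : envMk K g _ = envMk K g _ := RingQuot.mkAlgHom_rel K (EnvRel.mk (K := K) x y)
  simpa [envι] using h

theorem symι_rel (x y : g) :
    symι K g x * symι K g y = ∑ i : ZMod 2, ∑ j : ZMod 2,
      sgn K (i * j) • (symι K g (comp K j y) * symι K g (comp K i x)) := by
  have h : symMk K g _ = symMk K g _ := RingQuot.mkAlgHom_rel K (SymRel.mk (K := K) x y)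
  simpa [symι] using h

/-- Extension of a linear map with supercommuting values to an algebra morphism on `S(E)`. -/
def symLift {A : Type w} [Ring A] [Algebra K A] (f : g →ₗ[K] A)
    (hf : ∀ x y, f x * f y = ∑ i : ZMod 2, ∑ j : ZMod 2,
      sgn K (i * j) • (f (comp K j y) * f (comp K i x))) : SymAlg K g →ₐ[K] A :=
  RingQuot.liftAlgHom K ⟨TensorAlgebra.lift K f, by
    rintro _ _ ⟨x, y⟩
    simpa using hf x y⟩

@[simp] theorem symLift_ι {A : Type w} [Ring A] [Algebra K A] (f : g →ₗ[K] A) (hf) (x : g) :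
    symLift f hf (symι K g x) = f x := by
  have h := RingQuot.liftAlgHom_mkAlgHom_apply K (s := SymRel K g) (TensorAlgebra.lift K f)
    (by rintro _ _ ⟨x, y⟩; simpa using hf x y) (TensorAlgebra.ι K x)
  rw [TensorAlgebra.lift_ι_apply] at h
  exact h

theorem sym_hom_ext {A : Type w} [Ring A] [Algebra K A] {F G : SymAlg K g →ₐ[K] A}
    (h : ∀ x, F (symι K g x) = G (symι K g x)) : F = G := by
  apply RingQuot.ringQuot_ext'
  apply TensorAlgebra.hom_ext
  ext x
  exact h x

theorem env_hom_ext [LieSuper K g] {A : Type w} [Ring A] [Algebra K A] {F G : EnvAlg K g →ₐ[K] A}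
    (h : ∀ x, F (envι K g x) = G (envι K g x)) : F = G := by
  apply RingQuot.ringQuot_ext'
  apply TensorAlgebra.hom_ext
  ext x
  exact h x

theorem envPar_aux [LieSuper K g] ⦃a b : TensorAlgebra K g⦄ (hab : EnvRel K g a b) :
    TensorAlgebra.lift K (envι K g ∘ₗ par K) a = TensorAlgebra.lift K (envι K g ∘ₗ par K) b := by
  obtain ⟨x, y⟩ := hab
  have h := envι_rel (K := K) (par K x) (par K y)
  simpa [par_comp, LieSuper.par_br] using h

/-- The parity automorphism of `U(g)`. -/
def envPar [LieSuper K g] : EnvAlg K g →ₐ[K] EnvAlg K g :=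
  RingQuot.liftAlgHom K ⟨TensorAlgebra.lift K (envι K g ∘ₗ par K), envPar_aux⟩

@[simp] theorem envPar_ι [LieSuper K g] (x : g) :
    envPar (envι K g x) = envι K g (par K x) := by
  have h := RingQuot.liftAlgHom_mkAlgHom_apply K (s := EnvRel K g)
    (TensorAlgebra.lift K (envι K g ∘ₗ par K)) envPar_aux (TensorAlgebra.ι K x)
  rw [TensorAlgebra.lift_ι_apply] at h
  exact h

instance instSuperEnv [LieSuper K g] : SuperSpace K (EnvAlg K g) where
  par := envPar.toLinearMap
  par_par x := by
    have h : (envPar (K := K) (g := g)).comp envPar = AlgHom.id K _ :=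
      env_hom_ext fun x => by simp [SuperSpace.par_par]
    exact DFunLike.congr_fun h x

/-- The parity automorphism of `S(E)`. -/
def symPar : SymAlg K g →ₐ[K] SymAlg K g :=
  symLift (symι K g ∘ₗ par K) fun x y => by
    simpa [par_comp] using symι_rel (K := K) (par K x) (par K y)

@[simp] theorem symPar_ι (x : g) : symPar (symι K g x) = symι K g (par K x) := by
  simp [symPar]

instance instSuperSym : SuperSpace K (SymAlg K g) where
  par := symPar.toLinearMap
  par_par x := by
    have h : (symPar (K := K) (g := g)).comp symPar = AlgHom.id K _ :=
      sym_hom_ext fun x => by simp [SuperSpace.par_par]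
    exact DFunLike.congr_fun h x

end EnvFacts

/-! The coalgebra structure of `S(E)` -/

section Coalgebra

variable {K : Type u} [Field K] {E : Type v} [AddCommGroup E] [Module K E] [SuperSpace K E]

/-- The automorphism `e ↦ -e` of `S(E)`; composition with it replaces `X` by `-X` in a formal
series. -/
def symNeg : SymAlg K E →ₐ[K] SymAlg K E :=
  symLift (-symι K E) fun x y => by
    simpa only [LinearMap.neg_apply, neg_mul_neg] using symι_rel (K := K) x y

/-- The counit of `S(E)`, which is the unit element of `S(E)^*`. -/
def counit : SymAlg K E →ₐ[K] K := symLift 0 fun x y => by simp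

/-- The operator `(c, y) ↦ (0, c e)` on `K × E`. -/
def jet : E →ₗ[K] Module.End K (K × E) where
  toFun e := (LinearMap.inr K K E) ∘ₗ (LinearMap.fst K K E).smulRight e
  map_add' e e' := by ext <;> simp
  map_smul' c e := by ext <;> simp

/-- The projection `S(E) → S¹(E) = E`, which vanishes on `Sⁿ(E)` for `n ≠ 1`. -/
def symOne : SymAlg K E →ₗ[K] E :=
  LinearMap.snd K K E ∘ₗ LinearMap.applyₗ (1, 0) ∘ₗ
    (symLift (jet (K := K) (E := E)) fun x y => by
      have h : ∀ a b : E, jet (K := K) a * jet (K := K) b = 0 := fun a b => by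
        ext <;> simp [jet]
      simp [h]).toLinearMap

/-- Left multiplication by `e ⊗ 1 + 1 ⊗ e` in the superalgebra `S(E) ⊗ S(E)`, that is
`a ⊗ b ↦ e a ⊗ b + (-1)^{|e||a|} a ⊗ e b`. -/
def comulStep : E →ₗ[K] Module.End K (SymAlg K E ⊗[K] SymAlg K E) where
  toFun e := TensorProduct.map (LinearMap.mulLeft K (symι K E e)) LinearMap.id +
    ∑ i : ZMod 2, ∑ j : ZMod 2, sgn K (i * j) •
      TensorProduct.map (comp K i) (LinearMap.mulLeft K (symι K E (comp K j e)))
  map_add' e e' := by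
    ext a b
    simp [add_mul, TensorProduct.tmul_add, TensorProduct.add_tmul, Finset.sum_add_distrib]
    abel
  map_smul' c e := by
    ext a b
    simp [TensorProduct.smul_tmul', Finset.smul_sum, smul_comm c]

theorem symPar_mul (e : E) (a : SymAlg K E) :
    par K (symι K E e * a) = symι K E (par K e) * par K a := by
  have h := map_mul (symPar (K := K) (g := E)) (symι K E e) a
  rwa [symPar_ι] at h

theorem comulStep_tmul [CharZero K] (e : E) (a b : SymAlg K E) :
    comulStep (K := K) e (a ⊗ₜ[K] b) = (symι K E e * a) ⊗ₜ[K] b +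
      (a ⊗ₜ[K] (symι K E (comp K 0 e) * b) + par K a ⊗ₜ[K] (symι K E (comp K 1 e) * b)) := by
  have h : ∀ c d : SymAlg K E, (comp K 0 a) ⊗ₜ[K] c + (comp K 0 a) ⊗ₜ[K] d + (comp K 1 a) ⊗ₜ[K] c -
      (comp K 1 a) ⊗ₜ[K] d = a ⊗ₜ[K] c + par K a ⊗ₜ[K] d := fun c d => by
    conv_rhs => rw [← comp_sub (K := K) a]
    conv_rhs => enter [1, 2]; rw [← comp_add (K := K) a]
    simp only [TensorProduct.add_tmul, TensorProduct.sub_tmul]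
    abel
  simp only [comulStep, LinearMap.coe_mk, AddHom.coe_mk, LinearMap.add_apply, LinearMap.sum_apply,
    LinearMap.smul_apply, TensorProduct.map_tmul, LinearMap.mulLeft_apply, LinearMap.id_apply]
  rw [← h, ← sum_sgn (K := K) fun i j => comp K i a ⊗ₜ[K] (symι K E (comp K j e) * b)]

theorem comulStep_rel [CharZero K] (x y : E) :
    comulStep (K := K) x * comulStep (K := K) y = ∑ i : ZMod 2, ∑ j : ZMod 2,
      sgn K (i * j) • (comulStep (K := K) (comp K j y) * comulStep (K := K) (comp K i x)) := by
  have r := fun x' y' : E => symι_rel (K := K) x' y'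
  simp only [sum_sgn] at r
  have even0 := fun z : E => comp_of_even (K := K) (par_comp_zero (K := K) z)
  have odd1 := fun z : E => comp_of_odd (K := K) (par_comp_one (K := K) z)
  have r00 := r (comp K 0 x) (comp K 0 y)
  have r01 := r (comp K 0 x) (comp K 1 y)
  have r10 := r (comp K 1 x) (comp K 0 y)
  have r11 := r (comp K 1 x) (comp K 1 y)
  simp only [even0, odd1, map_zero, mul_zero, zero_mul, add_zero, zero_add, sub_zero, zero_sub]
    at r00 r01 r10 r11
  have hx := comp_add (K := K) x
  have hy := comp_add (K := K) y
  have e00 := fun c : SymAlg K E => congrArg (· * c) r00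
  have e01 := fun c : SymAlg K E => congrArg (· * c) r01
  have e10 := fun c : SymAlg K E => congrArg (· * c) r10
  have e11 := fun c : SymAlg K E => congrArg (· * c) r11
  simp only [mul_assoc, neg_mul] at e00 e01 e10 e11
  have key : comulStep (K := K) (comp K 0 x + comp K 1 x) *
      comulStep (K := K) (comp K 0 y + comp K 1 y) =
      comulStep (K := K) (comp K 0 y) * comulStep (K := K) (comp K 0 x) +
      comulStep (K := K) (comp K 1 y) * comulStep (K := K) (comp K 0 x) +
      comulStep (K := K) (comp K 0 y) * comulStep (K := K) (comp K 1 x) -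
      comulStep (K := K) (comp K 1 y) * comulStep (K := K) (comp K 1 x) := by
    apply TensorProduct.ext'
    intro a b
    simp only [map_add, Module.End.mul_apply, LinearMap.add_apply, LinearMap.sub_apply,
      comulStep_tmul, even0, odd1, map_zero, zero_mul, TensorProduct.tmul_zero, add_zero,
      zero_add, symPar_mul, par_comp_zero, par_comp_one, map_neg, neg_mul,
      TensorProduct.neg_tmul, SuperSpace.par_par,
      e00, e01, e10, e11, TensorProduct.tmul_neg, mul_add]
    abel
  rw [hx, hy] at key
  rw [key]
  exact (sum_sgn (K := K) fun i j =>
    comulStep (K := K) (comp K j y) * comulStep (K := K) (comp K i x)).symm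

/-- The comultiplication `Δ`, the morphism of superalgebras `S(E) → S(E) ⊗ S(E)` with
`Δ e = e ⊗ 1 + 1 ⊗ e`; it is obtained from the left multiplications by the `Δ e`. -/
def comul [CharZero K] : SymAlg K E →ₗ[K] SymAlg K E ⊗[K] SymAlg K E :=
  LinearMap.applyₗ ((1 : SymAlg K E) ⊗ₜ[K] (1 : SymAlg K E)) ∘ₗ
    (symLift (comulStep (K := K) (E := E)) comulStep_rel).toLinearMap

end Coalgebra

/-! Formal series

For discrete superspaces `E`, `W` the completed tensor product of `W` and `S(E)^*` is the space
of all linear maps `S(E) → W`; the element `w ⊗ f` is the map `s ↦ f(s) w`, and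
`f ⊗ w = (-1)^{|f||w|} w ⊗ f`. Formal series in `X` with coefficients in `W` are therefore
written as elements of `SymAlg K E →ₗ[K] W`. -/

section Series

variable {K : Type u} [Field K] {E : Type v} [AddCommGroup E] [Module K E] [SuperSpace K E]

/-- `u` is a summable family of series with sum `G`, in the topology of `L(S(E), W)` with `S(E)`
and `W` discrete. -/
def HasPointwiseSum {ι M W : Type*} [AddCommGroup M] [Module K M] [AddCommGroup W] [Module K W]
    (u : ι → M →ₗ[K] W) (G : M →ₗ[K] W) : Prop :=
  ∀ s, (Function.support fun i => u i s).Finite ∧ G s = ∑ᶠ i, u i s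

/-- The bilinear operation on formal series induced by a bilinear operation `β` on coefficients
(a product, a bracket, an action), extended with the rule of signs
`(w ⊗ f)(w' ⊗ f') = (-1)^{|f||w'|} β(w, w') ⊗ f f'`, that is
`(F G)(s) = ∑ (-1)^{|s₁||G|} β(F(s₁), G(s₂))` where `Δ s = ∑ s₁ ⊗ s₂`. -/
def convProd [CharZero K] {W₁ W₂ W₃ : Type*} [AddCommGroup W₁] [Module K W₁] [AddCommGroup W₂]
    [Module K W₂] [SuperSpace K W₂] [AddCommGroup W₃] [Module K W₃]
    (β : W₁ →ₗ[K] W₂ →ₗ[K] W₃) (F : SymAlg K E →ₗ[K] W₁) (G : SymAlg K E →ₗ[K] W₂) :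
    SymAlg K E →ₗ[K] W₃ :=
  (∑ i : ZMod 2, ∑ j : ZMod 2, sgn K (i * j) •
    TensorProduct.lift (β.compl₁₂ (F ∘ₗ comp K i) (comp K j G))) ∘ₗ comul

/-- The constant series `1 ⊗ w`. -/
def constSeries {W : Type*} [AddCommGroup W] [Module K W] (x : W) : SymAlg K E →ₗ[K] W :=
  (counit (K := K) (E := E)).toLinearMap.smulRight x

/-- The series `F(-X)`. -/
def negX {W : Type*} [AddCommGroup W] [Module K W] (F : SymAlg K E →ₗ[K] W) : SymAlg K E →ₗ[K] W :=
  F ∘ₗ (symNeg (K := K) (E := E)).toLinearMap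

/-- `G = q(T) F = ∑ qₙ Tⁿ F` for a formal power series `q` in one variable. -/
def HasSeries {W : Type*} [AddCommGroup W] [Module K W] (q : PowerSeries K)
    (T : (SymAlg K E →ₗ[K] W) → (SymAlg K E →ₗ[K] W)) (F G : SymAlg K E →ₗ[K] W) : Prop :=
  HasPointwiseSum (fun n : ℕ => PowerSeries.coeff n q • T^[n] F) G

/-- For a basis `P` of `E` with `P i` of parity `p i` and `F = ∑ φⁱ ⊗ Pᵢ`, the coefficient `φⁱ`. -/
noncomputable def coef {ι : Type*} (P : Module.Basis ι K E) (p : ι → ZMod 2) (F : SymAlg K E →ₗ[K] E) (i : ι) :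
    SymAlg K E →ₗ[K] K :=
  ∑ j : ZMod 2, sgn K (p i * j) • comp K j (P.coord i ∘ₗ F)

/-- The operator `e^*` dual to the left multiplication by `e` in `S(E)`, acting on `W`-valued
series; for `e = Pᵢ` this is `(-1)^{|Xⁱ|} ∂/∂Xⁱ`. -/
def dualMul {W : Type*} [AddCommGroup W] [Module K W] [SuperSpace K W] (e : E)
    (ψ : SymAlg K E →ₗ[K] W) : SymAlg K E →ₗ[K] W :=
  ∑ i : ZMod 2, ∑ j : ZMod 2, sgn K (i * j) •
    (comp K i ψ ∘ₗ LinearMap.mulLeft K (symι K E (comp K j e)))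

/-- The operator `f^* = f(∂/∂P)` on `S(E)` dual to the left multiplication by `f` in `S(E)^*`:
`f^* s = ∑ f(s₁) s₂` where `Δ s = ∑ s₁ ⊗ s₂`. -/
def contract [CharZero K] (f : SymAlg K E →ₗ[K] K) : SymAlg K E →ₗ[K] SymAlg K E :=
  (TensorProduct.lid K (SymAlg K E)).toLinearMap ∘ₗ f.rTensor (SymAlg K E) ∘ₗ comul

/-- The monomial `X^{i₁} ⋯ X^{iₖ}` in `S(E)^*`, where `Xⁱ ∈ E^* ⊆ S(E)^*` is the dual basis. -/
noncomputable def monom [CharZero K] {ι : Type*} (P : Module.Basis ι K E) : List ι → (SymAlg K E →ₗ[K] K)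
  | [] => (counit (K := K) (E := E)).toLinearMap
  | i :: t => convProd (LinearMap.mul K K) (P.coord i ∘ₗ symOne) (monom P t)

/-- Polynomials in `X` of degree at most `N` with coefficients in `W`. -/
def polyLE [CharZero K] {ι : Type*} (P : Module.Basis ι K E) (W : Type*) [AddCommGroup W]
    [Module K W] (N : ℤ) : Submodule K (SymAlg K E →ₗ[K] W) :=
  Submodule.span K {F | ∃ (t : List ι) (x : W), (t.length : ℤ) ≤ N ∧ F = (monom P t).smulRight x}

end Series

/-! The superalgebra of series `a + ε b` with `ε² = 0` -/

section Eps

variable {K : Type u} [Field K] [CharZero K] {E : Type v} [AddCommGroup E] [Module K E]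
  [SuperSpace K E] {R : Type w} [Ring R] [Algebra K R] [SuperSpace K R]

/-- The product of `a + ε b` and `a' + ε b'`, where `ε` has parity `p`, `ε² = 0` and
`a ε = (-1)^{|a| p} ε a`. -/
def epsMul (p : ZMod 2) (x y : (SymAlg K E →ₗ[K] R) × (SymAlg K E →ₗ[K] R)) :
    (SymAlg K E →ₗ[K] R) × (SymAlg K E →ₗ[K] R) :=
  (convProd (LinearMap.mul K R) x.1 y.1,
    convProd (LinearMap.mul K R) x.2 y.1 +
      ∑ i : ZMod 2, sgn K (i * p) • convProd (LinearMap.mul K R) (comp K i x.1) y.2)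

/-- Powers of `a + ε b`. -/
def epsPow (p : ZMod 2) (x : (SymAlg K E →ₗ[K] R) × (SymAlg K E →ₗ[K] R)) :
    ℕ → (SymAlg K E →ₗ[K] R) × (SymAlg K E →ₗ[K] R)
  | 0 => (constSeries 1, 0)
  | n + 1 => epsMul p x (epsPow p x n)

/-- `y = exp x`. -/
def HasExp (p : ZMod 2) (x y : (SymAlg K E →ₗ[K] R) × (SymAlg K E →ₗ[K] R)) : Prop :=
  HasPointwiseSum (fun n : ℕ => (n.factorial : K)⁻¹ • (epsPow p x n).1) y.1 ∧
    HasPointwiseSum (fun n : ℕ => (n.factorial : K)⁻¹ • (epsPow p x n).2) y.2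

end Eps

/-! Induced and coinduced modules and their realizations -/

section Modules

variable {K : Type u} [Field K] {g : Type v} [AddCommGroup g] [Module K g] [SuperSpace K g]
  [LieSuper K g]

/-- The parity of the permutation of the odd elements among `e₁, …, eₙ` induced by `τ`, as a
sign: the product of `(-1)^{p p'}` over all inversions of `τ`. -/
def oddSign (K : Type u) [Field K] {n : ℕ} (p : Fin n → ZMod 2) (τ : Equiv.Perm (Fin n)) : K :=
  ∏ k, ∏ l, if k < l ∧ τ l < τ k then sgn K (p (τ k) * p (τ l)) else 1

/-- `σ : S(W) → U(g)` sends `e₁ ⋯ eₙ` to the supersymmetric product `e₁ ∘ ⋯ ∘ eₙ`. -/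
def IsSymmetrization (W : SuperSubmodule K g) (σ : SymAlg K W.toSubmodule →ₗ[K] EnvAlg K g) : Prop :=
  ∀ (n : ℕ) (p : Fin n → ZMod 2) (e : Fin n → W.toSubmodule), (∀ k, IsHomog K (p k) (e k)) →
    σ (List.ofFn fun k => symι K W.toSubmodule (e k)).prod =
      (n.factorial : K)⁻¹ • ∑ τ : Equiv.Perm (Fin n),
        oddSign K p τ • (List.ofFn fun k => envι K g (e (τ k) : g)).prod

variable {h : LieSuperSub K g} {V : Type w} [AddCommGroup V] [Module K V] [SuperSpace K V]

/-- The space of the coinduced module `Hom_{U(h)}(U(g), V)`: linear maps `f` with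
`y f(u) = (-1)^{|f||y|} f(y u)` for `y ∈ h`. -/
def Coind (ρ : SuperRepr h V) : Submodule K (EnvAlg K g →ₗ[K] V) where
  carrier := {f | ∀ (y : h.toSubmodule) (u : EnvAlg K g), ρ.act y (f u) =
    ∑ i : ZMod 2, ∑ j : ZMod 2, sgn K (i * j) • (comp K i f) (envι K g (comp K j y) * u)}
  zero_mem' := fun y u => by simp
  add_mem' := fun {f f'} hf hf' y u => by
    simp only [LinearMap.add_apply, map_add, hf y u, hf' y u, smul_add, Finset.sum_add_distrib]
  smul_mem' := fun c f hf y u => by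
    simp only [LinearMap.smul_apply, map_smul, hf y u, Finset.smul_sum, smul_comm c]

/-- `(x f)(u) = (-1)^{|x|(|f|+|u|)} f(u x)`. -/
def homAct (x : g) : (EnvAlg K g →ₗ[K] V) →ₗ[K] (EnvAlg K g →ₗ[K] V) where
  toFun f := ∑ i : ZMod 2, ∑ j : ZMod 2, ∑ k : ZMod 2, sgn K (i * (j + k)) •
    (comp K j f ∘ₗ LinearMap.mulRight K (envι K g (comp K i x)) ∘ₗ comp K k)
  map_add' f f' := by
    simp only [map_add, LinearMap.add_comp, smul_add, Finset.sum_add_distrib]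
  map_smul' c f := by
    simp only [map_smul, LinearMap.smul_comp, Finset.smul_sum, smul_comm c, RingHom.id_apply]

theorem par_env_mul (a b : EnvAlg K g) : par K (a * b) = par K a * par K b :=
  map_mul (envPar (K := K) (g := g)) a b

theorem par_env_ι (x : g) : par K (envι K g x) = envι K g (par K x) := envPar_ι x

theorem par_hom_apply (f : EnvAlg K g →ₗ[K] V) (u : EnvAlg K g) :
    par K f u = par K (f (par K u)) := rfl

theorem mem_coind_iff [CharZero K] (ρ : SuperRepr h V) (f : EnvAlg K g →ₗ[K] V) :
    f ∈ Coind ρ ↔ ∀ (y : h.toSubmodule) (u : EnvAlg K g), ρ.act y (f u) =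
      f (envι K g (comp K 0 y) * u) - par K (f (envι K g (comp K 1 y) * par K u)) := by
  have key : ∀ (y : h.toSubmodule) (u : EnvAlg K g),
      ∑ i : ZMod 2, ∑ j : ZMod 2, sgn K (i * j) • (comp K i f) (envι K g (comp K j y) * u) =
      f (envι K g (comp K 0 y) * u) - par K (f (envι K g (comp K 1 y) * par K u)) := by
    intro y u
    rw [sum_sgn]
    have h0 := DFunLike.congr_fun (comp_add (K := K) f) (envι K g (comp K 0 y) * u)
    have h1 := DFunLike.congr_fun (comp_sub (K := K) f) (envι K g (comp K 1 y) * u)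
    rw [par_hom_apply, par_env_mul, par_env_ι] at h1
    rw [par_comp_one] at h1
    simp only [map_neg, neg_mul, LinearMap.sub_apply, LinearMap.add_apply] at h0 h1
    rw [sub_eq_add_neg (f _), ← h1, ← h0]
    abel
  constructor
  · intro hf y u
    rw [← key, ← hf y u]
  · intro hf y u
    rw [key, ← hf y u]

theorem homAct_apply [CharZero K] (x : g) (f : EnvAlg K g →ₗ[K] V) (u : EnvAlg K g) :
    homAct x f u = f (u * envι K g (comp K 0 x)) - par K (f (u * envι K g (comp K 1 x))) := by
  have h0 : ∀ a : EnvAlg K g, comp K 0 f a + comp K 1 f a = f a := fun a =>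
    DFunLike.congr_fun (comp_add (K := K) f) a
  have h1 : ∀ a : EnvAlg K g, comp K 0 f a - comp K 1 f a = par K (f (par K a)) := fun a =>
    DFunLike.congr_fun (comp_sub (K := K) f) a
  have h2 : ∀ a : EnvAlg K g, comp K 0 a + comp K 1 a = a := fun a => comp_add a
  have h3 : ∀ a : EnvAlg K g, comp K 0 a - comp K 1 a = par K a := fun a => comp_sub a
  have e0 : ∀ b, f (u * b) = comp K 0 f (comp K 0 u * b) + comp K 0 f (comp K 1 u * b) +
      (comp K 1 f (comp K 0 u * b) + comp K 1 f (comp K 1 u * b)) := fun b => by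
    rw [← map_add, ← map_add, ← add_mul, h2, h0]
  have e1 : ∀ b, par K (f (par K (par K u * b))) =
      comp K 0 f (comp K 0 u * b) - comp K 0 f (comp K 1 u * b) -
      (comp K 1 f (comp K 0 u * b) - comp K 1 f (comp K 1 u * b)) := fun b => by
    rw [← map_sub, ← map_sub, ← sub_mul, h3, h1]
  have e2 := e1 (envι K g (comp K 1 x))
  rw [par_env_mul, SuperSpace.par_par, par_env_ι, par_comp_one, map_neg, mul_neg, map_neg,
    map_neg] at e2
  rw [sub_eq_add_neg, e2, e0]
  simp only [homAct, LinearMap.coe_mk, AddHom.coe_mk, LinearMap.sum_apply, LinearMap.smul_apply,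
    LinearMap.comp_apply, LinearMap.mulRight_apply]
  rw [show (Finset.univ : Finset (ZMod 2)) = {0, 1} from rfl]
  have t : (1 : ZMod 2) + 1 = 0 := rfl
  simp [sgn, t]
  abel

theorem homAct_mem [CharZero K] (ρ : SuperRepr h V) (x : g) (f : EnvAlg K g →ₗ[K] V)
    (hf : f ∈ Coind ρ) : homAct x f ∈ Coind ρ := by
  rw [mem_coind_iff] at hf ⊢
  intro y u
  have hp : ∀ v : V, ρ.act y (par K v) = par K (ρ.act (par K y) v) := fun v => by
    rw [ρ.par_act, SuperSpace.par_par]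
  have pc : ((par K y : h.toSubmodule) : g) = par K (y : g) := rfl
  have p0 : comp K 0 (par K (y : g)) = comp K 0 (y : g) := by rw [← par_comp, par_comp_zero]
  have p1 : comp K 1 (par K (y : g)) = -comp K 1 (y : g) := by rw [← par_comp, par_comp_one]
  simp only [homAct_apply, map_sub, hp, hf, pc, p0, p1, par_env_mul, par_env_ι, par_comp_zero,
    par_comp_one,
    map_neg, mul_neg, neg_mul, SuperSpace.par_par, mul_assoc]
  abel

/-- The action of `x ∈ g` on the coinduced module. -/
def coindAct [CharZero K] (ρ : SuperRepr h V) (x : g) : Coind ρ →ₗ[K] Coind ρ :=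
  (homAct x).restrict (homAct_mem ρ x)

/-- The relations `u y ⊗ v = u ⊗ y v` for `y ∈ h`. -/
def indRel (ρ : SuperRepr h V) : Submodule K (EnvAlg K g ⊗[K] V) :=
  Submodule.span K {t | ∃ (u : EnvAlg K g) (y : h.toSubmodule) (x : V),
    t = (u * envι K g (y : g)) ⊗ₜ[K] x - u ⊗ₜ[K] ρ.act y x}

/-- The space of the induced module `U(g) ⊗_{U(h)} V`. -/
abbrev Ind (ρ : SuperRepr h V) := (EnvAlg K g ⊗[K] V) ⧸ indRel ρ

/-- The action of `x ∈ g` on the induced module, `x (u ⊗ v) = x u ⊗ v`. -/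
def indAct (ρ : SuperRepr h V) (x : g) : Ind ρ →ₗ[K] Ind ρ :=
  (indRel ρ).mapQ (indRel ρ) ((LinearMap.mulLeft K (envι K g x)).rTensor V) (by
    rw [indRel, Submodule.span_le]
    rintro _ ⟨u, y, z, rfl⟩
    refine Submodule.subset_span ⟨envι K g x * u, y, z, ?_⟩
    simp [mul_assoc])

variable {E : Type v} [AddCommGroup E] [Module K E] [SuperSpace K E]

/-- The realization map `Hom_{U(h)}(U(g), V) → Hom(S(E), V)` given by `σ : S(E) → U(g)`. -/
def coindReal (ρ : SuperRepr h V) (σ : SymAlg K E →ₗ[K] EnvAlg K g) :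
    Coind ρ →ₗ[K] (SymAlg K E →ₗ[K] V) :=
  LinearMap.lcomp K V σ ∘ₗ (Coind ρ).subtype

/-- The realization map `S(E) ⊗ V → U(g) ⊗_{U(h)} V` given by `σ : S(E) → U(g)`. -/
def indReal (ρ : SuperRepr h V) (σ : SymAlg K E →ₗ[K] EnvAlg K g) : SymAlg K E ⊗[K] V →ₗ[K] Ind ρ :=
  (indRel ρ).mkQ ∘ₗ σ.rTensor V

/-- The operator on `S(E) ⊗ V` defined by a series `H` with coefficients in `h`; for
`H = f ⊗ y` it is `s ⊗ v ↦ (-1)^{|y||s|} f^* s ⊗ y v`. -/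
def indOp [CharZero K] (ρ : SuperRepr h V) (H : SymAlg K E →ₗ[K] h.toSubmodule) :
    SymAlg K E ⊗[K] V →ₗ[K] SymAlg K E ⊗[K] V :=
  TensorProduct.lift (TensorProduct.lift (∑ i : ZMod 2, ∑ j : ZMod 2, sgn K (i * j) •
    (LinearMap.llcomp K V V (SymAlg K E ⊗[K] V)).flip.compl₁₂ (ρ.act ∘ₗ comp K i ∘ₗ H)
      (TensorProduct.mk K (SymAlg K E) V ∘ₗ comp K j)) ∘ₗ comul)

end Modules

/-! The maps `A`, `B` and the conditions on them -/

section Conditions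

variable {K : Type u} [Field K] [CharZero K] {g : Type v} [AddCommGroup g] [Module K g]
  [SuperSpace K g] [LieSuper K g] (gm h : LieSuperSub K g)

/-- The formal series `X P ∈ S(g₋)^* ⊗ g`: the identity map of `g₋`, that is
`∑ Pᵢ ⊗ Xⁱ = ∑ (-1)^{|Pᵢ|} Xⁱ ⊗ Pᵢ`. -/
def XP : SymAlg K gm.toSubmodule →ₗ[K] g := gm.toSubmodule.subtype ∘ₗ symOne

/-- `ad XP` on formal series with coefficients in `g`. -/
def adXP (F : SymAlg K gm.toSubmodule →ₗ[K] g) : SymAlg K gm.toSubmodule →ₗ[K] g :=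
  convProd (br K) (XP gm) F

/-- `e^{-t}`. -/
def expNeg (K : Type u) [Field K] : PowerSeries K :=
  PowerSeries.mk fun n => (-1) ^ n * (n.factorial : K)⁻¹

/-- `-t / (e^{-t} - 1)`, the inverse of `-(e^{-t} - 1) / t`. -/
noncomputable def toddSeries (K : Type u) [Field K] : PowerSeries K :=
  (PowerSeries.mk fun n => (-1) ^ n * ((n + 1).factorial : K)⁻¹)⁻¹

theorem toddSeries_mul : toddSeries K * (expNeg K - 1) = -PowerSeries.X := by
  have h : expNeg K - 1 =
      -(PowerSeries.X * PowerSeries.mk fun n => (-1) ^ n * ((n + 1).factorial : K)⁻¹) := by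
    ext n
    cases n with
    | zero => simp [expNeg]
    | succ n =>
      rw [map_neg, PowerSeries.coeff_succ_X_mul, map_sub]
      simp [expNeg, PowerSeries.coeff_one, pow_succ]
  rw [h, toddSeries, mul_neg, mul_left_comm, PowerSeries.inv_mul_cancel _ (by simp), mul_one]

variable {gm h}

/-- `A(x) = -(ad XP / (e^{-ad XP} - 1)) Π₋ e^{-ad XP} x` and `B(x) = Π e^{-ad XP} x`, with
`Π₋`, `Π` the projections of `g = g₋ ⊕ h`. -/
def IsExplicit (hc : IsCompl gm.toSubmodule h.toSubmodule)
    (A : g →ₗ[K] SymAlg K gm.toSubmodule →ₗ[K] gm.toSubmodule)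
    (B : g →ₗ[K] SymAlg K gm.toSubmodule →ₗ[K] h.toSubmodule) : Prop :=
  ∀ x : g, ∃ E : SymAlg K gm.toSubmodule →ₗ[K] g,
    HasSeries (expNeg K) (adXP gm) (constSeries x) E ∧
    HasSeries (toddSeries K) (adXP gm)
      (gm.toSubmodule.projection h.toSubmodule hc ∘ₗ E) (gm.toSubmodule.subtype ∘ₗ A x) ∧
    h.toSubmodule.subtype ∘ₗ B x = h.toSubmodule.projection gm.toSubmodule hc.symm ∘ₗ E

/-- `e^{εx} e^{XP} = e^{XP + ε A(x)} e^{ε B(x)}` for homogeneous `x`, with `ε² = 0`,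
`|ε| = |x|`; all exponentials exist. -/
def ExpIdentity (A : g →ₗ[K] SymAlg K gm.toSubmodule →ₗ[K] gm.toSubmodule)
    (B : g →ₗ[K] SymAlg K gm.toSubmodule →ₗ[K] h.toSubmodule) : Prop :=
  ∀ (p : ZMod 2) (x : g), IsHomog K p x →
    ∃ y₁ y₂ y₃ y₄ : (SymAlg K gm.toSubmodule →ₗ[K] EnvAlg K g) × (SymAlg K gm.toSubmodule →ₗ[K] EnvAlg K g),
      HasExp p (0, constSeries (envι K g x)) y₁ ∧
      HasExp p (envι K g ∘ₗ XP gm, 0) y₂ ∧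
      HasExp p (envι K g ∘ₗ XP gm, envι K g ∘ₗ gm.toSubmodule.subtype ∘ₗ A x) y₃ ∧
      HasExp p (0, envι K g ∘ₗ h.toSubmodule.subtype ∘ₗ B x) y₄ ∧
      epsMul p y₁ y₂ = epsMul p y₃ y₄

variable {V : Type w} [AddCommGroup V] [Module K V] [SuperSpace K V]

/-- `T(x) = ∑ᵢ φⁱ(-X, x) Pᵢ^* + ρ(h(-X, x))` in the realization of the coinduced module by
`V`-valued formal series, where `A(x) = ∑ φⁱ(X, x) ⊗ Pᵢ` and `B(x) = h(X, x)`. -/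
def CoindFormula (ρ : SuperRepr h V) (σ : SymAlg K gm.toSubmodule →ₗ[K] EnvAlg K g)
    (A : g →ₗ[K] SymAlg K gm.toSubmodule →ₗ[K] gm.toSubmodule)
    (B : g →ₗ[K] SymAlg K gm.toSubmodule →ₗ[K] h.toSubmodule)
    {ι : Type*} (P : Module.Basis ι K gm.toSubmodule) (p : ι → ZMod 2) : Prop :=
  ∀ x : g, ∃ D : (SymAlg K gm.toSubmodule →ₗ[K] V) →ₗ[K] (SymAlg K gm.toSubmodule →ₗ[K] V),
    (∀ ψ, HasPointwiseSum (fun i => convProd (LinearMap.lsmul K V)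
      (coef P p (negX (A x)) i) (dualMul (P i) ψ)) (D ψ)) ∧
    ∀ f : Coind ρ, coindReal ρ σ (coindAct ρ x f) =
      D (coindReal ρ σ f) + convProd ρ.act (negX (B x)) (coindReal ρ σ f)

/-- `I(x) = ∑ᵢ (-1)^{|φⁱ||Pᵢ|} Pᵢ φⁱ(∂/∂P, x) + ρ(h(∂/∂P, x))` in the realization of the induced
module by `S(g₋) ⊗ V`. -/
def IndFormula (ρ : SuperRepr h V) (σ : SymAlg K gm.toSubmodule →ₗ[K] EnvAlg K g)
    (A : g →ₗ[K] SymAlg K gm.toSubmodule →ₗ[K] gm.toSubmodule)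
    (B : g →ₗ[K] SymAlg K gm.toSubmodule →ₗ[K] h.toSubmodule)
    {ι : Type*} (P : Module.Basis ι K gm.toSubmodule) (p : ι → ZMod 2) : Prop :=
  ∀ x : g, ∃ D : SymAlg K gm.toSubmodule →ₗ[K] SymAlg K gm.toSubmodule,
    HasPointwiseSum (fun i => ∑ j : ZMod 2, sgn K (j * p i) •
      (LinearMap.mulLeft K (symι K gm.toSubmodule (P i)) ∘ₗ
        contract (comp K j (coef P p (A x) i)))) D ∧
    ∀ t : SymAlg K gm.toSubmodule ⊗[K] V,
      indAct ρ x (indReal ρ σ t) = indReal ρ σ (D.rTensor V t + indOp ρ (B x) t)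

/-- `g = ⨁_{n ≥ -l} gₙ` is a `ℤ`-graded Lie superalgebra, `g₋ = ⨁_{n < 0} gₙ` and
`h = ⨁_{n ≥ 0} gₙ`. -/
structure IsDepthGrading (gm h : LieSuperSub K g) (l : ℕ) (𝒢 : ℤ → Submodule K g) : Prop where
  internal : DirectSum.IsInternal 𝒢
  par_mem : ∀ n, ∀ x ∈ 𝒢 n, par K x ∈ 𝒢 n
  br_mem : ∀ m n, ∀ x ∈ 𝒢 m, ∀ y ∈ 𝒢 n, br K x y ∈ 𝒢 (m + n)
  eq_bot : ∀ n : ℤ, n < -l → 𝒢 n = ⊥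
  neg_eq : gm.toSubmodule = ⨆ n : ℤ, ⨆ _ : n < 0, 𝒢 n
  nonneg_eq : h.toSubmodule = ⨆ n : ℤ, ⨆ _ : 0 ≤ n, 𝒢 n

end Conditions

end SuperRep

open SuperRep

/-!
Let `σ = e^{XP}`, a formal series in `X` with coefficients in `U(g)`. As a linear map `S(g₋) → U(g)`
it is the supersymmetrization map (`isSymmetrization_symExp`), because `XPᵐ` evaluated at a product
of `n` elements of `g₋` is the signed sum over all orders if `m = n`, and zero otherwise.

A series `A` with values in `g₋` defines the coderivation `coder A : s ↦ ∑ A(s₁) s₂` of `S(g₋)`, and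
composition of series with `coder A` is the derivative along the vector field `∑ Aⁱ ∂/∂Xⁱ`. Two
identities govern everything: `x e^{XP} = e^{XP} (e^{-ad XP} x)` for `x ∈ g` (`const_mul_symExp`),
and `e^{XP} ∘ coder A = e^{XP} θ(A)` with the left logarithmic derivative `θ(A) = ((1 - e^{-ad XP})
/ ad XP) A` (`symExp_coder`). Both hold because, with `t XP` in place of `XP`, the two sides solve
the same linear differential equation in `t`. The map `A` of the theorem is the solution of `θ(A(x))
= Π₋ e^{-ad XP} x`, and `B(x)` is the remaining part of `e^{-ad XP} x`, so that `x e^{XP} = e^{XP} ∘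
coder A(x) + e^{XP} B(x)` (`const_mul_symExp_eq`). Since `ε² = 0`, this is the exponential identity,
and it says that the operator `coder A(x) ⊗ 1 + ρ(B(x))` on `S(g₋) ⊗ V` is carried by `s ⊗ v ↦ σ(s)
⊗ v` to the action of `x` on the induced module. The analogous identity with the factors on the
other side, which involves `e^{ad XP}`, that is, `A` and `B` at `-X`, gives the action on the
coinduced module.

The bijectivity of the realizations is proved without the Poincaré–Birkhoff–Witt theorem. The
Maurer–Cartan equation for `θ` (`maurer_cartan`), the formula for the derivative of `e^{-ad XP} x`
(`exp_coder`) and the fact that `e^{-ad XP}` preserves brackets (`serBr_exp`) give the structure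
equations `mapA_br` and `mapB_br`. By these the explicit operators form representations of `g` on
`S(g₋) ⊗ V` and on the `V`-valued series, for every `V`, independently of the (co)induced modules.
Hence there is a `g`-morphism `u ⊗ v ↦ u (1 ⊗ v)` from the induced module to `S(g₋) ⊗ V`. It is a
left inverse of the realization, because `1 ⊗ V` generates `S(g₋) ⊗ V`; and the realization is
surjective, because its image is stable under `g` and contains `1 ⊗ V`. The coinduced module is
dual: a series `ψ` is the realization of `u ↦ ± (u ψ)(1)`, since a series is determined by these
values (`eq_zero_of_coindEnv`).

In the graded case `ad XP` lowers the degree by at least one, and the degrees are bounded below by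
`-l`; moreover `ad XP` raises the polynomial degree in `X` by at most one.

Throughout, the rule of signs is carried by the operator `tw i`, which multiplies an element `x` by
`(-1)^{i|x|}`; identities are checked for homogeneous elements and extended by linearity.
-/

namespace SuperRep

universe u v w

set_option linter.unusedSectionVars false

/-! ### Sign conventions -/

section Signs

variable {K : Type u} [Field K]

theorem zmod_two_cases (i : ZMod 2) : i = 0 ∨ i = 1 := by revert i; decide

theorem sum_zmod_two {M : Type*} [AddCommMonoid M] (f : ZMod 2 → M) : ∑ i, f i = f 0 + f 1 :=
  Fin.sum_univ_two f

@[simp] theorem sgn_zero : sgn K 0 = 1 := by simp [sgn]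

@[simp] theorem sgn_one : sgn K 1 = -1 := by simp [sgn]

theorem sgn_add (i j : ZMod 2) : sgn K (i + j) = sgn K i * sgn K j := by
  have t : (1 : ZMod 2) + 1 = 0 := rfl
  rcases zmod_two_cases i with rfl | rfl <;> rcases zmod_two_cases j with rfl | rfl <;> simp [t]

@[simp] theorem sgn_mul_self (i : ZMod 2) : sgn K i * sgn K i = 1 := by
  rcases zmod_two_cases i with rfl | rfl <;> simp

variable {V : Type v} [AddCommGroup V] [Module K V] [SuperSpace K V]
variable {W : Type w} [AddCommGroup W] [Module K W] [SuperSpace K W]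

/-- The `i`-th power of the parity operator: the factor `(-1)^{i|x|}` as an operator on `x`. -/
def tw (K : Type u) [Field K] {V : Type v} [AddCommGroup V] [Module K V] [SuperSpace K V]
    (i : ZMod 2) : V →ₗ[K] V :=
  if i = 0 then LinearMap.id else par K

@[simp] theorem tw_zero (x : V) : tw K 0 x = x := by simp [tw]

@[simp] theorem tw_one (x : V) : tw K 1 x = par K x := by simp [tw]

@[simp] theorem par_par' (x : V) : par K (par K x) = x := SuperSpace.par_par x

theorem tw_of_homog {i p : ZMod 2} {x : V} (h : IsHomog K p x) : tw K i x = sgn K (i * p) • x := by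
  rcases zmod_two_cases i with rfl | rfl
  · simp
  · simpa [IsHomog] using h

theorem tw_tw (i j : ZMod 2) (x : V) : tw K i (tw K j x) = tw K (i + j) x := by
  have t : (1 : ZMod 2) + 1 = 0 := rfl
  rcases zmod_two_cases i with rfl | rfl <;> rcases zmod_two_cases j with rfl | rfl <;> simp [t]

theorem tw_comm (i j : ZMod 2) (x : V) : tw K i (tw K j x) = tw K j (tw K i x) := by
  rw [tw_tw, tw_tw, add_comm]

theorem tw_par (i : ZMod 2) (x : V) : tw K i (par K x) = par K (tw K i x) := by
  rw [← tw_one (K := K) x, tw_comm, tw_one]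

theorem IsHomog.zero (p : ZMod 2) : IsHomog K p (0 : V) := by simp [IsHomog]

theorem IsHomog.sub {p : ZMod 2} {x y : V} (hx : IsHomog K p x) (hy : IsHomog K p y) :
    IsHomog K p (x - y) := by
  unfold IsHomog at *; rw [map_sub, hx, hy, smul_sub]

theorem IsHomog.smul {p : ZMod 2} {x : V} (hx : IsHomog K p x) (c : K) :
    IsHomog K p (c • x) := by
  unfold IsHomog at *; rw [map_smul, hx, smul_comm]

theorem isHomog_zero_iff {x : V} : IsHomog K 0 x ↔ par K x = x := by simp [IsHomog]

theorem isHomog_one_iff {x : V} : IsHomog K 1 x ↔ par K x = -x := by simp [IsHomog]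

theorem isHomog_comp (i : ZMod 2) (x : V) : IsHomog K i (comp K i x) := by
  rcases zmod_two_cases i with rfl | rfl
  · simpa [IsHomog] using par_comp_zero (K := K) x
  · simpa [IsHomog] using par_comp_one (K := K) x

theorem IsHomog.comp_self [CharZero K] {i : ZMod 2} {x : V} (h : IsHomog K i x) :
    comp K i x = x := by
  rcases zmod_two_cases i with rfl | rfl
  · exact (comp_of_even (isHomog_zero_iff.1 h)).1
  · exact (comp_of_odd (isHomog_one_iff.1 h)).2

theorem IsHomog.comp_ne [CharZero K] {i j : ZMod 2} {x : V} (h : IsHomog K i x) (hij : j ≠ i) :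
    comp K j x = 0 := by
  rcases zmod_two_cases i with rfl | rfl <;> rcases zmod_two_cases j with rfl | rfl
  · exact absurd rfl hij
  · exact (comp_of_even (isHomog_zero_iff.1 h)).2
  · exact (comp_of_odd (isHomog_one_iff.1 h)).1
  · exact absurd rfl hij

theorem IsHomog.sum_comp [CharZero K] {M : Type*} [AddCommMonoid M] {i : ZMod 2} {x : V}
    (h : IsHomog K i x) (f : ZMod 2 → V → M) (hf : ∀ j, f j 0 = 0) :
    ∑ j, f j (SuperRep.comp K j x) = f i x := by
  rw [Finset.sum_eq_single i]
  · rw [h.comp_self]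
  · intro j _ hj; rw [h.comp_ne hj, hf]
  · intro h; exact absurd (Finset.mem_univ i) h

theorem par_hom_apply' (F : V →ₗ[K] W) (x : V) : par K F x = par K (F (par K x)) := rfl

theorem par_hom_par (F : V →ₗ[K] W) (x : V) : par K F (par K x) = par K (F x) := by
  rw [par_hom_apply', par_par']

theorem par_comp_hom {W' : Type*} [AddCommGroup W'] [Module K W'] [SuperSpace K W']
    (G : W →ₗ[K] W') (F : V →ₗ[K] W) : par K (G ∘ₗ F) = par K G ∘ₗ par K F := by
  ext x; simp [par_hom_apply']

theorem tw_comp_hom {W' : Type*} [AddCommGroup W'] [Module K W'] [SuperSpace K W']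
    (i : ZMod 2) (G : W →ₗ[K] W') (F : V →ₗ[K] W) : tw K i (G ∘ₗ F) = tw K i G ∘ₗ tw K i F := by
  rcases zmod_two_cases i with rfl | rfl
  · simp
  · simp [par_comp_hom]

theorem tw_hom_tw (i : ZMod 2) (F : V →ₗ[K] W) (x : V) : tw K i F (tw K i x) = tw K i (F x) := by
  rcases zmod_two_cases i with rfl | rfl
  · simp
  · simp [par_hom_par]

theorem IsHomog.comp_hom {W' : Type*} [AddCommGroup W'] [Module K W'] [SuperSpace K W']
    {p q : ZMod 2} {G : W →ₗ[K] W'} {F : V →ₗ[K] W} (hG : IsHomog K p G) (hF : IsHomog K q F) :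
    IsHomog K (p + q) (G ∘ₗ F) := by
  unfold IsHomog at *
  rw [par_comp_hom, hG, hF, sgn_add, LinearMap.smul_comp, LinearMap.comp_smul, smul_smul]

theorem IsHomog.apply {p q : ZMod 2} {F : V →ₗ[K] W} (hF : IsHomog K p F) {x : V}
    (hx : IsHomog K q x) : IsHomog K (p + q) (F x) := by
  unfold IsHomog at *
  have h := LinearMap.congr_fun hF (par K x)
  rw [par_hom_par] at h
  rw [h, hx, LinearMap.smul_apply, map_smul, smul_smul, sgn_add]

theorem IsHomog.tw_apply {p : ZMod 2} {F : V →ₗ[K] W} (hF : IsHomog K p F) (i : ZMod 2) (x : V) :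
    SuperRep.tw K i (F x) = sgn K (i * p) • F (SuperRep.tw K i x) := by
  rw [← tw_hom_tw, tw_of_homog hF]; rfl

theorem tw_comp_of_homog {W' : Type*} [AddCommGroup W'] [Module K W'] [SuperSpace K W']
    {p : ZMod 2} (i : ZMod 2) (G : W →ₗ[K] W') {F : V →ₗ[K] W} (hF : IsHomog K p F) :
    tw K i (G ∘ₗ F) = sgn K (i * p) • (tw K i G ∘ₗ F) := by
  rw [tw_comp_hom, tw_of_homog hF, LinearMap.comp_smul]

theorem comp_comp_even {W' : Type*} [AddCommGroup W'] [Module K W'] [SuperSpace K W']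
    (i : ZMod 2) {G : W →ₗ[K] W'} (hG : IsHomog K 0 G) (F : V →ₗ[K] W) :
    comp K i (G ∘ₗ F) = G ∘ₗ comp K i F := by
  simp only [comp, LinearMap.smul_apply, LinearMap.add_apply, LinearMap.id_apply, par_comp_hom,
    isHomog_zero_iff.1 hG, LinearMap.comp_smul, LinearMap.comp_add]

theorem comp_even_comp {W' : Type*} [AddCommGroup W'] [Module K W'] [SuperSpace K W']
    (i : ZMod 2) (G : W →ₗ[K] W') {F : V →ₗ[K] W} (hF : IsHomog K 0 F) :
    comp K i (G ∘ₗ F) = comp K i G ∘ₗ F := by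
  simp only [comp, LinearMap.smul_apply, LinearMap.add_apply, LinearMap.id_apply, par_comp_hom,
    isHomog_zero_iff.1 hF, LinearMap.smul_comp, LinearMap.add_comp]

theorem even_iff {F : V →ₗ[K] W} : IsHomog K 0 F ↔ ∀ x, par K (F x) = F (par K x) := by
  rw [isHomog_zero_iff]
  constructor
  · intro h x
    conv_rhs => rw [← h]
    rw [par_hom_par]
  · intro h
    ext x
    rw [par_hom_apply', h, par_par']

theorem even_comp {F : V →ₗ[K] W} (h : IsHomog K 0 F) (i : ZMod 2) (x : V) :
    comp K i (F x) = F (comp K i x) := by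
  simp only [comp, LinearMap.smul_apply, LinearMap.add_apply, LinearMap.id_apply,
    even_iff.1 h, map_smul, map_add]

theorem even_tw {F : V →ₗ[K] W} (h : IsHomog K 0 F) (i : ZMod 2) (x : V) :
    tw K i (F x) = F (tw K i x) := by
  rw [h.tw_apply, mul_zero, sgn_zero, one_smul]

theorem tw_apply_eq_self {x : V} (h : IsHomog K 0 x) (i : ZMod 2) : tw K i x = x := by
  rw [tw_of_homog h, mul_zero, sgn_zero, one_smul]

/-- A signed sum of the parity components is a power of the parity operator. In this form the rule
of signs needs no case distinction. -/
theorem sum_sgn_comp [CharZero K] (i : ZMod 2) (x : V) :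
    ∑ j : ZMod 2, sgn K (i * j) • comp K j x = tw K i x := by
  rw [sum_zmod_two]
  rcases zmod_two_cases i with rfl | rfl
  · simpa using comp_add (K := K) x
  · simpa [← sub_eq_add_neg] using comp_sub (K := K) x

end Signs

/-! ### The symmetric superalgebra -/

section Sym

variable {K : Type u} [Field K] {E : Type v} [AddCommGroup E] [Module K E] [SuperSpace K E]

/-- Left multiplication by `e ∈ E` on `S(E)`. -/
def symL (e : E) : SymAlg K E →ₗ[K] SymAlg K E := LinearMap.mulLeft K (symι K E e)

@[simp] theorem symL_apply (e : E) (s : SymAlg K E) : symL e s = symι K E e * s := rfl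

theorem par_sym_mul (a b : SymAlg K E) : par K (a * b) = par K a * par K b :=
  map_mul (symPar (K := K) (g := E)) a b

theorem par_sym_one : par K (1 : SymAlg K E) = 1 := map_one (symPar (K := K) (g := E))

theorem par_sym_ι (e : E) : par K (symι K E e) = symι K E (par K e) := symPar_ι e

theorem isHomog_symL {i : ZMod 2} {e : E} (h : IsHomog K i e) :
    IsHomog K i (symL (K := K) e) := by
  unfold IsHomog at *
  ext s
  rw [par_hom_apply', symL_apply, par_sym_mul, par_par', par_sym_ι, h]
  simp

/-- The algebra `S(E)` is generated by `E`: by the universal property, the inclusion of the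
subalgebra generated by `E` has a right inverse. -/
theorem sym_adjoin : Algebra.adjoin K (Set.range (symι K E)) = ⊤ := by
  set B := Algebra.adjoin K (Set.range (symι K E))
  let f : E →ₗ[K] B := (symι K E).codRestrict B.toSubmodule
    fun e => Algebra.subset_adjoin ⟨e, rfl⟩
  have hf : ∀ x y, f x * f y = ∑ i : ZMod 2, ∑ j : ZMod 2,
      sgn K (i * j) • (f (comp K j y) * f (comp K i x)) := fun x y => by
    apply Subtype.ext
    have h := symι_rel (K := K) x y
    simp only [sum_sgn] at h ⊢
    exact h
  have h : B.val.comp (symLift f hf) = AlgHom.id K _ := sym_hom_ext fun x => by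
    simp [f]
    rfl
  rw [eq_top_iff]
  intro s _
  have := DFunLike.congr_fun h s
  rw [AlgHom.id_apply] at this
  rw [← this]
  exact (symLift f hf s).2

/-- Induction on the degree in `S(E)`, one homogeneous factor at a time. -/
theorem sym_induction [CharZero K] {P : SymAlg K E → Prop} (one : P 1)
    (add : ∀ a b, P a → P b → P (a + b)) (smul : ∀ (c : K) a, P a → P (c • a))
    (mul : ∀ (i : ZMod 2) (e : E) (s : SymAlg K E), IsHomog K i e → P s → P (symι K E e * s))
    (s : SymAlg K E) : P s := by
  have key : ∀ a : SymAlg K E, ∀ s, P s → P (a * s) := by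
    intro a
    have ha : a ∈ Algebra.adjoin K (Set.range (symι K E)) := by rw [sym_adjoin]; trivial
    induction ha using Algebra.adjoin_induction with
    | mem x hx =>
      obtain ⟨e, rfl⟩ := hx
      intro s hs
      rw [← comp_add (K := K) e, map_add, add_mul]
      exact add _ _ (mul 0 _ _ (isHomog_comp 0 e) hs) (mul 1 _ _ (isHomog_comp 1 e) hs)
    | algebraMap c =>
      intro s hs
      rw [← Algebra.smul_def]
      exact smul c s hs
    | add x y _ _ hx hy =>
      intro s hs
      rw [add_mul]
      exact add _ _ (hx s hs) (hy s hs)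
    | mul x y _ _ hx hy =>
      intro s hs
      rw [mul_assoc]
      exact hx _ (hy s hs)
  simpa using key s 1 one

theorem sym_hom_ext_mul [CharZero K] {W : Type*} [AddCommGroup W] [Module K W]
    {F G : SymAlg K E →ₗ[K] W} (one : F 1 = G 1)
    (mul : ∀ (i : ZMod 2) (e : E), IsHomog K i e → F ∘ₗ symL e = G ∘ₗ symL e) : F = G := by
  ext s
  induction s using sym_induction with
  | one => exact one
  | add a b ha hb => rw [map_add, map_add, ha, hb]
  | smul c a ha => rw [map_smul, map_smul, ha]
  | mul i e s he _ => exact LinearMap.congr_fun (mul i e he) s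

@[simp] theorem counit_ι (e : E) : counit (symι K E e) = 0 := by simp [counit]

theorem constSeries_apply {W : Type*} [AddCommGroup W] [Module K W] (x : W) (s : SymAlg K E) :
    constSeries x s = counit s • x := rfl

@[simp] theorem constSeries_one {W : Type*} [AddCommGroup W] [Module K W] (x : W) :
    constSeries (K := K) (E := E) x 1 = x := by simp [constSeries_apply]

@[simp] theorem constSeries_symL {W : Type*} [AddCommGroup W] [Module K W] (x : W) (e : E) :
    constSeries (K := K) x ∘ₗ symL e = 0 := by
  ext s; simp [constSeries_apply]

/-- The first component of `s (c, e)` in the representation of `S(E)` on `K ⊕ E` that reads off the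
terms of degree at most one. -/
@[simp] theorem symOne_one : symOne (1 : SymAlg K E) = 0 := by simp [symOne]

theorem jet_fst (s : SymAlg K E) (x : K × E) :
    (symLift (jet (K := K) (E := E)) (fun x y => by
      have h : ∀ a b : E, jet (K := K) a * jet (K := K) b = 0 := fun a b => by
        ext <;> simp [jet]
      simp [h]) s x).1 = counit s * x.1 := by
  have hs : s ∈ Algebra.adjoin K (Set.range (symι K E)) := by rw [sym_adjoin]; trivial
  induction hs using Algebra.adjoin_induction generalizing x with
  | mem e he => obtain ⟨e, rfl⟩ := he; simp [jet]
  | algebraMap c => simp [Module.algebraMap_end_apply]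
  | add a b _ _ ha hb => simp [ha, hb, add_mul]
  | mul a b _ _ ha hb => simp [ha, hb, mul_assoc]

@[simp] theorem symOne_ι_mul (e : E) (s : SymAlg K E) :
    symOne (symι K E e * s) = counit s • e := by
  have h := jet_fst (K := K) s (1, 0)
  simp only [mul_one] at h
  rw [← h]
  simp [symOne, jet]

theorem symOne_symL (e : E) : symOne ∘ₗ symL (K := K) e = constSeries e := by
  ext s; simp [constSeries_apply]

theorem counit_par (s : SymAlg K E) : counit (par K s) = counit s := by
  have h : (counit (K := K) (E := E)).comp symPar = counit := sym_hom_ext fun x => by simp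
  exact DFunLike.congr_fun h s

theorem isHomog_constSeries {W : Type*} [AddCommGroup W] [Module K W] [SuperSpace K W]
    {p : ZMod 2} {x : W} (h : IsHomog K p x) :
    IsHomog K p (constSeries (K := K) (E := E) x) := by
  unfold IsHomog at *
  ext s
  rw [par_hom_apply', constSeries_apply, counit_par, map_smul, h, smul_comm]
  rfl

theorem par_constSeries {W : Type*} [AddCommGroup W] [Module K W] [SuperSpace K W] (x : W) :
    par K (constSeries (K := K) (E := E) x) = constSeries (par K x) := by
  ext s
  rw [par_hom_apply', constSeries_apply, counit_par, map_smul]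
  rfl

theorem symOne_even [CharZero K] : IsHomog K 0 (symOne (K := K) (E := E)) := by
  rw [isHomog_zero_iff]
  refine sym_hom_ext_mul ?_ fun i e he => ?_
  · rw [par_hom_apply', par_sym_one, symOne_one, map_zero]
  · ext s
    simp only [LinearMap.comp_apply, symL_apply, par_hom_apply', par_sym_mul, par_sym_ι,
      symOne_ι_mul, map_smul, counit_par, par_par']

/-- The product rule in `S(E)` for a homogeneous factor: `a e = (-1)^{|a||e|} e a`, for `a ∈ E`. -/
theorem symι_mul_comm [CharZero K] {i : ZMod 2} {e : E} (he : IsHomog K i e) (x : E) :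
    symι K E x * symι K E e = symι K E e * symι K E (tw K i x) := by
  rw [symι_rel, ← sum_sgn_comp i x, map_sum, Finset.mul_sum]
  refine Finset.sum_congr rfl fun j _ => ?_
  rw [he.sum_comp (fun l y => sgn K (j * l) • (symι K E y * symι K E (comp K j x)))
    (fun j => by simp), map_smul, mul_smul_comm, mul_comm j i]

end Sym

/-! ### Products of formal series -/

section Conv

variable {K : Type u} [Field K] [CharZero K] {E : Type v} [AddCommGroup E] [Module K E]
  [SuperSpace K E]
variable {W₁ W₂ W₃ W₄ W₅ W₆ : Type*}
  [AddCommGroup W₁] [Module K W₁] [AddCommGroup W₂] [Module K W₂]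
  [AddCommGroup W₃] [Module K W₃] [AddCommGroup W₄] [Module K W₄]
  [AddCommGroup W₅] [Module K W₅] [AddCommGroup W₆] [Module K W₆]

/-- The product of series without signs, `s ↦ ∑ β(F(s₁), G(s₂))`. -/
def plainConv (β : W₁ →ₗ[K] W₂ →ₗ[K] W₃) (F : SymAlg K E →ₗ[K] W₁) (G : SymAlg K E →ₗ[K] W₂) :
    SymAlg K E →ₗ[K] W₃ :=
  TensorProduct.lift (β.compl₁₂ F G) ∘ₗ comul

theorem comul_one : comul (1 : SymAlg K E) = 1 ⊗ₜ[K] 1 := by simp [comul]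

theorem comul_ι_mul (e : E) (s : SymAlg K E) :
    comul (symι K E e * s) = comulStep (K := K) e (comul s) := by
  simp [comul]

theorem plainConv_one (β : W₁ →ₗ[K] W₂ →ₗ[K] W₃) (F : SymAlg K E →ₗ[K] W₁)
    (G : SymAlg K E →ₗ[K] W₂) : plainConv β F G 1 = β (F 1) (G 1) := by
  simp [plainConv, comul_one]

theorem plainConv_symL (β : W₁ →ₗ[K] W₂ →ₗ[K] W₃) (F : SymAlg K E →ₗ[K] W₁)
    (G : SymAlg K E →ₗ[K] W₂) (e : E) :
    plainConv β F G ∘ₗ symL e = plainConv β (F ∘ₗ symL e) G +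
      plainConv β F (G ∘ₗ symL (comp K 0 e)) +
      plainConv β (F ∘ₗ par K) (G ∘ₗ symL (comp K 1 e)) := by
  have h : ∀ z : SymAlg K E ⊗[K] SymAlg K E,
      TensorProduct.lift (β.compl₁₂ F G) (comulStep (K := K) e z) =
      TensorProduct.lift (β.compl₁₂ (F ∘ₗ symL e) G) z +
      TensorProduct.lift (β.compl₁₂ F (G ∘ₗ symL (comp K 0 e))) z +
      TensorProduct.lift (β.compl₁₂ (F ∘ₗ par K) (G ∘ₗ symL (comp K 1 e))) z := by
    intro z
    induction z with
    | zero => simp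
    | add a b ha hb =>
      simp only [map_add, ha, hb]
      abel
    | tmul a b =>
      rw [comulStep_tmul]
      simp only [map_add, TensorProduct.lift.tmul, LinearMap.compl₁₂_apply,
        LinearMap.comp_apply, symL_apply, add_assoc]
  ext s
  simp only [LinearMap.comp_apply, LinearMap.add_apply, plainConv, symL_apply, comul_ι_mul, h]

theorem plainConv_add_left (β : W₁ →ₗ[K] W₂ →ₗ[K] W₃) (F F' : SymAlg K E →ₗ[K] W₁)
    (G : SymAlg K E →ₗ[K] W₂) : plainConv β (F + F') G = plainConv β F G + plainConv β F' G := by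
  rw [plainConv, plainConv, plainConv, ← LinearMap.add_comp]
  congr 1
  ext; simp

theorem plainConv_add_right (β : W₁ →ₗ[K] W₂ →ₗ[K] W₃) (F : SymAlg K E →ₗ[K] W₁)
    (G G' : SymAlg K E →ₗ[K] W₂) :
    plainConv β F (G + G') = plainConv β F G + plainConv β F G' := by
  rw [plainConv, plainConv, plainConv, ← LinearMap.add_comp]
  congr 1
  ext; simp

theorem plainConv_smul_left (β : W₁ →ₗ[K] W₂ →ₗ[K] W₃) (c : K) (F : SymAlg K E →ₗ[K] W₁)
    (G : SymAlg K E →ₗ[K] W₂) : plainConv β (c • F) G = c • plainConv β F G := by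
  rw [plainConv, plainConv, ← LinearMap.smul_comp]
  congr 1
  ext; simp

theorem plainConv_smul_right (β : W₁ →ₗ[K] W₂ →ₗ[K] W₃) (c : K) (F : SymAlg K E →ₗ[K] W₁)
    (G : SymAlg K E →ₗ[K] W₂) : plainConv β F (c • G) = c • plainConv β F G := by
  rw [plainConv, plainConv, ← LinearMap.smul_comp]
  congr 1
  ext; simp

theorem plainConv_zero_right (β : W₁ →ₗ[K] W₂ →ₗ[K] W₃) (F : SymAlg K E →ₗ[K] W₁) :
    plainConv β F 0 = 0 := by
  simpa using plainConv_smul_right β (0 : K) F 0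

variable [SuperSpace K W₂]

theorem convProd_eq_plainConv (β : W₁ →ₗ[K] W₂ →ₗ[K] W₃) (F : SymAlg K E →ₗ[K] W₁)
    (G : SymAlg K E →ₗ[K] W₂) :
    convProd β F G = plainConv β F (comp K 0 G) + plainConv β (F ∘ₗ par K) (comp K 1 G) := by
  unfold convProd plainConv
  rw [← LinearMap.add_comp]
  congr 1
  ext a b
  have h0 := comp_add (K := K) a
  have h1 := comp_sub (K := K) a
  simp only [sum_sgn, TensorProduct.AlgebraTensorModule.curry_apply, LinearMap.restrictScalars_self,
    TensorProduct.curry_apply, LinearMap.add_apply, LinearMap.sub_apply, TensorProduct.lift.tmul,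
    LinearMap.compl₁₂_apply, LinearMap.comp_apply]
  rw [← h1, map_sub, map_sub, LinearMap.sub_apply]
  conv_rhs => rw [← h0]
  rw [map_add, map_add, LinearMap.add_apply]
  simp only [h0]
  abel

theorem convProd_one (β : W₁ →ₗ[K] W₂ →ₗ[K] W₃) (F : SymAlg K E →ₗ[K] W₁)
    (G : SymAlg K E →ₗ[K] W₂) : convProd β F G 1 = β (F 1) (G 1) := by
  rw [convProd_eq_plainConv, LinearMap.add_apply, plainConv_one, plainConv_one,
    LinearMap.comp_apply, par_sym_one, ← map_add, ← LinearMap.add_apply, comp_add]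

theorem convProd_add_left (β : W₁ →ₗ[K] W₂ →ₗ[K] W₃) (F F' : SymAlg K E →ₗ[K] W₁)
    (G : SymAlg K E →ₗ[K] W₂) : convProd β (F + F') G = convProd β F G + convProd β F' G := by
  simp only [convProd_eq_plainConv, LinearMap.add_comp, plainConv_add_left]
  abel

theorem convProd_add_right (β : W₁ →ₗ[K] W₂ →ₗ[K] W₃) (F : SymAlg K E →ₗ[K] W₁)
    (G G' : SymAlg K E →ₗ[K] W₂) :
    convProd β F (G + G') = convProd β F G + convProd β F G' := by
  simp only [convProd_eq_plainConv, map_add, plainConv_add_right]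
  abel

theorem convProd_smul_left (β : W₁ →ₗ[K] W₂ →ₗ[K] W₃) (c : K) (F : SymAlg K E →ₗ[K] W₁)
    (G : SymAlg K E →ₗ[K] W₂) : convProd β (c • F) G = c • convProd β F G := by
  simp only [convProd_eq_plainConv, LinearMap.smul_comp, plainConv_smul_left, smul_add]

theorem convProd_smul_right (β : W₁ →ₗ[K] W₂ →ₗ[K] W₃) (c : K) (F : SymAlg K E →ₗ[K] W₁)
    (G : SymAlg K E →ₗ[K] W₂) : convProd β F (c • G) = c • convProd β F G := by
  simp only [convProd_eq_plainConv, map_smul, plainConv_smul_right, smul_add]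

/-- The product of series as a bilinear map of the two series. -/
def conv₂ (β : W₁ →ₗ[K] W₂ →ₗ[K] W₃) :
    (SymAlg K E →ₗ[K] W₁) →ₗ[K] (SymAlg K E →ₗ[K] W₂) →ₗ[K] (SymAlg K E →ₗ[K] W₃) :=
  LinearMap.mk₂ K (convProd β) (convProd_add_left β) (convProd_smul_left β)
    (convProd_add_right β) (convProd_smul_right β)

theorem conv₂_apply (β : W₁ →ₗ[K] W₂ →ₗ[K] W₃) (F : SymAlg K E →ₗ[K] W₁)
    (G : SymAlg K E →ₗ[K] W₂) : conv₂ β F G = convProd β F G := rfl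

theorem convProd_zero_left (β : W₁ →ₗ[K] W₂ →ₗ[K] W₃) (G : SymAlg K E →ₗ[K] W₂) :
    convProd β 0 G = 0 := by rw [← conv₂_apply, map_zero, LinearMap.zero_apply]

theorem convProd_zero_right (β : W₁ →ₗ[K] W₂ →ₗ[K] W₃) (F : SymAlg K E →ₗ[K] W₁) :
    convProd β F 0 = 0 := by rw [← conv₂_apply, map_zero]

theorem convProd_sub_left (β : W₁ →ₗ[K] W₂ →ₗ[K] W₃) (F F' : SymAlg K E →ₗ[K] W₁)
    (G : SymAlg K E →ₗ[K] W₂) : convProd β (F - F') G = convProd β F G - convProd β F' G := by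
  simp only [← conv₂_apply, map_sub, LinearMap.sub_apply]

theorem convProd_sub_right (β : W₁ →ₗ[K] W₂ →ₗ[K] W₃) (F : SymAlg K E →ₗ[K] W₁)
    (G G' : SymAlg K E →ₗ[K] W₂) :
    convProd β F (G - G') = convProd β F G - convProd β F G' := by
  simp only [← conv₂_apply, map_sub]

theorem convProd_neg_left (β : W₁ →ₗ[K] W₂ →ₗ[K] W₃) (F : SymAlg K E →ₗ[K] W₁)
    (G : SymAlg K E →ₗ[K] W₂) : convProd β (-F) G = -convProd β F G := by
  simp only [← conv₂_apply, map_neg, LinearMap.neg_apply]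

theorem convProd_neg_right (β : W₁ →ₗ[K] W₂ →ₗ[K] W₃) (F : SymAlg K E →ₗ[K] W₁)
    (G : SymAlg K E →ₗ[K] W₂) : convProd β F (-G) = -convProd β F G := by
  simp only [← conv₂_apply, map_neg]

/-- A product whose second factor is even involves no signs. -/
theorem convProd_of_even (β : W₁ →ₗ[K] W₂ →ₗ[K] W₃) (F : SymAlg K E →ₗ[K] W₁)
    {G : SymAlg K E →ₗ[K] W₂} (hG : IsHomog K 0 G) : convProd β F G = plainConv β F G := by
  rw [convProd_eq_plainConv, hG.comp_self, hG.comp_ne one_ne_zero,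
    plainConv_zero_right, add_zero]

theorem par_symL {i : ZMod 2} {e : E} (he : IsHomog K i e) (G : SymAlg K E →ₗ[K] W₂) :
    par K G ∘ₗ symL e = sgn K i • par K (G ∘ₗ symL e) := by
  rw [par_comp_hom, isHomog_symL (K := K) he, LinearMap.comp_smul, smul_smul, sgn_mul_self,
    one_smul]

/-- The operators `F ↦ F(e ·)`, for `e ∈ E` homogeneous, are twisted derivations of every product of
series. Together with the value at `1` this determines the product. -/
theorem convProd_symL (β : W₁ →ₗ[K] W₂ →ₗ[K] W₃) (F : SymAlg K E →ₗ[K] W₁)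
    (G : SymAlg K E →ₗ[K] W₂) {i : ZMod 2} {e : E} (he : IsHomog K i e) :
    convProd β F G ∘ₗ symL e = convProd β (F ∘ₗ symL e) (tw K i G) +
      convProd β F (G ∘ₗ symL e) := by
  have hL := isHomog_symL (K := K) he
  have z : symL (K := K) (0 : E) = 0 := by ext; simp
  rcases zmod_two_cases i with rfl | rfl
  · have hp : par K ∘ₗ symL (K := K) e = symL e ∘ₗ par K := by
      ext s; exact even_iff.1 hL s
    simp only [convProd_eq_plainConv, LinearMap.add_comp, plainConv_symL, he.comp_self,
      he.comp_ne one_ne_zero, tw_zero, comp_even_comp _ G hL, z, LinearMap.comp_zero,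
      LinearMap.comp_assoc, hp, plainConv_zero_right]
    abel
  · have hp : par K ∘ₗ symL (K := K) e = -(symL e ∘ₗ par K) := by
      ext s
      have h := isHomog_one_iff.1 hL
      have := LinearMap.congr_fun h (par K s)
      rw [par_hom_par] at this
      simpa using this
    have hpp : (par K : SymAlg K E →ₗ[K] SymAlg K E) ∘ₗ par K = LinearMap.id := by
      ext s; simp
    have c0 : comp K 0 (G ∘ₗ symL e) = comp K 1 G ∘ₗ symL e := by
      simp only [comp, LinearMap.smul_apply, LinearMap.add_apply, LinearMap.id_apply,
        par_comp_hom, isHomog_one_iff.1 hL, LinearMap.comp_neg, sgn_zero, sgn_one, one_smul,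
        LinearMap.smul_comp, LinearMap.add_comp, neg_smul, LinearMap.neg_comp]
    have c1 : comp K 1 (G ∘ₗ symL e) = comp K 0 G ∘ₗ symL e := by
      simp only [comp, LinearMap.smul_apply, LinearMap.add_apply, LinearMap.id_apply,
        par_comp_hom, isHomog_one_iff.1 hL, LinearMap.comp_neg, sgn_zero, sgn_one, one_smul,
        LinearMap.smul_comp, LinearMap.add_comp, neg_smul, neg_neg]
    simp only [convProd_eq_plainConv, LinearMap.add_comp, plainConv_symL, he.comp_self,
      he.comp_ne zero_ne_one, tw_one, c0, c1, z, LinearMap.comp_zero,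
      LinearMap.comp_assoc, hp, hpp, ← par_comp, par_comp_zero, par_comp_one,
      LinearMap.comp_neg, plainConv_zero_right, LinearMap.comp_id]
    have nl : ∀ (F : SymAlg K E →ₗ[K] W₁) (G : SymAlg K E →ₗ[K] W₂),
        plainConv β (-F) G = -plainConv β F G := fun F G => by
      simpa using plainConv_smul_left β (-1 : K) F G
    have nr : ∀ (F : SymAlg K E →ₗ[K] W₁) (G : SymAlg K E →ₗ[K] W₂),
        plainConv β F (-G) = -plainConv β F G := fun F G => by
      simpa using plainConv_smul_right β (-1 : K) F G
    simp only [nl, nr]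
    abel

/-- Naturality of the product in the coefficients. -/
theorem convProd_natural [SuperSpace K W₅] {β : W₁ →ₗ[K] W₂ →ₗ[K] W₃} {γ : W₄ →ₗ[K] W₅ →ₗ[K] W₆}
    {f : W₁ →ₗ[K] W₄} {g : W₂ →ₗ[K] W₅} {k : W₃ →ₗ[K] W₆} (hg : IsHomog K 0 g)
    (h : ∀ x y, k (β x y) = γ (f x) (g y)) (F : SymAlg K E →ₗ[K] W₁) (G : SymAlg K E →ₗ[K] W₂) :
    k ∘ₗ convProd β F G = convProd γ (f ∘ₗ F) (g ∘ₗ G) := by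
  have key : ∀ (F : SymAlg K E →ₗ[K] W₁) (G : SymAlg K E →ₗ[K] W₂),
      k ∘ₗ plainConv β F G = plainConv γ (f ∘ₗ F) (g ∘ₗ G) := fun F G => by
    rw [plainConv, plainConv, ← LinearMap.comp_assoc]
    congr 1
    ext a b
    simp [h]
  rw [convProd_eq_plainConv, convProd_eq_plainConv, LinearMap.comp_add, key, key,
    comp_comp_even _ hg, comp_comp_even _ hg, LinearMap.comp_assoc]

theorem tw_convProd [SuperSpace K W₁] [SuperSpace K W₃] {β : W₁ →ₗ[K] W₂ →ₗ[K] W₃}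
    (hβ : ∀ x y, par K (β x y) = β (par K x) (par K y)) (i : ZMod 2)
    (F : SymAlg K E →ₗ[K] W₁) (G : SymAlg K E →ₗ[K] W₂) :
    tw K i (convProd β F G) = convProd β (tw K i F) (tw K i G) := by
  rcases zmod_two_cases i with rfl | rfl
  · simp
  simp only [tw_one]
  ext s
  induction s using sym_induction generalizing F G with
  | one => simp [par_hom_apply', par_sym_one, convProd_one, hβ]
  | add a b ha hb => simp only [map_add, ha, hb]
  | smul c a ha => simp only [map_smul, ha]
  | mul j e s he ih =>
    have hL := isHomog_symL (K := K) he
    have hR := LinearMap.congr_fun (convProd_symL β (par K F) (par K G) he) s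
    have hl := LinearMap.congr_fun (convProd_symL β F G he) (par K s)
    rw [LinearMap.comp_apply, symL_apply] at hR hl
    rw [hR, par_symL he, par_symL he, tw_par, convProd_smul_left, convProd_smul_right, ← smul_add,
      LinearMap.smul_apply, LinearMap.add_apply, ← ih, ← ih, par_hom_apply', par_sym_mul,
      par_sym_ι, he, map_smul, smul_mul_assoc, map_smul, map_smul, hl, LinearMap.add_apply,
      map_add, par_hom_apply', par_hom_apply']

theorem IsHomog.convProd [SuperSpace K W₁] [SuperSpace K W₃] {β : W₁ →ₗ[K] W₂ →ₗ[K] W₃}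
    (hβ : ∀ x y, par K (β x y) = β (par K x) (par K y)) {p q : ZMod 2}
    {F : SymAlg K E →ₗ[K] W₁} {G : SymAlg K E →ₗ[K] W₂} (hF : IsHomog K p F)
    (hG : IsHomog K q G) : IsHomog K (p + q) (convProd β F G) := by
  have h := tw_convProd hβ 1 F G
  simp only [tw_one] at h
  unfold IsHomog at *
  rw [h, hF, hG, convProd_smul_left, convProd_smul_right, smul_smul, sgn_add]

theorem convProd_const_left (β : W₁ →ₗ[K] W₂ →ₗ[K] W₃) (x : W₁) (G : SymAlg K E →ₗ[K] W₂) :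
    convProd β (constSeries x) G = β x ∘ₗ G := by
  ext s
  induction s using sym_induction generalizing G with
  | one => simp [convProd_one]
  | add a b ha hb => simp only [map_add, ha, hb]
  | smul c a ha => simp only [map_smul, ha]
  | mul j e s he ih =>
    have h := LinearMap.congr_fun (convProd_symL β (constSeries x) G he) s
    rw [LinearMap.comp_apply, symL_apply] at h
    rw [h, constSeries_symL, convProd_zero_left, zero_add, ih]
    rfl

theorem convProd_const_right (β : W₁ →ₗ[K] W₂ →ₗ[K] W₃) {p : ZMod 2} {x : W₂} (hx : IsHomog K p x)
    (F : SymAlg K E →ₗ[K] W₁) :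
    convProd β F (constSeries x) = β.flip x ∘ₗ F ∘ₗ tw K p := by
  ext s
  induction s using sym_induction generalizing F with
  | one =>
    have : tw K p (1 : SymAlg K E) = 1 := by
      rcases zmod_two_cases p with rfl | rfl <;> simp [par_sym_one]
    simp [convProd_one, this]
  | add a b ha hb => simp only [map_add, ha, hb]
  | smul c a ha => simp only [map_smul, ha]
  | mul j e s he ih =>
    have h := LinearMap.congr_fun (convProd_symL β F (constSeries x) he) s
    rw [LinearMap.comp_apply, symL_apply] at h
    have h2 := (isHomog_symL (K := K) he).tw_apply p s
    rw [symL_apply] at h2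
    rw [h, constSeries_symL, convProd_zero_right, add_zero,
      tw_of_homog (isHomog_constSeries hx), convProd_smul_right, LinearMap.smul_apply, ih]
    simp only [LinearMap.comp_apply, h2, map_smul, mul_comm p j]

/-- Associativity of the product of series, for bilinear maps which associate on the coefficients.
-/
theorem convProd_assoc [SuperSpace K W₃] [SuperSpace K W₅]
    {β₁₂ : W₁ →ₗ[K] W₂ →ₗ[K] W₄} {β : W₄ →ₗ[K] W₃ →ₗ[K] W₆}
    {β₂₃ : W₂ →ₗ[K] W₃ →ₗ[K] W₅} {β' : W₁ →ₗ[K] W₅ →ₗ[K] W₆}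
    (hβ : ∀ x y, par K (β₂₃ x y) = β₂₃ (par K x) (par K y))
    (h : ∀ x y z, β (β₁₂ x y) z = β' x (β₂₃ y z))
    (F : SymAlg K E →ₗ[K] W₁) (G : SymAlg K E →ₗ[K] W₂) (H : SymAlg K E →ₗ[K] W₃) :
    convProd β (convProd β₁₂ F G) H = convProd β' F (convProd β₂₃ G H) := by
  ext s
  induction s using sym_induction generalizing F G H with
  | one => simp [convProd_one, h]
  | add a b ha hb => simp only [map_add, ha, hb]
  | smul c a ha => simp only [map_smul, ha]
  | mul i e s he ih =>
    have h1 := LinearMap.congr_fun (convProd_symL β (convProd β₁₂ F G) H he) s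
    have h2 := LinearMap.congr_fun (convProd_symL β' F (convProd β₂₃ G H) he) s
    rw [LinearMap.comp_apply, symL_apply] at h1 h2
    rw [h1, h2, convProd_symL _ _ _ he, convProd_symL _ _ _ he, tw_convProd hβ]
    simp only [convProd_add_left, convProd_add_right, LinearMap.add_apply, ih]
    abel

end Conv

/-! ### Coderivations -/

section Coder

variable {K : Type u} [Field K] [CharZero K] {E : Type v} [AddCommGroup E] [Module K E]
  [SuperSpace K E]

/-- The coderivation `s ↦ ∑ A(s₁) s₂` of `S(E)` with components `A : S(E) → E`; its transpose is the
vector field `∑ Aⁱ ∂/∂Xⁱ`. -/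
def coder (A : SymAlg K E →ₗ[K] E) : SymAlg K E →ₗ[K] SymAlg K E :=
  plainConv (LinearMap.mul K (SymAlg K E) ∘ₗ symι K E) A LinearMap.id

theorem coder_one (A : SymAlg K E →ₗ[K] E) : coder A 1 = symι K E (A 1) := by
  simp [coder, plainConv_one]

theorem coder_add (A B : SymAlg K E →ₗ[K] E) : coder (A + B) = coder A + coder B :=
  plainConv_add_left _ _ _ _

theorem coder_smul (c : K) (A : SymAlg K E →ₗ[K] E) : coder (c • A) = c • coder A :=
  plainConv_smul_left _ _ _ _

theorem coder_sub (A B : SymAlg K E →ₗ[K] E) : coder (A - B) = coder A - coder B := by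
  rw [sub_eq_add_neg, coder_add, ← neg_one_smul K B, coder_smul, neg_one_smul K (coder B),
    ← sub_eq_add_neg]

theorem coder_symL (A : SymAlg K E →ₗ[K] E) {i : ZMod 2} {e : E} (he : IsHomog K i e) :
    coder A ∘ₗ symL e = coder (A ∘ₗ symL e) + symL e ∘ₗ coder (tw K i A) := by
  have z : symL (K := K) (0 : E) = 0 := by ext; simp
  have key : plainConv (LinearMap.mul K (SymAlg K E) ∘ₗ symι K E) (A ∘ₗ tw K i) (symL e) =
      symL e ∘ₗ coder (tw K i A) := by
    rw [coder, plainConv, plainConv, ← LinearMap.comp_assoc]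
    congr 1
    ext a b
    simp only [TensorProduct.AlgebraTensorModule.curry_apply, LinearMap.restrictScalars_self,
      TensorProduct.curry_apply, TensorProduct.lift.tmul, LinearMap.compl₁₂_apply,
      LinearMap.comp_apply, LinearMap.mul_apply', symL_apply, LinearMap.id_apply]
    rw [← mul_assoc, symι_mul_comm he, ← tw_hom_tw, tw_tw, mul_assoc]
    rcases zmod_two_cases i with rfl | rfl
    · simp
    · rw [show (1 : ZMod 2) + 1 = 0 from rfl, tw_zero]
  rw [← key]
  unfold coder
  rw [plainConv_symL]
  rcases zmod_two_cases i with rfl | rfl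
  · rw [he.comp_self, he.comp_ne one_ne_zero, z, LinearMap.comp_zero, LinearMap.id_comp,
      plainConv_zero_right, add_zero]
    congr 2
  · rw [he.comp_self, he.comp_ne zero_ne_one, z, LinearMap.comp_zero, LinearMap.id_comp,
      plainConv_zero_right, add_zero]
    congr 2

theorem coder_par (A : SymAlg K E →ₗ[K] E) : coder (par K A) = par K (coder A) := by
  ext s
  induction s using sym_induction generalizing A with
  | one => simp [par_hom_apply', coder_one, par_sym_one, par_sym_ι]
  | add a b ha hb => simp only [map_add, ha, hb]
  | smul c a ha => simp only [map_smul, ha]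
  | mul i e s he ih =>
    have h1 := LinearMap.congr_fun (coder_symL (par K A) he) s
    have h2 := LinearMap.congr_fun (coder_symL A he) (par K s)
    simp only [LinearMap.comp_apply, LinearMap.add_apply, symL_apply] at h1 h2
    rw [h1, par_symL he, coder_smul, LinearMap.smul_apply, tw_par, ih, ih, par_hom_apply',
      par_hom_apply', par_hom_apply', par_sym_mul, par_sym_ι, he, map_smul, smul_mul_assoc,
      map_smul, map_smul, h2, map_add, par_sym_mul, par_sym_ι, he, map_smul, smul_mul_assoc,
      smul_add, smul_smul,
      sgn_mul_self, one_smul]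

theorem isHomog_coder {p : ZMod 2} {A : SymAlg K E →ₗ[K] E} (h : IsHomog K p A) :
    IsHomog K p (coder A) := by
  unfold IsHomog at *
  rw [← coder_par, h, coder_smul]

@[simp] theorem counit_coder (A : SymAlg K E →ₗ[K] E) (s : SymAlg K E) :
    counit (coder A s) = 0 := by
  induction s using sym_induction generalizing A with
  | one => simp [coder_one]
  | add a b ha hb => simp only [map_add, ha, hb, add_zero]
  | smul c a ha => simp only [map_smul, ha, smul_zero]
  | mul i e s he ih =>
    have h1 := LinearMap.congr_fun (coder_symL A he) s
    simp only [LinearMap.comp_apply, LinearMap.add_apply, symL_apply] at h1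
    simp [h1, ih]

theorem constSeries_coder {W : Type*} [AddCommGroup W] [Module K W] (x : W)
    (A : SymAlg K E →ₗ[K] E) : constSeries x ∘ₗ coder A = 0 := by
  ext s; simp [constSeries_apply]

theorem symOne_coder (A : SymAlg K E →ₗ[K] E) : symOne ∘ₗ coder A = A := by
  ext s
  induction s using sym_induction generalizing A with
  | one =>
    have h := symOne_ι_mul (K := K) (A 1) 1
    simp only [mul_one, map_one, one_smul] at h
    simp [coder_one, h]
  | add a b ha hb => simp only [map_add, ha, hb]
  | smul c a ha => simp only [map_smul, ha]
  | mul i e s he ih =>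
    have h1 := LinearMap.congr_fun (coder_symL A he) s
    simp only [LinearMap.comp_apply, LinearMap.add_apply, symL_apply] at h1 ih ⊢
    rw [h1, map_add, ih]
    simp

variable {W₁ W₂ W₃ : Type*}
  [AddCommGroup W₁] [Module K W₁] [AddCommGroup W₂] [Module K W₂] [SuperSpace K W₂]
  [AddCommGroup W₃] [Module K W₃]

theorem comp_coder_symL {i p : ZMod 2} {e : E} {A : SymAlg K E →ₗ[K] E}
    (F : SymAlg K E →ₗ[K] W₁) (hA : IsHomog K p A) (he : IsHomog K i e) :
    (F ∘ₗ coder A) ∘ₗ symL e = F ∘ₗ coder (A ∘ₗ symL e) +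
      sgn K (i * p) • ((F ∘ₗ symL e) ∘ₗ coder A) := by
  rw [LinearMap.comp_assoc, coder_symL A he, tw_of_homog hA, coder_smul, LinearMap.comp_add,
    LinearMap.comp_smul, LinearMap.comp_smul, LinearMap.comp_assoc]

/-- Coderivations act on products of series from the right as twisted derivations. -/
theorem convProd_coder (β : W₁ →ₗ[K] W₂ →ₗ[K] W₃) (F : SymAlg K E →ₗ[K] W₁)
    (G : SymAlg K E →ₗ[K] W₂) {p : ZMod 2} {A : SymAlg K E →ₗ[K] E} (hA : IsHomog K p A) :
    convProd β F G ∘ₗ coder A = convProd β (F ∘ₗ coder A) (tw K p G) +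
      convProd β F (G ∘ₗ coder A) := by
  ext s
  induction s using sym_induction generalizing F G p A with
  | one =>
    have h := LinearMap.congr_fun (convProd_symL β F G (hA.apply (q := 0) (x := 1) (by
      simp [IsHomog, par_sym_one]))) 1
    have h0 : ∀ i, tw K i (1 : SymAlg K E) = 1 := fun i =>
      tw_apply_eq_self (by simp [IsHomog, par_sym_one]) i
    simp only [LinearMap.comp_apply, LinearMap.add_apply, symL_apply, mul_one, add_zero] at h
    simp only [LinearMap.comp_apply, coder_one, h, LinearMap.add_apply, convProd_one, symL_apply,
      mul_one]
  | add a b ha hb => rw [map_add, map_add, ha F G hA, hb F G hA]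
  | smul c a ha => rw [map_smul, map_smul, ha F G hA]
  | mul i e s he ih =>
    have hL := isHomog_symL (K := K) he
    have hD := isHomog_coder hA
    have hG : tw K p (G ∘ₗ symL e) = sgn K (p * i) • (tw K p G ∘ₗ symL e) :=
      tw_comp_of_homog p G hL
    change ((convProd β F G ∘ₗ coder A) ∘ₗ symL e) s =
      ((convProd β (F ∘ₗ coder A) (tw K p G)) ∘ₗ symL e) s +
        ((convProd β F (G ∘ₗ coder A)) ∘ₗ symL e) s
    rw [comp_coder_symL _ hA he, LinearMap.add_apply, ih F G (hA.comp_hom hL), LinearMap.smul_apply,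
      convProd_symL _ F G he, LinearMap.add_comp, LinearMap.add_apply, LinearMap.add_apply,
      ih _ _ hA, ih _ _ hA,
      convProd_symL _ _ _ he, convProd_symL _ _ _ he, comp_coder_symL F hA he,
      comp_coder_symL G hA he, tw_comp_of_homog i G hD, hG, tw_tw, tw_tw, add_comm i p,
      mul_comm p i]
    simp only [convProd_add_left, convProd_add_right, convProd_smul_left, convProd_smul_right,
      LinearMap.add_apply, LinearMap.smul_apply, smul_add, smul_smul, sgn_mul_self, one_smul]
    abel

/-- The supercommutator of two coderivations is the coderivation whose components are the
commutator of the corresponding vector fields. -/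
theorem coder_commutator {p q : ZMod 2} {A B : SymAlg K E →ₗ[K] E} (hA : IsHomog K p A)
    (hB : IsHomog K q B) :
    coder A ∘ₗ coder B - sgn K (p * q) • (coder B ∘ₗ coder A) =
      coder (A ∘ₗ coder B - sgn K (p * q) • (B ∘ₗ coder A)) := by
  ext s
  induction s using sym_induction generalizing p q A B with
  | one =>
    have h : ∀ {p q : ZMod 2} {A B : SymAlg K E →ₗ[K] E}, IsHomog K p A → IsHomog K q B →
        coder A (symι K E (B 1)) = symι K E (A (symι K E (B 1))) +
          sgn K (p * q) • (symι K E (B 1) * symι K E (A 1)) := by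
      intro p q A B hA hB
      have hB1 : IsHomog K q (B 1) := by
        simpa using hB.apply (q := 0) (x := 1) (by simp [IsHomog, par_sym_one])
      have := LinearMap.congr_fun (coder_symL A hB1) 1
      simp only [LinearMap.comp_apply, LinearMap.add_apply, symL_apply, mul_one, coder_one] at this
      rw [this, tw_of_homog hA, LinearMap.smul_apply, map_smul, mul_smul_comm, mul_comm q p]
    have hB1 : IsHomog K q (B 1) := by
      simpa using hB.apply (q := 0) (x := 1) (by simp [IsHomog, par_sym_one])
    have hA1 : IsHomog K p (A 1) := by
      simpa using hA.apply (q := 0) (x := 1) (by simp [IsHomog, par_sym_one])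
    have hc := symι_mul_comm (K := K) hB1 (A 1)
    rw [tw_of_homog hA1, map_smul, mul_smul_comm, mul_comm q p] at hc
    simp only [LinearMap.sub_apply, LinearMap.comp_apply, LinearMap.smul_apply, coder_one,
      h hA hB, h hB hA, smul_add, smul_smul, mul_comm q p, sgn_mul_self, one_smul, map_sub,
      map_smul, hc]
    abel
  | add a b ha hb => rw [map_add, map_add, ha hA hB, hb hA hB]
  | smul c a ha => rw [map_smul, map_smul, ha hA hB]
  | mul i e s he ih =>
    have hL := isHomog_symL (K := K) he
    have hA' := hA.comp_hom hL
    have hB' := hB.comp_hom hL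
    have i1 := ih hA hB
    have i2 := ih hA' hB
    have i3 := ih hA hB'
    change ((coder A ∘ₗ coder B - sgn K (p * q) • (coder B ∘ₗ coder A)) ∘ₗ symL e) s =
      ((coder (A ∘ₗ coder B - sgn K (p * q) • (B ∘ₗ coder A))) ∘ₗ symL e) s
    have hC : IsHomog K (p + q) (A ∘ₗ coder B - sgn K (p * q) • (B ∘ₗ coder A)) :=
      (hA.comp_hom (isHomog_coder hB)).sub
        ((add_comm p q ▸ hB.comp_hom (isHomog_coder hA)).smul _)
    have e1 : (A ∘ₗ coder B - sgn K (p * q) • (B ∘ₗ coder A)) ∘ₗ symL e =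
        (A ∘ₗ coder (B ∘ₗ symL e) - sgn K (p * (q + i)) • ((B ∘ₗ symL e) ∘ₗ coder A)) +
        sgn K (i * q) • ((A ∘ₗ symL e) ∘ₗ coder B -
          sgn K ((p + i) * q) • (B ∘ₗ coder (A ∘ₗ symL e))) := by
      rw [LinearMap.sub_comp, LinearMap.smul_comp, comp_coder_symL _ hA he,
        comp_coder_symL _ hB he]
      simp only [mul_add, add_mul, sgn_add, smul_add, smul_sub, smul_smul]
      rw [show sgn K (i * q) * (sgn K (p * q) * sgn K (i * q)) = sgn K (p * q) by
        rw [mul_left_comm, sgn_mul_self, mul_one], mul_comm p i]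
      abel
    rw [coder_symL _ he, tw_of_homog hC, e1]
    simp only [coder_add, coder_smul, LinearMap.add_apply, LinearMap.smul_apply, ← i2, ← i3,
      LinearMap.sub_comp, LinearMap.smul_comp, LinearMap.comp_smul]
    rw [LinearMap.comp_apply (symL e), ← i1, comp_coder_symL _ hA he, comp_coder_symL _ hB he,
      coder_symL _ he, coder_symL _ he,
      tw_of_homog hA, tw_of_homog hB, coder_smul, coder_smul]
    simp only [LinearMap.sub_apply, LinearMap.comp_apply, LinearMap.add_apply,
      LinearMap.smul_apply, symL_apply, mul_add, add_mul, sgn_add, smul_add, smul_sub, smul_smul,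
      mul_sub, mul_smul_comm, map_smul]
    rw [mul_comm p i]
    rcases zmod_two_cases i with rfl | rfl <;> rcases zmod_two_cases p with rfl | rfl <;>
      rcases zmod_two_cases q with rfl | rfl <;> simp <;> abel

end Coder

/-! ### Supercommutativity of the product of series -/

section Swap

variable {K : Type u} [Field K] [CharZero K] {E : Type v} [AddCommGroup E] [Module K E]
  [SuperSpace K E]
variable {W₁ W₂ W₃ : Type*}
  [AddCommGroup W₁] [Module K W₁] [SuperSpace K W₁]
  [AddCommGroup W₂] [Module K W₂] [SuperSpace K W₂]
  [AddCommGroup W₃] [Module K W₃]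

/-- The bilinear map `(x, y) ↦ (-1)^{|x||y|} β(y, x)`. -/
def superFlip (β : W₂ →ₗ[K] W₁ →ₗ[K] W₃) : W₁ →ₗ[K] W₂ →ₗ[K] W₃ :=
  ∑ i : ZMod 2, ∑ j : ZMod 2, sgn K (i * j) • β.flip.compl₁₂ (comp K j) (comp K i)

theorem superFlip_apply (β : W₂ →ₗ[K] W₁ →ₗ[K] W₃) (x : W₁) (y : W₂) :
    superFlip β x y = ∑ i : ZMod 2, ∑ j : ZMod 2, sgn K (i * j) • β (comp K i y) (comp K j x) := by
  simp [superFlip]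

theorem superFlip_homog (β : W₂ →ₗ[K] W₁ →ₗ[K] W₃) {p q : ZMod 2} {x : W₁} {y : W₂}
    (hx : IsHomog K p x) (hy : IsHomog K q y) : superFlip β x y = sgn K (p * q) • β y x := by
  rw [superFlip_apply, hy.sum_comp (fun i y => ∑ j : ZMod 2, sgn K (i * j) • β y (comp K j x))
    (fun i => by simp), hx.sum_comp (fun j x => sgn K (q * j) • β y x) (fun i => by simp), mul_comm]

/-- The products of series inherit supercommutativity. -/
theorem convProd_superFlip (β : W₂ →ₗ[K] W₁ →ₗ[K] W₃) {p q : ZMod 2} {F : SymAlg K E →ₗ[K] W₁}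
    {G : SymAlg K E →ₗ[K] W₂} (hF : IsHomog K p F) (hG : IsHomog K q G) :
    convProd (superFlip β) F G = sgn K (p * q) • convProd β G F := by
  ext s
  induction s using sym_induction generalizing p q F G with
  | one =>
    have h1 : IsHomog K 0 (1 : SymAlg K E) := by simp [IsHomog, par_sym_one]
    have hF1 := hF.apply h1
    have hG1 := hG.apply h1
    rw [add_zero] at hF1 hG1
    rw [LinearMap.smul_apply, convProd_one, convProd_one, superFlip_homog β hF1 hG1]
  | add a b ha hb => rw [map_add, map_add, ha hF hG, hb hF hG]
  | smul c a ha => rw [map_smul, map_smul, ha hF hG]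
  | mul i e s he ih =>
    have hL := isHomog_symL (K := K) he
    have h1 := LinearMap.congr_fun (convProd_symL (superFlip β) F G he) s
    have h2 := LinearMap.congr_fun (convProd_symL β G F he) s
    simp only [LinearMap.comp_apply, LinearMap.add_apply, symL_apply] at h1 h2
    rw [h1, LinearMap.smul_apply, h2, tw_of_homog hG, tw_of_homog hF, convProd_smul_right,
      convProd_smul_right, LinearMap.smul_apply, LinearMap.smul_apply, ih (hF.comp_hom hL) hG,
      ih hF (hG.comp_hom hL), LinearMap.smul_apply, LinearMap.smul_apply, add_mul, mul_add,
      sgn_add, sgn_add, smul_add, smul_smul, smul_smul, add_comm, mul_comm p i]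
    congr 2
    rw [mul_left_comm, sgn_mul_self, mul_one]

theorem convProd_superFlip_of_even_right (β : W₂ →ₗ[K] W₁ →ₗ[K] W₃) (F : SymAlg K E →ₗ[K] W₁)
    {G : SymAlg K E →ₗ[K] W₂} (hG : IsHomog K 0 G) :
    convProd (superFlip β) F G = convProd β G F := by
  have h : ∀ i, convProd (superFlip β) (comp K i F) G = convProd β G (comp K i F) := fun i => by
    rw [convProd_superFlip β (isHomog_comp i F) hG, mul_zero, sgn_zero, one_smul]
  rw [← comp_add (K := K) F, convProd_add_left, convProd_add_right, h, h]

theorem convProd_congr {β β' : W₁ →ₗ[K] W₂ →ₗ[K] W₃} (h : ∀ x y, β x y = β' x y)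
    (F : SymAlg K E →ₗ[K] W₁) (G : SymAlg K E →ₗ[K] W₂) : convProd β F G = convProd β' F G := by
  congr 1; ext x y; exact h x y

theorem convProd_add_bil (β β' : W₁ →ₗ[K] W₂ →ₗ[K] W₃)
    (F : SymAlg K E →ₗ[K] W₁) (G : SymAlg K E →ₗ[K] W₂) :
    convProd (β + β') F G = convProd β F G + convProd β' F G := by
  rw [convProd, convProd, convProd, ← LinearMap.add_comp]
  congr 1
  ext a b
  simp only [sum_sgn, TensorProduct.AlgebraTensorModule.curry_apply, LinearMap.restrictScalars_self,
    TensorProduct.curry_apply, LinearMap.add_apply, LinearMap.sub_apply, TensorProduct.lift.tmul,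
    LinearMap.compl₁₂_apply, LinearMap.comp_apply]
  abel

theorem convProd_smul_bil (c : K) (β : W₁ →ₗ[K] W₂ →ₗ[K] W₃)
    (F : SymAlg K E →ₗ[K] W₁) (G : SymAlg K E →ₗ[K] W₂) :
    convProd (c • β) F G = c • convProd β F G := by
  rw [convProd, convProd, ← LinearMap.smul_comp]
  congr 1
  ext a b
  simp only [sum_sgn, TensorProduct.AlgebraTensorModule.curry_apply, LinearMap.restrictScalars_self,
    TensorProduct.curry_apply, LinearMap.add_apply, LinearMap.sub_apply, TensorProduct.lift.tmul,
    LinearMap.compl₁₂_apply, LinearMap.comp_apply, LinearMap.smul_apply, smul_sub, smul_add]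

theorem convProd_sub_bil (β β' : W₁ →ₗ[K] W₂ →ₗ[K] W₃)
    (F : SymAlg K E →ₗ[K] W₁) (G : SymAlg K E →ₗ[K] W₂) :
    convProd (β - β') F G = convProd β F G - convProd β' F G := by
  have h := convProd_add_bil (β - β') β' F G
  rw [sub_add_cancel] at h
  rw [h, add_sub_cancel_right]

end Swap

section TensorSuper

variable {K : Type u} [Field K]
  {V : Type v} [AddCommGroup V] [Module K V] [SuperSpace K V]
  {W : Type w} [AddCommGroup W] [Module K W] [SuperSpace K W]

/-- The parity operator of a tensor product of superspaces is the tensor product of the parity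
operators. -/
instance instSuperTensor : SuperSpace K (V ⊗[K] W) where
  par := TensorProduct.map (par K) (par K)
  par_par x := by
    induction x with
    | zero => simp
    | add a b ha hb => rw [map_add, map_add, ha, hb]
    | tmul a b => simp

theorem par_tmul (x : V) (y : W) : par K (x ⊗ₜ[K] y) = par K x ⊗ₜ[K] par K y :=
  TensorProduct.map_tmul _ _ _ _

end TensorSuper

section Rules

variable {K : Type u} [Field K] [CharZero K] {E : Type v} [AddCommGroup E] [Module K E]
  [SuperSpace K E]
variable {L M N : Type*}
  [AddCommGroup L] [Module K L] [SuperSpace K L]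
  [AddCommGroup M] [Module K M] [SuperSpace K M]
  [AddCommGroup N] [Module K N]

/-- A left action of a bracket extends to series. -/
theorem convProd_left_action {b : L →ₗ[K] L →ₗ[K] L} {a : L →ₗ[K] M →ₗ[K] M}
    (ha : ∀ x y, par K (a x y) = a (par K x) (par K y))
    (h : ∀ x y z, a (b x y) z = a x (a y z) -
      ∑ i : ZMod 2, ∑ j : ZMod 2, sgn K (i * j) • a (comp K i y) (a (comp K j x) z))
    {p q : ZMod 2} {F G : SymAlg K E →ₗ[K] L} (hF : IsHomog K p F) (hG : IsHomog K q G)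
    (H : SymAlg K E →ₗ[K] M) :
    convProd a (convProd b F G) H =
      convProd a F (convProd a G H) - sgn K (p * q) • convProd a G (convProd a F H) := by
  let m : L ⊗[K] L →ₗ[K] M →ₗ[K] M := TensorProduct.lift (LinearMap.mk₂ K (fun x y => a x ∘ₗ a y)
    (fun x x' y => by ext; simp) (fun c x y => by ext; simp) (fun x y y' => by ext; simp)
    (fun c x y => by ext; simp))
  have hm : ∀ x y z, m (x ⊗ₜ y) z = a x (a y z) := fun x y z => by simp [m]
  let l : L →ₗ[K] L →ₗ[K] (M →ₗ[K] M) := LinearMap.compr₂ (TensorProduct.mk K L L) m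
  have hl : ∀ x y z, l x y z = a x (a y z) := fun x y z => by simp [l, hm]
  have hL : ∀ F G : SymAlg K E →ₗ[K] L,
      convProd (LinearMap.id : (M →ₗ[K] M) →ₗ[K] M →ₗ[K] M) (convProd l F G) H =
      convProd a F (convProd a G H) := fun F G => convProd_assoc ha (fun x y z => by simp [hl]) F G H
  have hb : a ∘ₗ convProd b F G = convProd (l - superFlip l) F G := by
    have := convProd_natural (K := K) (β := b) (γ := l - superFlip l) (f := LinearMap.id)
      (g := LinearMap.id) (k := a) (isHomog_zero_iff.2 (by ext; simp [par_hom_apply']))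
      (fun x y => by
        ext z
        simp only [h, LinearMap.sub_apply, superFlip_apply, LinearMap.sum_apply,
          LinearMap.smul_apply, hl, LinearMap.id_apply]) F G
    simpa using this
  have hn : convProd a (convProd b F G) H =
      convProd (LinearMap.id : (M →ₗ[K] M) →ₗ[K] M →ₗ[K] M) (a ∘ₗ convProd b F G) H := by
    have := convProd_natural (K := K) (β := a) (γ := LinearMap.id) (f := a)
      (g := LinearMap.id) (k := LinearMap.id) (isHomog_zero_iff.2 (by ext; simp [par_hom_apply']))
      (fun x y => rfl) (convProd b F G) H
    simpa using this
  rw [hn, hb, convProd_sub_bil, convProd_superFlip l hF hG, convProd_sub_left, convProd_smul_left,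
    hL, hL]

/-- A right action of a bracket extends to series. -/
theorem convProd_right_action {b : L →ₗ[K] L →ₗ[K] L} {a : N →ₗ[K] L →ₗ[K] N}
    (h : ∀ z x y, a z (b x y) = a (a z x) y -
      ∑ i : ZMod 2, ∑ j : ZMod 2, sgn K (i * j) • a (a z (comp K i y)) (comp K j x))
    {p q : ZMod 2} {F G : SymAlg K E →ₗ[K] L} (hF : IsHomog K p F) (hG : IsHomog K q G)
    (hb : ∀ x y, par K (b x y) = b (par K x) (par K y)) (H : SymAlg K E →ₗ[K] N) :
    convProd a H (convProd b F G) =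
      convProd a (convProd a H F) G - sgn K (p * q) • convProd a (convProd a H G) F := by
  let m : N →ₗ[K] L ⊗[K] L →ₗ[K] N := (TensorProduct.lift (LinearMap.mk₂ K
    (fun x y => a.flip y ∘ₗ a.flip x)
    (fun x x' y => by ext; simp) (fun c x y => by ext; simp) (fun x y y' => by ext; simp)
    (fun c x y => by ext; simp))).flip
  have hm : ∀ x y z, m z (x ⊗ₜ y) = a (a z x) y := fun x y z => by simp [m]
  have hL : ∀ F G : SymAlg K E →ₗ[K] L,
      convProd a (convProd a H F) G = convProd m H (convProd (TensorProduct.mk K L L) F G) :=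
    fun F G => convProd_assoc (fun x y => par_tmul x y) (fun x y z => by simp [hm]) H F G
  have key : convProd a H (convProd b F G) =
      convProd m H (convProd (TensorProduct.mk K L L - superFlip (TensorProduct.mk K L L)) F G) := by
    let a' : N →ₗ[K] L →ₗ[K] L →ₗ[K] N := LinearMap.mk₂ K (fun z x => a z ∘ₗ b x)
      (fun x x' y => by ext; simp) (fun c x y => by ext; simp) (fun x y y' => by ext; simp)
      (fun c x y => by ext; simp)
    have hsf : ∀ x y : L, par K (superFlip (TensorProduct.mk K L L) x y) =
        superFlip (TensorProduct.mk K L L) (par K x) (par K y) := fun x y => by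
      simp only [superFlip_apply, map_sum, map_smul, TensorProduct.mk_apply, par_tmul, par_comp]
    have e1 : convProd a H (convProd b F G) =
        convProd LinearMap.id (convProd a' H F) G :=
      (convProd_assoc hb (fun x y z => rfl) H F G).symm
    have e2 : convProd LinearMap.id (convProd a' H F) G = convProd m H
        (convProd (TensorProduct.mk K L L - superFlip (TensorProduct.mk K L L)) F G) :=
      convProd_assoc (fun x y => by simp only [LinearMap.sub_apply, map_sub, hsf,
          TensorProduct.mk_apply, par_tmul])
        (fun x y z => by
          simp only [LinearMap.sub_apply, superFlip_apply, map_sub, map_sum, map_smul,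
            TensorProduct.mk_apply, hm]
          exact h x y z) H F G
    rw [e1, e2]
  rw [key, convProd_sub_bil, convProd_superFlip _ hF hG, convProd_sub_right, convProd_smul_right,
    hL, hL]

/-- A supercommutator identity extends to series. -/
theorem convProd_commutator {b : L →ₗ[K] L →ₗ[K] M} {c : L →ₗ[K] L →ₗ[K] M}
    (h : ∀ x y, b x y = c x y -
      ∑ i : ZMod 2, ∑ j : ZMod 2, sgn K (i * j) • c (comp K i y) (comp K j x))
    {p q : ZMod 2} {F G : SymAlg K E →ₗ[K] L} (hF : IsHomog K p F) (hG : IsHomog K q G) :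
    convProd b F G = convProd c F G - sgn K (p * q) • convProd c G F := by
  rw [← convProd_superFlip c hF hG, ← convProd_sub_bil]
  exact convProd_congr (fun x y => by
    rw [h, LinearMap.sub_apply, LinearMap.sub_apply, superFlip_apply]) F G

end Rules

section Lie

variable {K : Type u} [Field K] [CharZero K] {E : Type v} [AddCommGroup E] [Module K E]
  [SuperSpace K E] {g : Type w} [AddCommGroup g] [Module K g] [SuperSpace K g] [LieSuper K g]

theorem br_skew_homog {p q : ZMod 2} {x y : g} (hx : IsHomog K p x) (hy : IsHomog K q y) :
    br K x y = -(sgn K (p * q) • br K y x) := by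
  rw [br, LieSuper.skew]
  rw [hy.sum_comp (fun i y => ∑ j : ZMod 2, sgn K (i * j) • br K y (comp K j x))
    (fun i => by simp), hx.sum_comp (fun j x => sgn K (q * j) • br K y x) (fun i => by simp),
    mul_comm]

theorem IsHomog.br {p q : ZMod 2} {x y : g} (hx : IsHomog K p x) (hy : IsHomog K q y) :
    IsHomog K (p + q) (SuperRep.br K x y) := by
  unfold IsHomog at *
  rw [SuperRep.br, LieSuper.par_br, hx, hy, sgn_add, map_smul, map_smul, LinearMap.smul_apply,
    smul_smul, mul_comm]

theorem br_leibniz_homog {p q : ZMod 2} {x y : g} (hx : IsHomog K p x) (hy : IsHomog K q y) (z : g) :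
    br K (br K x y) z = br K x (br K y z) - sgn K (p * q) • br K y (br K x z) := by
  have key : ∀ (r : ZMod 2) (z : g), IsHomog K r z →
      br K (br K x y) z = br K x (br K y z) - sgn K (p * q) • br K y (br K x z) := by
    intro r z hz
    have h := LieSuper.jacobi (K := K) p q r x y z
    rw [hx.comp_self, hy.comp_self, hz.comp_self] at h
    have h1 := br_skew_homog hz hx
    have h2 := br_skew_homog hz (hx.br hy)
    have h3 : br K z (br K x y) = -(sgn K (r * (p + q)) • br K (br K x y) z) := h2
    change sgn K (p * r) • br K x (br K y z) + sgn K (q * p) • br K y (br K z x) +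
      sgn K (r * q) • br K z (br K x y) = 0 at h
    rw [h1, h3, map_neg, map_smul] at h
    have h4 := congrArg (fun t => sgn K (p * r) • t) h
    simp only [smul_add, smul_neg, smul_smul, smul_zero, mul_add, sgn_add, mul_comm r p,
      mul_comm q p, mul_comm r q] at h4
    have e1 : sgn K (p * r) * sgn K (p * r) = 1 := sgn_mul_self _
    have e2 : sgn K (p * r) * (sgn K (p * q) * sgn K (p * r)) = sgn K (p * q) := by
      rw [mul_left_comm, e1, mul_one]
    have e3 : sgn K (p * r) * (sgn K (q * r) * (sgn K (p * r) * sgn K (q * r))) = 1 := by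
      rw [mul_left_comm (sgn K (q * r)), sgn_mul_self, mul_one, e1]
    simp only [e1, e2, e3, one_smul] at h4
    rw [eq_comm, ← sub_eq_zero, ← h4]
    abel
  have h0 := key 0 _ (isHomog_comp 0 z)
  have h1 := key 1 _ (isHomog_comp 1 z)
  rw [← comp_add (K := K) z]
  simp only [map_add, h0, h1, smul_add]
  abel

theorem br_leibniz (x y z : g) : br K (br K x y) z = br K x (br K y z) -
    ∑ i : ZMod 2, ∑ j : ZMod 2, sgn K (i * j) • br K (comp K i y) (br K (comp K j x) z) := by
  have h : ∀ i j : ZMod 2, br K (br K (comp K i x) (comp K j y)) z =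
      br K (comp K i x) (br K (comp K j y) z) -
        sgn K (i * j) • br K (comp K j y) (br K (comp K i x) z) := fun i j =>
    br_leibniz_homog (isHomog_comp i x) (isHomog_comp j y) z
  have e : br K (br K x y) z = ∑ i : ZMod 2, ∑ j : ZMod 2,
      br K (br K (comp K i x) (comp K j y)) z := by
    simp only [sum_zmod_two]
    conv_lhs => rw [← comp_add (K := K) x, ← comp_add (K := K) y]
    simp only [map_add, LinearMap.add_apply]
    abel
  have e' : br K x (br K y z) = ∑ i : ZMod 2, ∑ j : ZMod 2,
      br K (comp K i x) (br K (comp K j y) z) := by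
    simp only [sum_zmod_two]
    conv_lhs => rw [← comp_add (K := K) x, ← comp_add (K := K) y]
    simp only [map_add, LinearMap.add_apply]
    abel
  rw [e, e', Finset.sum_comm (f := fun i j => sgn K (i * j) • br K (comp K i y)
    (br K (comp K j x) z)), ← Finset.sum_sub_distrib]
  refine Finset.sum_congr rfl fun i _ => ?_
  rw [← Finset.sum_sub_distrib]
  refine Finset.sum_congr rfl fun j _ => ?_
  rw [h, mul_comm j i]

/-- The bracket of `g`-valued series. -/
abbrev serBr (F G : SymAlg K E →ₗ[K] g) : SymAlg K E →ₗ[K] g := convProd (br K) F G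

theorem serBr_leibniz {p q : ZMod 2} {F G : SymAlg K E →ₗ[K] g} (hF : IsHomog K p F)
    (hG : IsHomog K q G) (H : SymAlg K E →ₗ[K] g) :
    serBr (serBr F G) H = serBr F (serBr G H) - sgn K (p * q) • serBr G (serBr F H) :=
  convProd_left_action LieSuper.par_br br_leibniz hF hG H

theorem serBr_skew {p q : ZMod 2} {F G : SymAlg K E →ₗ[K] g} (hF : IsHomog K p F)
    (hG : IsHomog K q G) : serBr F G = -(sgn K (p * q) • serBr G F) := by
  rw [← convProd_superFlip (br K) hF hG, ← neg_one_smul K, ← convProd_smul_bil]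
  exact convProd_congr (fun x y => by
    rw [LinearMap.smul_apply, LinearMap.smul_apply, superFlip_apply, neg_one_smul]
    exact LieSuper.skew x y) F G

theorem isHomog_serBr {p q : ZMod 2} {F G : SymAlg K E →ₗ[K] g} (hF : IsHomog K p F)
    (hG : IsHomog K q G) : IsHomog K (p + q) (serBr F G) :=
  IsHomog.convProd LieSuper.par_br hF hG

end Lie

/-! ### The degree filtration -/

section Fil

variable {K : Type u} [Field K] {E : Type v} [AddCommGroup E] [Module K E]
  [SuperSpace K E]

/-- The subspace `S⁰(E) ⊕ ⋯ ⊕ Sⁿ(E)` of `S(E)`. -/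
def fil (K : Type u) [Field K] (E : Type v) [AddCommGroup E] [Module K E] [SuperSpace K E] (n : ℕ) :
    Submodule K (SymAlg K E) :=
  (1 ⊔ LinearMap.range (symι K E)) ^ n

theorem one_le_fil_one : (1 : Submodule K (SymAlg K E)) ≤ 1 ⊔ LinearMap.range (symι K E) :=
  le_sup_left

theorem fil_mono : Monotone (fil K E) := fun _ _ h => pow_le_pow_right' one_le_fil_one h

theorem one_mem_fil (n : ℕ) : (1 : SymAlg K E) ∈ fil K E n :=
  fil_mono (Nat.zero_le n) (by
    rw [fil, pow_zero]; exact Submodule.one_le.1 le_rfl)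

theorem mem_fil_zero {s : SymAlg K E} : s ∈ fil K E 0 ↔ ∃ c : K, s = c • 1 := by
  simp only [fil, pow_zero, Submodule.mem_one, Algebra.algebraMap_eq_smul_one, eq_comm]

theorem ι_mul_mem_fil (e : E) {n : ℕ} {s : SymAlg K E} (hs : s ∈ fil K E n) :
    symι K E e * s ∈ fil K E (n + 1) := by
  rw [fil, pow_succ']
  exact Submodule.mul_mem_mul (Submodule.mem_sup_right ⟨e, rfl⟩) hs

/-- Induction along the degree filtration. -/
theorem fil_induction {P : ℕ → SymAlg K E → Prop} (one : P 0 1)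
    (add : ∀ n a b, P n a → P n b → P n (a + b)) (smul : ∀ n (c : K) a, P n a → P n (c • a))
    (up : ∀ n s, s ∈ fil K E n → P n s → P (n + 1) s)
    (mul : ∀ n (e : E) s, s ∈ fil K E n → P n s → P (n + 1) (symι K E e * s))
    {n : ℕ} {s : SymAlg K E} (hs : s ∈ fil K E n) : P n s := by
  induction n generalizing s with
  | zero =>
    obtain ⟨c, rfl⟩ := mem_fil_zero.1 hs
    exact smul _ _ _ one
  | succ n ih =>
    rw [fil, pow_succ'] at hs
    induction hs using Submodule.mul_induction_on' with
    | mem_mul_mem a ha b hb =>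
      obtain ⟨c, hc, d, hd, rfl⟩ := Submodule.mem_sup.1 ha
      obtain ⟨k, rfl⟩ := Submodule.mem_one.1 hc
      obtain ⟨e, rfl⟩ := hd
      rw [add_mul]
      refine add _ _ _ ?_ (mul n e b hb (ih hb))
      rw [← Algebra.smul_def]
      exact smul _ _ _ (up n b hb (ih hb))
    | add a _ b _ ha hb => exact add _ _ _ ha hb

theorem par_mem_fil {n : ℕ} {s : SymAlg K E} (hs : s ∈ fil K E n) : par K s ∈ fil K E n := by
  refine fil_induction (P := fun n s => par K s ∈ fil K E n) ?_ ?_ ?_ ?_ ?_ hs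
  · rw [par_sym_one]; exact one_mem_fil 0
  · intro n a b ha hb; rw [map_add]; exact Submodule.add_mem _ ha hb
  · intro n c a ha; rw [map_smul]; exact Submodule.smul_mem _ c ha
  · intro n s _ h; exact fil_mono (Nat.le_succ n) h
  · intro n e s _ h; rw [par_sym_mul, par_sym_ι]; exact ι_mul_mem_fil _ h

theorem tw_mem_fil (i : ZMod 2) {n : ℕ} {s : SymAlg K E} (hs : s ∈ fil K E n) :
    tw K i s ∈ fil K E n := by
  rcases zmod_two_cases i with rfl | rfl
  · simpa using hs
  · simpa using par_mem_fil hs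

variable [CharZero K]

theorem exists_mem_fil (s : SymAlg K E) : ∃ n, s ∈ fil K E n := by
  induction s using sym_induction with
  | one => exact ⟨0, one_mem_fil 0⟩
  | add a b ha hb =>
    obtain ⟨m, hm⟩ := ha
    obtain ⟨n, hn⟩ := hb
    exact ⟨max m n, Submodule.add_mem _ (fil_mono (le_max_left m n) hm)
      (fil_mono (le_max_right m n) hn)⟩
  | smul c a ha =>
    obtain ⟨m, hm⟩ := ha
    exact ⟨m, Submodule.smul_mem _ _ hm⟩
  | mul i e s _ ih =>
    obtain ⟨m, hm⟩ := ih
    exact ⟨m + 1, ι_mul_mem_fil e hm⟩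

/-- The tensors `∑ a ⊗ b` of total degree at most `n`. -/
def filT (K : Type u) [Field K] (E : Type v) [AddCommGroup E] [Module K E] [SuperSpace K E] (n : ℕ) :
    Submodule K (SymAlg K E ⊗[K] SymAlg K E) :=
  Submodule.span K {z | ∃ i j, i + j = n ∧ ∃ a ∈ fil K E i, ∃ b ∈ fil K E j, z = a ⊗ₜ[K] b}

theorem tmul_mem_filT {i j n : ℕ} (h : i + j = n) {a b : SymAlg K E} (ha : a ∈ fil K E i)
    (hb : b ∈ fil K E j) : a ⊗ₜ[K] b ∈ filT K E n :=
  Submodule.subset_span ⟨i, j, h, a, ha, b, hb, rfl⟩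

/-- The comultiplication is compatible with the degree filtration. -/
theorem comul_mem_filT {n : ℕ} {s : SymAlg K E} (hs : s ∈ fil K E n) : comul s ∈ filT K E n := by
  refine fil_induction (P := fun n s => comul s ∈ filT K E n) ?_ ?_ ?_ ?_ ?_ hs
  · rw [comul_one]; exact tmul_mem_filT (i := 0) (j := 0) rfl (one_mem_fil 0) (one_mem_fil 0)
  · intro n a b ha hb; rw [map_add]; exact Submodule.add_mem _ ha hb
  · intro n c a ha; rw [map_smul]; exact Submodule.smul_mem _ c ha
  · intro n s _ h
    refine Submodule.span_le.2 ?_ h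
    rintro _ ⟨i, j, hij, a, ha, b, hb, rfl⟩
    exact tmul_mem_filT (i := i + 1) (j := j) (by omega) (fil_mono (Nat.le_succ i) ha) hb
  · intro n e s _ h
    rw [comul_ι_mul]
    have : filT K E n ≤ (filT K E (n + 1)).comap (comulStep (K := K) e) := by
      refine Submodule.span_le.2 ?_
      rintro _ ⟨i, j, hij, a, ha, b, hb, rfl⟩
      change comulStep (K := K) e (a ⊗ₜ[K] b) ∈ filT K E (n + 1)
      rw [comulStep_tmul]
      exact Submodule.add_mem _
        (tmul_mem_filT (i := i + 1) (j := j) (by omega) (ι_mul_mem_fil e ha) hb)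
        (Submodule.add_mem _
          (tmul_mem_filT (i := i) (j := j + 1) (by omega) ha (ι_mul_mem_fil _ hb))
          (tmul_mem_filT (i := i) (j := j + 1) (by omega) (par_mem_fil ha) (ι_mul_mem_fil _ hb)))
    exact this h

variable {W₁ W₂ W₃ : Type*}
  [AddCommGroup W₁] [Module K W₁] [AddCommGroup W₂] [Module K W₂] [AddCommGroup W₃] [Module K W₃]

theorem plainConv_mem {n : ℕ} {s : SymAlg K E} (hs : s ∈ fil K E n) {β : W₁ →ₗ[K] W₂ →ₗ[K] W₃}
    {F : SymAlg K E →ₗ[K] W₁} {G : SymAlg K E →ₗ[K] W₂} {Q : Submodule K W₃}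
    (h : ∀ i j, i + j = n → ∀ a ∈ fil K E i, ∀ b ∈ fil K E j, β (F a) (G b) ∈ Q) :
    plainConv β F G s ∈ Q := by
  have : filT K E n ≤ Q.comap (TensorProduct.lift (β.compl₁₂ F G)) := by
    refine Submodule.span_le.2 ?_
    rintro _ ⟨i, j, hij, a, ha, b, hb, rfl⟩
    exact h i j hij a ha b hb
  exact this (comul_mem_filT hs)

variable [SuperSpace K W₂]

theorem convProd_mem {n : ℕ} {s : SymAlg K E} (hs : s ∈ fil K E n) {β : W₁ →ₗ[K] W₂ →ₗ[K] W₃}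
    {F : SymAlg K E →ₗ[K] W₁} {G : SymAlg K E →ₗ[K] W₂} {Q : Submodule K W₃}
    (h : ∀ i j, i + j = n → ∀ a ∈ fil K E i, ∀ b ∈ fil K E j, ∀ k, β (F a) (comp K k G b) ∈ Q) :
    convProd β F G s ∈ Q := by
  rw [convProd_eq_plainConv]
  exact Submodule.add_mem _ (plainConv_mem hs fun i j hij a ha b hb => h i j hij a ha b hb 0)
    (plainConv_mem hs fun i j hij a ha b hb => h i j hij _ (par_mem_fil ha) b hb 1)

theorem comp_hom_apply (k : ZMod 2) (G : SymAlg K E →ₗ[K] W₂) (b : SymAlg K E) :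
    comp K k G b = (2⁻¹ : K) • (G b + sgn K k • par K (G (par K b))) := rfl

theorem comp_eq_zero_of_fil {n : ℕ} {G : SymAlg K E →ₗ[K] W₂} (hG : ∀ s ∈ fil K E n, G s = 0)
    (k : ZMod 2) : ∀ s ∈ fil K E n, comp K k G s = 0 := fun s hs => by
  rw [comp_hom_apply, hG s hs, hG _ (par_mem_fil hs)]; simp

theorem comp_hom_mem {Q : Submodule K W₂} (hQ : ∀ x ∈ Q, par K x ∈ Q) {G : SymAlg K E →ₗ[K] W₂}
    (hG : ∀ s, G s ∈ Q) (k : ZMod 2) (s : SymAlg K E) : comp K k G s ∈ Q := by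
  rw [comp_hom_apply]
  exact Submodule.smul_mem _ _ (Submodule.add_mem _ (hG _) (Submodule.smul_mem _ _ (hQ _ (hG _))))

/-- Multiplication by a series without constant term raises the order of vanishing. -/
theorem convProd_vanish {X : SymAlg K E →ₗ[K] W₁} (hX : X 1 = 0) (β : W₁ →ₗ[K] W₂ →ₗ[K] W₃)
    {n : ℕ} {G : SymAlg K E →ₗ[K] W₂} (hG : ∀ s ∈ fil K E n, G s = 0) :
    ∀ s ∈ fil K E (n + 1), convProd β X G s = 0 := by
  intro s hs
  refine (Submodule.mem_bot K).1 (convProd_mem hs fun i j hij a ha b hb k => ?_)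
  rw [Submodule.mem_bot]
  rcases Nat.eq_zero_or_pos i with rfl | hi
  · obtain ⟨c, rfl⟩ := mem_fil_zero.1 ha
    rw [map_smul, hX, smul_zero, map_zero, LinearMap.zero_apply]
  · rw [comp_eq_zero_of_fil hG k b (fil_mono (by omega) hb), map_zero]

theorem convProd_iterate_vanish {X : SymAlg K E →ₗ[K] W₁} (hX : X 1 = 0)
    (β : W₁ →ₗ[K] W₂ →ₗ[K] W₂) (G : SymAlg K E →ₗ[K] W₂) {m n : ℕ} (h : m < n) :
    ∀ s ∈ fil K E m, ((convProd β X)^[n] G) s = 0 := by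
  induction n generalizing m with
  | zero => omega
  | succ n ih =>
    rw [Function.iterate_succ_apply']
    rcases m with _ | m
    · intro s hs
      obtain ⟨c, rfl⟩ := mem_fil_zero.1 hs
      rw [map_smul, convProd_one, hX, map_zero, LinearMap.zero_apply, smul_zero]
    · exact convProd_vanish hX β (ih (by omega))

end Fil

/-! ### Pointwise sums of series -/

section Sums

variable {K : Type u} [Field K] [CharZero K] {E : Type v} [AddCommGroup E] [Module K E]
  [SuperSpace K E]
variable {M W W' W₁ W₂ W₃ : Type*} [AddCommGroup M] [Module K M] [AddCommGroup W] [Module K W]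
  [AddCommGroup W'] [Module K W']
  [AddCommGroup W₁] [Module K W₁] [AddCommGroup W₂] [Module K W₂] [AddCommGroup W₃] [Module K W₃]

theorem hasPointwiseSum_nat_iff {a : ℕ → M →ₗ[K] W} {G : M →ₗ[K] W} :
    HasPointwiseSum a G ↔ ∀ s, ∃ N, ∀ n, N ≤ n → a n s = 0 ∧ G s = ∑ i ∈ Finset.range n, a i s := by
  constructor
  · intro h s
    obtain ⟨h1, h2⟩ := h s
    obtain ⟨N, hN⟩ := h1.bddAbove
    refine ⟨N + 1, fun n hn => ⟨?_, ?_⟩⟩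
    · by_contra hne
      have := hN (a := n) hne
      omega
    · rw [h2]
      refine finsum_eq_sum_of_support_subset _ fun i hi => ?_
      have := hN hi
      simp only [Finset.coe_range, Set.mem_Iio]
      omega
  · intro h s
    obtain ⟨N, hN⟩ := h s
    have hs : (Function.support fun i => a i s) ⊆ ↑(Finset.range N) := fun i hi => by
      by_contra hlt
      simp only [Finset.coe_range, Set.mem_Iio, not_lt] at hlt
      exact hi (hN i hlt).1
    exact ⟨(Finset.finite_toSet _).subset hs, by
      rw [(hN N le_rfl).2, finsum_eq_sum_of_support_subset _ hs]⟩

theorem HasPointwiseSum.unique {ι : Type*} {a : ι → M →ₗ[K] W} {G G' : M →ₗ[K] W}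
    (h : HasPointwiseSum a G) (h' : HasPointwiseSum a G') : G = G' := by
  ext s; rw [(h s).2, (h' s).2]

theorem HasPointwiseSum.eq_zero {ι : Type*} {a : ι → M →ₗ[K] W} {G : M →ₗ[K] W}
    (h : HasPointwiseSum a G) (ha : ∀ n, a n = 0) : G = 0 := by
  ext s; rw [(h s).2]; simp [ha]

theorem HasPointwiseSum.add {ι : Type*} {a b : ι → M →ₗ[K] W} {F G : M →ₗ[K] W}
    (ha : HasPointwiseSum a F) (hb : HasPointwiseSum b G) :
    HasPointwiseSum (fun n => a n + b n) (F + G) := fun s => by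
  refine ⟨((ha s).1.union (hb s).1).subset (Function.support_add _ _), ?_⟩
  simp only [LinearMap.add_apply]
  rw [(ha s).2, (hb s).2, finsum_add_distrib (ha s).1 (hb s).1]

theorem HasPointwiseSum.map {ι : Type*} {a : ι → M →ₗ[K] W} {F : M →ₗ[K] W}
    (ha : HasPointwiseSum a F) (f : W →ₗ[K] W') :
    HasPointwiseSum (fun n => f ∘ₗ a n) (f ∘ₗ F) := fun s => by
  refine ⟨(ha s).1.subset fun n hn h => hn ?_, ?_⟩
  · change f (a n s) = 0
    rw [show a n s = 0 from h, map_zero]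
  · simp only [LinearMap.comp_apply]
    rw [(ha s).2]
    exact f.toAddMonoidHom.map_finsum (ha s).1

theorem HasPointwiseSum.comp {ι M' : Type*} [AddCommGroup M'] [Module K M']
    {a : ι → M →ₗ[K] W} {F : M →ₗ[K] W}
    (ha : HasPointwiseSum a F) (f : M' →ₗ[K] M) :
    HasPointwiseSum (fun n => a n ∘ₗ f) (F ∘ₗ f) := fun s => ha (f s)

theorem HasPointwiseSum.smul {ι : Type*} {a : ι → M →ₗ[K] W} {F : M →ₗ[K] W}
    (ha : HasPointwiseSum a F) (c : K) : HasPointwiseSum (fun n => c • a n) (c • F) := by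
  have h := ha.map (c • LinearMap.id)
  have e : ∀ F : M →ₗ[K] W, (c • LinearMap.id) ∘ₗ F = c • F := fun F => by ext; simp
  simpa only [e] using h

theorem HasPointwiseSum.sub {ι : Type*} {a b : ι → M →ₗ[K] W} {F G : M →ₗ[K] W}
    (ha : HasPointwiseSum a F) (hb : HasPointwiseSum b G) :
    HasPointwiseSum (fun n => a n - b n) (F - G) := by
  simpa only [neg_one_smul, ← sub_eq_add_neg] using ha.add (hb.smul (-1))

/-- The pointwise sum of a pointwise finite family. -/
noncomputable def psum {ι : Type*} (a : ι → M →ₗ[K] W)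
    (h : ∀ s, (Function.support fun i => a i s).Finite) : M →ₗ[K] W where
  toFun s := ∑ᶠ i, a i s
  map_add' s t := by
    rw [← finsum_add_distrib (h s) (h t)]
    simp only [map_add]
  map_smul' c s := by
    simp only [map_smul, RingHom.id_apply]
    rw [smul_finsum' c (h s)]

theorem hasPointwiseSum_psum {ι : Type*} (a : ι → M →ₗ[K] W)
    (h : ∀ s, (Function.support fun i => a i s).Finite) : HasPointwiseSum a (psum a h) :=
  fun s => ⟨h s, rfl⟩

theorem HasPointwiseSum.common {a : ℕ → M →ₗ[K] W} {G : M →ₗ[K] W} (h : HasPointwiseSum a G)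
    (U : Finset M) :
    ∃ N, ∀ n, N ≤ n → ∀ u ∈ U, a n u = 0 ∧ G u = (∑ i ∈ Finset.range n, a i) u := by
  rw [hasPointwiseSum_nat_iff] at h
  choose N hN using h
  refine ⟨U.sup N, fun n hn u hu => ?_⟩
  obtain ⟨h1, h2⟩ := hN u n ((Finset.le_sup hu).trans hn)
  exact ⟨h1, by rw [LinearMap.sum_apply]; exact h2⟩

theorem HasPointwiseSum.shift {a : ℕ → M →ₗ[K] W} {G : M →ₗ[K] W}
    (h : HasPointwiseSum (fun n => a (n + 1)) G) (h0 : a 0 = 0) : HasPointwiseSum a G := by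
  rw [hasPointwiseSum_nat_iff] at h ⊢
  intro s
  obtain ⟨N, hN⟩ := h s
  refine ⟨N + 1, fun n hn => ?_⟩
  obtain ⟨m, rfl⟩ : ∃ m, n = m + 1 := ⟨n - 1, by omega⟩
  obtain ⟨h1, h2⟩ := hN m (by omega)
  exact ⟨h1, by rw [h2, Finset.sum_range_succ', h0]; simp⟩

theorem sum_antidiagonal_range {f : ℕ → ℕ → W} {N n : ℕ} (hn : 2 * N ≤ n)
    (hf : ∀ i j, N ≤ i ∨ N ≤ j → f i j = 0) :
    ∑ k ∈ Finset.range n, ∑ p ∈ Finset.HasAntidiagonal.antidiagonal k, f p.1 p.2 =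
      ∑ i ∈ Finset.range N, ∑ j ∈ Finset.range N, f i j := by
  rw [← Finset.sum_product', Finset.sum_sigma']
  symm
  refine Finset.sum_of_injOn (fun p => ⟨p.1 + p.2, p⟩) ?_ ?_ ?_ ?_
  · intro p _ q _ h
    simpa using (Sigma.mk.inj_iff.1 h).2
  · rintro ⟨i, j⟩ h
    simp only [Finset.coe_product, Finset.coe_range, Set.mem_prod, Set.mem_Iio] at h
    simp only [Finset.coe_sigma, Set.mem_sigma_iff, Finset.mem_coe, Finset.mem_range,
      Finset.HasAntidiagonal.mem_antidiagonal]
    exact ⟨by omega, trivial⟩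
  · rintro ⟨k, ⟨i, j⟩⟩ h h'
    simp only [Finset.mem_sigma, Finset.mem_range, Finset.HasAntidiagonal.mem_antidiagonal] at h
    apply hf
    by_contra hlt
    push Not at hlt
    apply h'
    exact ⟨(i, j), by simpa using hlt, by simp [h.2]⟩
  · rintro p _; rfl

variable [SuperSpace K W₂]

/-- A product of series at a given point depends on finitely many values of the factors. -/
theorem convProd_finite_dependence (β : W₁ →ₗ[K] W₂ →ₗ[K] W₃) (s : SymAlg K E) :
    ∃ U : Finset (SymAlg K E), ∀ F F' : SymAlg K E →ₗ[K] W₁, ∀ G G' : SymAlg K E →ₗ[K] W₂,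
      (∀ u ∈ U, F u = F' u) → (∀ u ∈ U, G u = G' u) → convProd β F G s = convProd β F' G' s := by
  classical
  obtain ⟨T, hT⟩ := TensorProduct.exists_finset (comul s)
  refine ⟨T.biUnion fun z => {z.1, z.2, par K z.1, par K z.2}, fun F F' G G' hF hG => ?_⟩
  have m1 : ∀ z ∈ T, F z.1 = F' z.1 := fun z hz =>
    hF _ (Finset.mem_biUnion.2 ⟨z, hz, by simp⟩)
  have m2 : ∀ z ∈ T, G z.2 = G' z.2 := fun z hz =>
    hG _ (Finset.mem_biUnion.2 ⟨z, hz, by simp⟩)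
  have m3 : ∀ z ∈ T, F (par K z.1) = F' (par K z.1) := fun z hz =>
    hF _ (Finset.mem_biUnion.2 ⟨z, hz, by simp⟩)
  have m4 : ∀ z ∈ T, G (par K z.2) = G' (par K z.2) := fun z hz =>
    hG _ (Finset.mem_biUnion.2 ⟨z, hz, by simp⟩)
  simp only [convProd_eq_plainConv, LinearMap.add_apply, plainConv, LinearMap.comp_apply, hT,
    map_sum, TensorProduct.lift.tmul, LinearMap.compl₁₂_apply]
  congr 1 <;> refine Finset.sum_congr rfl fun z hz => ?_
  · rw [comp_hom_apply, comp_hom_apply, m1 z hz, m2 z hz, m4 z hz]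
  · rw [comp_hom_apply, comp_hom_apply, m3 z hz, m2 z hz, m4 z hz]

/-- The Cauchy product of two sequences of series, regarded as power series in a parameter. -/
def cauchy (β : W₁ →ₗ[K] W₂ →ₗ[K] W₃) (a : ℕ → SymAlg K E →ₗ[K] W₁) (b : ℕ → SymAlg K E →ₗ[K] W₂)
    (n : ℕ) : SymAlg K E →ₗ[K] W₃ :=
  ∑ p ∈ Finset.HasAntidiagonal.antidiagonal n, convProd β (a p.1) (b p.2)

theorem HasPointwiseSum.cauchy (β : W₁ →ₗ[K] W₂ →ₗ[K] W₃) {a : ℕ → SymAlg K E →ₗ[K] W₁}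
    {b : ℕ → SymAlg K E →ₗ[K] W₂} {F : SymAlg K E →ₗ[K] W₁} {G : SymAlg K E →ₗ[K] W₂}
    (ha : HasPointwiseSum a F) (hb : HasPointwiseSum b G) :
    HasPointwiseSum (cauchy β a b) (convProd β F G) := by
  rw [hasPointwiseSum_nat_iff]
  intro s
  obtain ⟨U, hU⟩ := convProd_finite_dependence β s
  obtain ⟨N₁, h₁⟩ := ha.common U
  obtain ⟨N₂, h₂⟩ := hb.common U
  set N := max N₁ N₂
  have hz : ∀ i j, N ≤ i ∨ N ≤ j → convProd β (a i) (b j) s = 0 := by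
    rintro i j (h | h)
    · rw [hU (a i) 0 (b j) (b j) (fun u hu => (h₁ i (le_of_max_le_left h) u hu).1)
        (fun u _ => rfl), convProd_zero_left, LinearMap.zero_apply]
    · rw [hU (a i) (a i) (b j) 0 (fun u _ => rfl)
        (fun u hu => (h₂ j (le_of_max_le_right h) u hu).1), convProd_zero_right,
        LinearMap.zero_apply]
  refine ⟨2 * N, fun n hn => ⟨?_, ?_⟩⟩
  · rw [SuperRep.cauchy, LinearMap.sum_apply]
    refine Finset.sum_eq_zero fun p hp => hz _ _ ?_
    rw [Finset.HasAntidiagonal.mem_antidiagonal] at hp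
    omega
  · rw [hU F (∑ i ∈ Finset.range N, a i) G (∑ i ∈ Finset.range N, b i)
      (fun u hu => (h₁ N (le_max_left _ _) u hu).2) (fun u hu => (h₂ N (le_max_right _ _) u hu).2)]
    simp only [SuperRep.cauchy, LinearMap.sum_apply]
    rw [sum_antidiagonal_range hn hz]
    simp only [← conv₂_apply, map_sum, LinearMap.sum_apply]
    exact Finset.sum_comm

theorem HasPointwiseSum.convProd_left (β : W₁ →ₗ[K] W₂ →ₗ[K] W₃) (F : SymAlg K E →ₗ[K] W₁)
    {b : ℕ → SymAlg K E →ₗ[K] W₂} {G : SymAlg K E →ₗ[K] W₂} (hb : HasPointwiseSum b G) :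
    HasPointwiseSum (fun n => convProd β F (b n)) (convProd β F G) := by
  rw [hasPointwiseSum_nat_iff]
  intro s
  obtain ⟨U, hU⟩ := convProd_finite_dependence β s
  obtain ⟨N, h⟩ := hb.common U
  refine ⟨N, fun n hn => ⟨?_, ?_⟩⟩
  · rw [hU F F _ 0 (fun u _ => rfl) (fun u hu => (h n hn u hu).1), convProd_zero_right,
      LinearMap.zero_apply]
  · rw [hU F F G _ (fun u _ => rfl) (fun u hu => (h n hn u hu).2)]
    simp only [← conv₂_apply, map_sum, LinearMap.sum_apply]

theorem HasPointwiseSum.convProd_right (β : W₁ →ₗ[K] W₂ →ₗ[K] W₃) {a : ℕ → SymAlg K E →ₗ[K] W₁}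
    {F : SymAlg K E →ₗ[K] W₁} (ha : HasPointwiseSum a F) (G : SymAlg K E →ₗ[K] W₂) :
    HasPointwiseSum (fun n => convProd β (a n) G) (convProd β F G) := by
  rw [hasPointwiseSum_nat_iff]
  intro s
  obtain ⟨U, hU⟩ := convProd_finite_dependence β s
  obtain ⟨N, h⟩ := ha.common U
  refine ⟨N, fun n hn => ⟨?_, ?_⟩⟩
  · rw [hU _ 0 G G (fun u hu => (h n hn u hu).1) (fun u _ => rfl), convProd_zero_left,
      LinearMap.zero_apply]
  · rw [hU F _ G G (fun u hu => (h n hn u hu).2) (fun u _ => rfl)]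
    simp only [← conv₂_apply, map_sum, LinearMap.sum_apply]

/-- The derivative of a Cauchy product with respect to the parameter. -/
theorem cauchy_deriv (β : W₁ →ₗ[K] W₂ →ₗ[K] W₃) {a a' : ℕ → SymAlg K E →ₗ[K] W₁}
    {b b' : ℕ → SymAlg K E →ₗ[K] W₂} (ha : ∀ n : ℕ, ((n + 1 : ℕ) : K) • a (n + 1) = a' n)
    (hb : ∀ n : ℕ, ((n + 1 : ℕ) : K) • b (n + 1) = b' n) (n : ℕ) :
    ((n + 1 : ℕ) : K) • cauchy β a b (n + 1) = cauchy β a' b n + cauchy β a b' n := by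
  have h : ((n + 1 : ℕ) : K) • cauchy β a b (n + 1) =
      ∑ p ∈ Finset.HasAntidiagonal.antidiagonal (n + 1), (p.1 : K) • convProd β (a p.1) (b p.2) +
      ∑ p ∈ Finset.HasAntidiagonal.antidiagonal (n + 1), (p.2 : K) • convProd β (a p.1) (b p.2) := by
    rw [cauchy, Finset.smul_sum, ← Finset.sum_add_distrib]
    refine Finset.sum_congr rfl fun p hp => ?_
    rw [Finset.HasAntidiagonal.mem_antidiagonal] at hp
    rw [← hp, Nat.cast_add, add_smul]
  rw [h, Finset.Nat.sum_antidiagonal_succ, Finset.Nat.sum_antidiagonal_succ']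
  simp only [Nat.cast_zero, zero_smul, zero_add]
  congr 1
  · refine Finset.sum_congr rfl fun p _ => ?_
    rw [← ha, convProd_smul_left]
  · refine Finset.sum_congr rfl fun p _ => ?_
    rw [← hb, convProd_smul_right]

theorem cauchy_zero (β : W₁ →ₗ[K] W₂ →ₗ[K] W₃) (a : ℕ → SymAlg K E →ₗ[K] W₁)
    (b : ℕ → SymAlg K E →ₗ[K] W₂) : cauchy β a b 0 = convProd β (a 0) (b 0) := by
  simp [cauchy]

/-- Uniqueness for linear differential equations in a formal parameter: a power series `∑ aₙ tⁿ`
that vanishes at `t = 0`, and whose derivative depends linearly on it, is zero. The identities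
between exponential series below are obtained from it, with `e^{XP}` replaced by `e^{t XP}`. -/
theorem seq_eq_zero {a : ℕ → W} (h0 : a 0 = 0)
    (h : ∀ n : ℕ, a n = 0 → ((n + 1 : ℕ) : K) • a (n + 1) = 0) (n : ℕ) : a n = 0 := by
  induction n with
  | zero => exact h0
  | succ n ih => exact (smul_eq_zero.1 (h n ih)).resolve_left (Nat.cast_ne_zero.2 n.succ_ne_zero)

end Sums

/-! ### Power series in `ad XP` -/

section AdXP

variable {K : Type u} [Field K] [CharZero K] {g : Type v} [AddCommGroup g] [Module K g]
  [SuperSpace K g] [LieSuper K g] {gm : LieSuperSub K g}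

theorem subtype_even (W : SuperSubmodule K g) : IsHomog K 0 W.toSubmodule.subtype :=
  even_iff.2 fun _ => rfl

theorem isHomog_XP : IsHomog K 0 (XP gm) :=
  (zero_add (0 : ZMod 2)) ▸ (subtype_even gm.toSuperSubmodule).comp_hom symOne_even

theorem XP_one : XP gm 1 = 0 := by simp [XP]

theorem XP_symL (e : gm.toSubmodule) : XP gm ∘ₗ symL e = constSeries (e : g) := by
  rw [XP, LinearMap.comp_assoc, symOne_symL]
  ext s; simp [constSeries_apply]

theorem XP_coder (A : SymAlg K gm.toSubmodule →ₗ[K] gm.toSubmodule) :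
    XP gm ∘ₗ coder A = gm.toSubmodule.subtype ∘ₗ A := by
  rw [XP, LinearMap.comp_assoc, symOne_coder]

variable (gm) in
/-- The operator `ad XP` as a linear map. -/
def adX : Module.End K (SymAlg K gm.toSubmodule →ₗ[K] g) := conv₂ (br K) (XP gm)

theorem adX_eq_serBr (F : SymAlg K gm.toSubmodule →ₗ[K] g) : adX gm F = serBr (XP gm) F := rfl

theorem adX_pow (n : ℕ) (F : SymAlg K gm.toSubmodule →ₗ[K] g) :
    (adX gm ^ n) F = (adXP gm)^[n] F := Module.End.pow_apply _ _ _

theorem adX_pow_vanish (F : SymAlg K gm.toSubmodule →ₗ[K] g) {m n : ℕ} (h : m < n) :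
    ∀ s ∈ fil K gm.toSubmodule m, ((adX gm ^ n) F) s = 0 := by
  rw [adX_pow]
  exact convProd_iterate_vanish XP_one (br K) F h

theorem isHomog_adX {p : ZMod 2} {F : SymAlg K gm.toSubmodule →ₗ[K] g} (hF : IsHomog K p F) :
    IsHomog K p (adX gm F) := by
  have h := isHomog_serBr isHomog_XP hF
  rwa [zero_add] at h

theorem isHomog_adX_pow {p : ZMod 2} {F : SymAlg K gm.toSubmodule →ₗ[K] g} (hF : IsHomog K p F)
    (n : ℕ) : IsHomog K p ((adX gm ^ n) F) := by
  induction n with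
  | zero => simpa using hF
  | succ n ih => rw [pow_succ', Module.End.mul_apply]; exact isHomog_adX ih

theorem par_adX (F : SymAlg K gm.toSubmodule →ₗ[K] g) : par K (adX gm F) = adX gm (par K F) := by
  have h := tw_convProd (β := br K) LieSuper.par_br 1 (XP gm) F
  rw [tw_apply_eq_self isHomog_XP, tw_one, tw_one] at h
  exact h

theorem par_adX_pow (F : SymAlg K gm.toSubmodule →ₗ[K] g) (n : ℕ) :
    par K ((adX gm ^ n) F) = (adX gm ^ n) (par K F) := by
  induction n with
  | zero => simp
  | succ n ih => rw [pow_succ', Module.End.mul_apply, Module.End.mul_apply, par_adX, ih]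

/-- `ad XP` is a derivation of the bracket of series. -/
theorem adX_serBr (G H : SymAlg K gm.toSubmodule →ₗ[K] g) :
    adX gm (serBr G H) = serBr (adX gm G) H + serBr G (adX gm H) := by
  have h : ∀ i, adX gm (serBr (comp K i G) H) =
      serBr (adX gm (comp K i G)) H + serBr (comp K i G) (adX gm H) := fun i => by
    have := serBr_leibniz (K := K) isHomog_XP (isHomog_comp i G) H
    rw [zero_mul, sgn_zero, one_smul] at this
    rw [adX_eq_serBr, adX_eq_serBr, adX_eq_serBr, this, sub_add_cancel]
  rw [← comp_add (K := K) G]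
  simp only [serBr, convProd_add_left, map_add] at h ⊢
  rw [h, h]
  abel

theorem adX_coder {p : ZMod 2} {A : SymAlg K gm.toSubmodule →ₗ[K] gm.toSubmodule}
    (hA : IsHomog K p A) (G : SymAlg K gm.toSubmodule →ₗ[K] g) :
    adX gm G ∘ₗ coder A =
      serBr (gm.toSubmodule.subtype ∘ₗ A) (tw K p G) + adX gm (G ∘ₗ coder A) := by
  rw [adX_eq_serBr, serBr, convProd_coder _ _ _ hA, XP_coder]
  rfl

/-- Products of series with values in subspaces closed under the product. -/
theorem convProd_mem_of_forall {E : Type*} [AddCommGroup E] [Module K E] [SuperSpace K E]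
    {W₁ W₂ W₃ : Type*} [AddCommGroup W₁] [Module K W₁] [AddCommGroup W₂] [Module K W₂]
    [SuperSpace K W₂] [AddCommGroup W₃] [Module K W₃] {β : W₁ →ₗ[K] W₂ →ₗ[K] W₃}
    {P : Submodule K W₁} {Q : Submodule K W₂} {R : Submodule K W₃}
    (hQ : ∀ x ∈ Q, par K x ∈ Q) (hβ : ∀ x ∈ P, ∀ y ∈ Q, β x y ∈ R)
    {F : SymAlg K E →ₗ[K] W₁} {G : SymAlg K E →ₗ[K] W₂} (hF : ∀ s, F s ∈ P) (hG : ∀ s, G s ∈ Q)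
    (s : SymAlg K E) : convProd β F G s ∈ R := by
  obtain ⟨n, hn⟩ := exists_mem_fil s
  exact convProd_mem hn fun i j _ a _ b _ k => hβ _ (hF a) _ (comp_hom_mem hQ hG k b)

theorem XP_mem (s : SymAlg K gm.toSubmodule) : XP gm s ∈ gm.toSubmodule := (symOne s).2

theorem adX_pow_mem {F : SymAlg K gm.toSubmodule →ₗ[K] g} (hF : ∀ s, F s ∈ gm.toSubmodule) (n : ℕ)
    (s : SymAlg K gm.toSubmodule) : (adX gm ^ n) F s ∈ gm.toSubmodule := by
  induction n generalizing s with
  | zero => simpa using hF s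
  | succ n ih =>
    rw [pow_succ', Module.End.mul_apply]
    exact convProd_mem_of_forall gm.par_mem gm.br_mem XP_mem ih s

theorem ser_support (q : PowerSeries K) (F : SymAlg K gm.toSubmodule →ₗ[K] g)
    (s : SymAlg K gm.toSubmodule) :
    (Function.support fun n => (PowerSeries.coeff n q • (adX gm ^ n) F) s).Finite := by
  obtain ⟨m, hm⟩ := exists_mem_fil s
  refine (Set.finite_Iic m).subset fun n hn => ?_
  by_contra hlt
  simp only [Set.mem_Iic, not_le] at hlt
  exact hn (by simp [adX_pow_vanish F hlt s hm])

/-- The series `q(ad XP) F`. -/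
noncomputable def ser (q : PowerSeries K) :
    (SymAlg K gm.toSubmodule →ₗ[K] g) →ₗ[K] (SymAlg K gm.toSubmodule →ₗ[K] g) where
  toFun F := psum (fun n => PowerSeries.coeff n q • (adX gm ^ n) F) (ser_support q F)
  map_add' F G := by
    refine (hasPointwiseSum_psum _ (ser_support q (F + G))).unique ?_
    simpa only [← smul_add, ← map_add] using (hasPointwiseSum_psum _ (ser_support q F)).add
      (hasPointwiseSum_psum _ (ser_support q G))
  map_smul' c F := by
    refine (hasPointwiseSum_psum _ (ser_support q (c • F))).unique ?_
    simpa only [smul_comm c, ← map_smul, RingHom.id_apply] using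
      (hasPointwiseSum_psum _ (ser_support q F)).smul c

theorem hasPointwiseSum_ser (q : PowerSeries K) (F : SymAlg K gm.toSubmodule →ₗ[K] g) :
    HasPointwiseSum (fun n => PowerSeries.coeff n q • (adX gm ^ n) F) (ser q F) :=
  hasPointwiseSum_psum _ (ser_support q F)

theorem hasSeries_ser (q : PowerSeries K) (F : SymAlg K gm.toSubmodule →ₗ[K] g) :
    HasSeries q (adXP gm) F (ser q F) := by
  have h := hasPointwiseSum_ser q F
  simp only [adX_pow] at h
  exact h

theorem par_ser (q : PowerSeries K) (F : SymAlg K gm.toSubmodule →ₗ[K] g) :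
    par K (ser q F) = ser q (par K F) := by
  refine HasPointwiseSum.unique (a := fun n => PowerSeries.coeff n q • (adX gm ^ n) (par K F)) ?_
    (hasPointwiseSum_ser q (par K F))
  have h := ((hasPointwiseSum_ser q F).map (par K)).comp (par K)
  have e : ∀ G : SymAlg K gm.toSubmodule →ₗ[K] g, (par K ∘ₗ G) ∘ₗ par K = par K G := fun G => rfl
  simpa only [e, map_smul, par_adX_pow] using h

theorem ser_apply_of_fil (q : PowerSeries K) (F : SymAlg K gm.toSubmodule →ₗ[K] g)
    {m n : ℕ} (h : m < n) {s : SymAlg K gm.toSubmodule} (hs : s ∈ fil K gm.toSubmodule m) :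
    ser q F s = ∑ i ∈ Finset.range n, PowerSeries.coeff i q • (adX gm ^ i) F s := by
  rw [(hasPointwiseSum_ser q F s).2]
  refine finsum_eq_sum_of_support_subset _ fun i hi => ?_
  by_contra hlt
  simp only [Finset.coe_range, Set.mem_Iio, not_lt] at hlt
  exact hi (by simp [adX_pow_vanish F (h.trans_le hlt) s hs])

theorem ser_mem (q : PowerSeries K) {F : SymAlg K gm.toSubmodule →ₗ[K] g}
    (hF : ∀ s, F s ∈ gm.toSubmodule) (s : SymAlg K gm.toSubmodule) :
    ser q F s ∈ gm.toSubmodule := by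
  obtain ⟨m, hm⟩ := exists_mem_fil s
  rw [ser_apply_of_fil q F m.lt_succ_self hm]
  exact Submodule.sum_mem _ fun n _ => Submodule.smul_mem _ _ (adX_pow_mem hF n s)

theorem adX_pow_ser (q : PowerSeries K) (F : SymAlg K gm.toSubmodule →ₗ[K] g) (n : ℕ) :
    (adX gm ^ n) (ser q F) = ser q ((adX gm ^ n) F) := by
  induction n with
  | zero => simp
  | succ n ih =>
    rw [pow_succ', Module.End.mul_apply, Module.End.mul_apply, ih]
    refine HasPointwiseSum.unique ((hasPointwiseSum_ser q ((adX gm ^ n) F)).convProd_left (br K)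
      (XP gm)) ?_
    have h := hasPointwiseSum_ser q (adX gm ((adX gm ^ n) F))
    have e : ∀ m, (adX gm ^ m) (adX gm ((adX gm ^ n) F)) =
        adX gm ((adX gm ^ m) ((adX gm ^ n) F)) := fun m => by
      rw [← Module.End.mul_apply, ← pow_succ, pow_succ', Module.End.mul_apply]
    have e' : (fun m => PowerSeries.coeff m q • (adX gm ^ m) (adX gm ((adX gm ^ n) F))) =
        fun m => convProd (br K) (XP gm) (PowerSeries.coeff m q • (adX gm ^ m) ((adX gm ^ n) F)) := by
      funext m
      rw [e, convProd_smul_right]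
      rfl
    rw [e'] at h
    exact h

/-- Power series in `ad XP` multiply as power series in one variable. -/
theorem ser_mul (p q : PowerSeries K) (F : SymAlg K gm.toSubmodule →ₗ[K] g) :
    ser (p * q) F = ser p (ser q F) := by
  ext s
  obtain ⟨m, hm⟩ := exists_mem_fil s
  rw [ser_apply_of_fil (p * q) F (n := 2 * (m + 1)) (by omega) hm,
    ser_apply_of_fil p (ser q F) m.lt_succ_self hm]
  have h : ∀ i, (adX gm ^ i) (ser q F) s = ∑ j ∈ Finset.range (m + 1),
      PowerSeries.coeff j q • (adX gm ^ (i + j)) F s := fun i => by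
    rw [adX_pow_ser, ser_apply_of_fil q _ m.lt_succ_self hm]
    simp only [← Module.End.mul_apply, ← pow_add, add_comm i]
  simp only [h, Finset.smul_sum, PowerSeries.coeff_mul, Finset.sum_smul]
  rw [← sum_antidiagonal_range (n := 2 * (m + 1)) le_rfl]
  · refine Finset.sum_congr rfl fun k _ => Finset.sum_congr rfl fun p hp => ?_
    rw [Finset.HasAntidiagonal.mem_antidiagonal] at hp
    rw [smul_smul, hp]
  · intro i j hij
    rw [adX_pow_vanish F (by omega) s hm, smul_zero, smul_zero]

theorem ser_one (F : SymAlg K gm.toSubmodule →ₗ[K] g) : ser 1 F = F := by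
  ext s
  obtain ⟨m, hm⟩ := exists_mem_fil s
  rw [ser_apply_of_fil 1 F m.lt_succ_self hm, Finset.sum_eq_single 0]
  · simp
  · intro i _ hi; simp [PowerSeries.coeff_one, hi]
  · simp

end AdXP

/-! ### Exponentials and the Maurer–Cartan equation -/

section Exponentials

variable {K : Type u} [Field K] [CharZero K] {g : Type v} [AddCommGroup g] [Module K g]
  [SuperSpace K g] [LieSuper K g] {gm : LieSuperSub K g}

/-- The power series `e^{ct}`. -/
def expS (c : K) : PowerSeries K := PowerSeries.mk fun n => c ^ n * (n.factorial : K)⁻¹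

/-- The power series `(e^{ct} - 1) / (ct)`. -/
def quotS (c : K) : PowerSeries K := PowerSeries.mk fun n => c ^ n * ((n + 1).factorial : K)⁻¹

variable (gm) in
/-- The coefficients of `e^{c t ad XP} x` as a power series in `t`. -/
def expCoeff (c : K) (x : g) (n : ℕ) : SymAlg K gm.toSubmodule →ₗ[K] g :=
  (c ^ n * (n.factorial : K)⁻¹) • (adX gm ^ n) (constSeries x)

/-- The coefficients of `(e^{c t ad XP} - 1) / (c ad XP) A` as a power series in `t`. -/
def formCoeff (c : K) (A : SymAlg K gm.toSubmodule →ₗ[K] g) : ℕ → SymAlg K gm.toSubmodule →ₗ[K] g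
  | 0 => 0
  | n + 1 => (c ^ n * ((n + 1).factorial : K)⁻¹) • (adX gm ^ n) A

/-- The power series in `t` with constant term `A` and no other terms. -/
def atZero {W : Type*} [AddCommGroup W] (A : W) (n : ℕ) : W := if n = 0 then A else 0

theorem hasPointwiseSum_expCoeff (c : K) (x : g) :
    HasPointwiseSum (expCoeff gm c x) (ser (expS c) (constSeries x)) := by
  have h := hasPointwiseSum_ser (gm := gm) (expS c) (constSeries x)
  simp only [expS, PowerSeries.coeff_mk] at h
  exact h

theorem hasPointwiseSum_formCoeff (c : K) (A : SymAlg K gm.toSubmodule →ₗ[K] g) :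
    HasPointwiseSum (formCoeff c A) (ser (quotS c) A) := by
  refine HasPointwiseSum.shift ?_ rfl
  have h := hasPointwiseSum_ser (gm := gm) (quotS c) A
  simp only [quotS, PowerSeries.coeff_mk] at h
  exact h

theorem cast_mul_inv_factorial (n : ℕ) :
    ((n + 1 : ℕ) : K) * ((n + 1).factorial : K)⁻¹ = (n.factorial : K)⁻¹ := by
  rw [Nat.factorial_succ, Nat.cast_mul, mul_inv, ← mul_assoc,
    mul_inv_cancel₀ (Nat.cast_ne_zero.2 n.succ_ne_zero), one_mul]

theorem expCoeff_zero (c : K) (x : g) : expCoeff gm c x 0 = constSeries x := by simp [expCoeff]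

theorem expCoeff_succ (c : K) (x : g) (n : ℕ) :
    ((n + 1 : ℕ) : K) • expCoeff gm c x (n + 1) = c • adX gm (expCoeff gm c x n) := by
  rw [expCoeff, expCoeff, map_smul, ← Module.End.mul_apply, ← pow_succ', smul_smul, smul_smul,
    mul_left_comm, cast_mul_inv_factorial, pow_succ', mul_assoc]

theorem formCoeff_succ (c : K) (A : SymAlg K gm.toSubmodule →ₗ[K] g) (n : ℕ) :
    ((n + 1 : ℕ) : K) • formCoeff c A (n + 1) = atZero A n + c • adX gm (formCoeff c A n) := by
  cases n with
  | zero => simp [formCoeff, atZero]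
  | succ n =>
    rw [formCoeff, formCoeff, map_smul, ← Module.End.mul_apply, ← pow_succ', smul_smul, smul_smul,
      mul_left_comm, cast_mul_inv_factorial, pow_succ', mul_assoc]
    simp [atZero]

theorem isHomog_expCoeff (c : K) {p : ZMod 2} {x : g} (hx : IsHomog K p x) (n : ℕ) :
    IsHomog K p (expCoeff gm c x n) := (isHomog_adX_pow (isHomog_constSeries hx) n).smul _

theorem isHomog_formCoeff (c : K) {p : ZMod 2} {A : SymAlg K gm.toSubmodule →ₗ[K] g}
    (hA : IsHomog K p A) (n : ℕ) : IsHomog K p (formCoeff c A n) := by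
  cases n with
  | zero => exact IsHomog.zero p
  | succ n => exact (isHomog_adX_pow hA n).smul _

section CauchyRules

variable {E : Type*} [AddCommGroup E] [Module K E] [SuperSpace K E] {W₁ W₂ W₃ : Type*}
  [AddCommGroup W₁] [Module K W₁] [AddCommGroup W₂] [Module K W₂] [SuperSpace K W₂]
  [AddCommGroup W₃] [Module K W₃] (β : W₁ →ₗ[K] W₂ →ₗ[K] W₃)
  (a a' : ℕ → SymAlg K E →ₗ[K] W₁) (b b' : ℕ → SymAlg K E →ₗ[K] W₂)

theorem cauchy_atZero_left (A : SymAlg K E →ₗ[K] W₁) (n : ℕ) :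
    cauchy β (atZero A) b n = convProd β A (b n) := by
  rw [cauchy, Finset.sum_eq_single (0, n)]
  · simp [atZero]
  · rintro ⟨i, j⟩ hij hne
    rw [Finset.HasAntidiagonal.mem_antidiagonal] at hij
    have : i ≠ 0 := by rintro rfl; apply hne; simp only [zero_add] at hij; rw [hij]
    simp [atZero, this, convProd_zero_left]
  · intro h; exact absurd (by simp [Finset.HasAntidiagonal.mem_antidiagonal]) h

theorem cauchy_atZero_right (B : SymAlg K E →ₗ[K] W₂) (n : ℕ) :
    cauchy β a (atZero B) n = convProd β (a n) B := by
  rw [cauchy, Finset.sum_eq_single (n, 0)]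
  · simp [atZero]
  · rintro ⟨i, j⟩ hij hne
    rw [Finset.HasAntidiagonal.mem_antidiagonal] at hij
    have : j ≠ 0 := by rintro rfl; apply hne; simp only [add_zero] at hij; rw [hij]
    simp [atZero, this, convProd_zero_right]
  · intro h; exact absurd (by simp [Finset.HasAntidiagonal.mem_antidiagonal]) h

theorem cauchy_add_left (n : ℕ) :
    cauchy β (fun n => a n + a' n) b n = cauchy β a b n + cauchy β a' b n := by
  simp only [cauchy, convProd_add_left, Finset.sum_add_distrib]

theorem cauchy_add_right (n : ℕ) :
    cauchy β a (fun n => b n + b' n) n = cauchy β a b n + cauchy β a b' n := by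
  simp only [cauchy, convProd_add_right, Finset.sum_add_distrib]

theorem cauchy_sub_left (n : ℕ) :
    cauchy β (fun n => a n - a' n) b n = cauchy β a b n - cauchy β a' b n := by
  simp only [cauchy, convProd_sub_left, Finset.sum_sub_distrib]

theorem cauchy_sub_right (n : ℕ) :
    cauchy β a (fun n => b n - b' n) n = cauchy β a b n - cauchy β a b' n := by
  simp only [cauchy, convProd_sub_right, Finset.sum_sub_distrib]

theorem cauchy_smul_left (c : K) (n : ℕ) :
    cauchy β (fun n => c • a n) b n = c • cauchy β a b n := by
  simp only [cauchy, convProd_smul_left, Finset.smul_sum]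

theorem cauchy_smul_right (c : K) (n : ℕ) :
    cauchy β a (fun n => c • b n) n = c • cauchy β a b n := by
  simp only [cauchy, convProd_smul_right, Finset.smul_sum]

end CauchyRules

theorem adX_cauchy (a b : ℕ → SymAlg K gm.toSubmodule →ₗ[K] g) (n : ℕ) :
    adX gm (cauchy (br K) a b n) = cauchy (br K) (fun n => adX gm (a n)) b n +
      cauchy (br K) a (fun n => adX gm (b n)) n := by
  simp only [cauchy, map_sum, ← Finset.sum_add_distrib]
  exact Finset.sum_congr rfl fun p _ => adX_serBr _ _

/-- `e^{c ad XP}` is an automorphism of the bracket. -/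
theorem serBr_exp (c : K) (x y : g) :
    serBr (ser (gm := gm) (expS c) (constSeries x)) (ser (expS c) (constSeries y)) =
      ser (expS c) (constSeries (br K x y)) := by
  refine sub_eq_zero.1 ((((hasPointwiseSum_expCoeff c x).cauchy (br K)
    (hasPointwiseSum_expCoeff c y)).sub (hasPointwiseSum_expCoeff c (br K x y))).eq_zero ?_)
  -- The difference `D` of the two sides, with `t XP` for `XP`, satisfies `D' = c [XP, D]`.
  refine seq_eq_zero (K := K) ?_ fun n ih => ?_
  · rw [cauchy_zero, expCoeff_zero, expCoeff_zero, expCoeff_zero, convProd_const_left, sub_eq_zero]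
    ext s; simp [constSeries_apply]
  · rw [smul_sub, cauchy_deriv (br K) (expCoeff_succ c x) (expCoeff_succ c y), expCoeff_succ,
      cauchy_smul_left, cauchy_smul_right, ← smul_add, ← adX_cauchy, ← smul_sub, ← map_sub, ih,
      map_zero, smul_zero]

/-- The derivative of `e^{-ad XP} x` along a vector field is its bracket with the left logarithmic
derivative of `e^{XP}`. -/
theorem exp_coder {p q : ZMod 2} {A : SymAlg K gm.toSubmodule →ₗ[K] gm.toSubmodule}
    (hA : IsHomog K p A) {x : g} (hx : IsHomog K q x) :
    ser (gm := gm) (expS (-1)) (constSeries x) ∘ₗ coder A =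
      serBr (ser (expS (-1)) (constSeries x)) (ser (quotS (-1)) (gm.toSubmodule.subtype ∘ₗ A)) := by
  set A' := gm.toSubmodule.subtype ∘ₗ A
  have hA' : IsHomog K p A' := (zero_add p) ▸ (subtype_even gm.toSuperSubmodule).comp_hom hA
  refine sub_eq_zero.1 ((((hasPointwiseSum_expCoeff (-1) x).comp (coder A)).sub
    ((hasPointwiseSum_expCoeff (-1) x).cauchy (br K)
      (hasPointwiseSum_formCoeff (-1) A'))).eq_zero ?_)
  -- With `E = e^{-t ad XP} x` and `θ = ((1 - e^{-t ad XP}) / ad XP) A` one has `E' = -[XP, E]` and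
  -- `θ' = A - [XP, θ]`, and the derivation `F ↦ F ∘ coder A` sends `XP` to `A`. Hence the
  -- difference `D` of the two sides satisfies `D' = -[XP, D]`.
  refine seq_eq_zero (K := K) ?_ fun n ih => ?_
  · rw [cauchy_zero, expCoeff_zero, constSeries_coder, formCoeff, convProd_zero_right, sub_zero]
  · rw [smul_sub, cauchy_deriv (br K) (expCoeff_succ (-1) x) (formCoeff_succ (-1) A'),
      ← LinearMap.smul_comp, expCoeff_succ, cauchy_add_right, cauchy_smul_left, cauchy_smul_right,
      cauchy_atZero_right, LinearMap.smul_comp, adX_coder hA,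
      tw_of_homog (isHomog_expCoeff (-1) hx n), serBr, convProd_smul_right]
    have h := serBr_skew (isHomog_expCoeff (gm := gm) (-1) hx n) hA'
    have h2 := congrArg (adX gm) ih
    rw [map_sub, adX_cauchy, map_zero] at h2
    rw [serBr] at h
    rw [h, mul_comm q p]
    simp only [neg_smul, one_smul]
    rw [← neg_eq_zero, ← h2]
    abel

/-- The Maurer–Cartan equation for the left logarithmic derivative `((1 - e^{-ad XP}) / ad XP) A` of
`e^{XP}` along the vector field `A`. -/
theorem maurer_cartan {p q : ZMod 2} {A B : SymAlg K gm.toSubmodule →ₗ[K] gm.toSubmodule}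
    (hA : IsHomog K p A) (hB : IsHomog K q B) :
    ser (gm := gm) (quotS (-1)) (gm.toSubmodule.subtype ∘ₗ A) ∘ₗ coder B -
      sgn K (p * q) • (ser (quotS (-1)) (gm.toSubmodule.subtype ∘ₗ B) ∘ₗ coder A) =
    ser (quotS (-1)) (gm.toSubmodule.subtype ∘ₗ (A ∘ₗ coder B - sgn K (p * q) • (B ∘ₗ coder A))) +
      serBr (ser (quotS (-1)) (gm.toSubmodule.subtype ∘ₗ A))
        (ser (quotS (-1)) (gm.toSubmodule.subtype ∘ₗ B)) := by
  have hC : gm.toSubmodule.subtype ∘ₗ (A ∘ₗ coder B - sgn K (p * q) • (B ∘ₗ coder A)) =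
      (gm.toSubmodule.subtype ∘ₗ A) ∘ₗ coder B -
        sgn K (p * q) • ((gm.toSubmodule.subtype ∘ₗ B) ∘ₗ coder A) := by
    rw [LinearMap.comp_sub, LinearMap.comp_smul, LinearMap.comp_assoc, LinearMap.comp_assoc]
  rw [hC]
  set A' := gm.toSubmodule.subtype ∘ₗ A with hA'def
  set B' := gm.toSubmodule.subtype ∘ₗ B with hB'def
  set C' := A' ∘ₗ coder B - sgn K (p * q) • (B' ∘ₗ coder A)
  have hA' : IsHomog K p A' := (zero_add p) ▸ (subtype_even gm.toSuperSubmodule).comp_hom hA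
  have hB' : IsHomog K q B' := (zero_add q) ▸ (subtype_even gm.toSuperSubmodule).comp_hom hB
  have sA := hasPointwiseSum_formCoeff (-1) A'
  have sB := hasPointwiseSum_formCoeff (-1) B'
  have sC := hasPointwiseSum_formCoeff (-1) C'
  refine sub_eq_zero.1 ((((sA.comp (coder B)).sub ((sB.comp (coder A)).smul (sgn K (p * q)))).sub
    (sC.add (sA.cauchy (br K) sB))).eq_zero ?_)
  -- By `θ' = A - [XP, θ]`, the difference `D` of the two sides satisfies `D' = -[XP, D]`.
  refine seq_eq_zero (K := K) ?_ fun n ih => ?_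
  · rw [cauchy_zero, formCoeff, formCoeff, formCoeff, convProd_zero_right]
    simp
  · have z : ∀ (F : SymAlg K gm.toSubmodule →ₗ[K] g) (D : SymAlg K gm.toSubmodule →ₗ[K]
        SymAlg K gm.toSubmodule), atZero F n ∘ₗ D = atZero (F ∘ₗ D) n := fun F D => by
      cases n <;> simp [atZero]
    have z' : atZero C' n = atZero (A' ∘ₗ coder B) n - sgn K (p * q) • atZero (B' ∘ₗ coder A) n := by
      cases n <;> simp [atZero, C']
    rw [smul_sub, smul_sub, smul_comm _ (sgn K (p * q)), smul_add,
      cauchy_deriv (br K) (formCoeff_succ (-1) A') (formCoeff_succ (-1) B'),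
      ← LinearMap.smul_comp, ← LinearMap.smul_comp, formCoeff_succ, formCoeff_succ, formCoeff_succ,
      cauchy_add_right, cauchy_add_left, cauchy_smul_left, cauchy_smul_right,
      cauchy_atZero_right, cauchy_atZero_left, LinearMap.add_comp, LinearMap.add_comp,
      LinearMap.smul_comp, LinearMap.smul_comp, adX_coder hA, adX_coder hB, z, z, z',
      tw_of_homog (isHomog_formCoeff (-1) hA' n), tw_of_homog (isHomog_formCoeff (-1) hB' n),
      serBr, serBr, convProd_smul_right, convProd_smul_right, ← hA'def, ← hB'def]
    have h := serBr_skew (isHomog_formCoeff (gm := gm) (-1) hA' n) hB'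
    have h2 := congrArg (adX gm) ih
    simp only [map_sub, map_add, map_smul, adX_cauchy, map_zero] at h2
    simp only [serBr] at h
    have ss : ∀ Z : SymAlg K gm.toSubmodule →ₗ[K] g, sgn K (p * q) • sgn K (p * q) • Z = Z :=
      fun Z => by rw [smul_smul, sgn_mul_self, one_smul]
    rw [h, mul_comm q p]
    simp only [neg_smul, one_smul, smul_add, smul_neg, ss]
    rw [← neg_eq_zero, ← h2]
    abel

end Exponentials

/-! ### Series with coefficients in `U(g)` and the symmetrization map -/

section EnvSeries

variable {K : Type u} [Field K] [CharZero K] {g : Type v} [AddCommGroup g] [Module K g]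
  [SuperSpace K g] [LieSuper K g]

theorem envι_even : IsHomog K 0 (envι K g) := even_iff.2 par_env_ι

theorem par_env_one : par K (1 : EnvAlg K g) = 1 := map_one (envPar (K := K) (g := g))

theorem env_commutator (x y : g) : envι K g (br K x y) = envι K g x * envι K g y -
    ∑ i : ZMod 2, ∑ j : ZMod 2, sgn K (i * j) •
      (envι K g (comp K i y) * envι K g (comp K j x)) := by
  rw [← envι_rel, Finset.sum_comm]
  simp only [mul_comm]

variable {E : Type*} [AddCommGroup E] [Module K E] [SuperSpace K E]

/-- The product of formal series with coefficients in `U(g)`. -/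
abbrev serMul (F G : SymAlg K E →ₗ[K] EnvAlg K g) : SymAlg K E →ₗ[K] EnvAlg K g :=
  convProd (LinearMap.mul K (EnvAlg K g)) F G

theorem par_env_mul' (x y : EnvAlg K g) :
    par K (LinearMap.mul K (EnvAlg K g) x y) = LinearMap.mul K (EnvAlg K g) (par K x) (par K y) :=
  par_env_mul x y

theorem serMul_assoc (F G H : SymAlg K E →ₗ[K] EnvAlg K g) :
    serMul (serMul F G) H = serMul F (serMul G H) :=
  convProd_assoc par_env_mul' (fun x y z => mul_assoc x y z) F G H

theorem serMul_one_left (F : SymAlg K E →ₗ[K] EnvAlg K g) : serMul (constSeries 1) F = F := by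
  rw [serMul, convProd_const_left]
  ext s; simp

theorem serMul_one_right (F : SymAlg K E →ₗ[K] EnvAlg K g) : serMul F (constSeries 1) = F := by
  rw [serMul, convProd_const_right _ (isHomog_zero_iff.2 par_env_one)]
  ext s; simp

theorem isHomog_serMul {p q : ZMod 2} {F G : SymAlg K E →ₗ[K] EnvAlg K g} (hF : IsHomog K p F)
    (hG : IsHomog K q G) : IsHomog K (p + q) (serMul F G) := hF.convProd par_env_mul' hG

theorem IsHomog.envι_comp {p : ZMod 2} {F : SymAlg K E →ₗ[K] g} (hF : IsHomog K p F) :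
    IsHomog K p (envι K g ∘ₗ F) := (zero_add p) ▸ envι_even.comp_hom hF

theorem envι_serBr {p q : ZMod 2} {F G : SymAlg K E →ₗ[K] g} (hF : IsHomog K p F)
    (hG : IsHomog K q G) : envι K g ∘ₗ serBr F G =
      serMul (envι K g ∘ₗ F) (envι K g ∘ₗ G) -
        sgn K (p * q) • serMul (envι K g ∘ₗ G) (envι K g ∘ₗ F) := by
  have h1 : envι K g ∘ₗ serBr F G = convProd ((br K).compr₂ (envι K g)) F G := by
    have := convProd_natural (β := br K) (γ := (br K).compr₂ (envι K g)) (f := LinearMap.id)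
      (g := LinearMap.id) (k := envι K g) (even_iff.2 fun _ => rfl) (fun x y => rfl) F G
    simpa using this
  have h2 : ∀ F G : SymAlg K E →ₗ[K] g, serMul (envι K g ∘ₗ F) (envι K g ∘ₗ G) =
      convProd ((LinearMap.mul K (EnvAlg K g)).compl₁₂ (envι K g) (envι K g)) F G := fun F G => by
    have := convProd_natural (β := (LinearMap.mul K (EnvAlg K g)).compl₁₂ (envι K g) (envι K g))
      (γ := LinearMap.mul K (EnvAlg K g)) (f := envι K g) (g := envι K g) (k := LinearMap.id)
      envι_even (fun x y => rfl) F G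
    rw [LinearMap.id_comp] at this
    rw [this]
  rw [h1, h2, h2]
  exact convProd_commutator (fun x y => env_commutator x y) hF hG

theorem envι_constSeries (x : g) :
    envι K g ∘ₗ constSeries (E := E) x = constSeries (envι K g x) := by
  ext s; simp [constSeries_apply]

variable {gm : LieSuperSub K g}

theorem envι_adX {p : ZMod 2} {F : SymAlg K gm.toSubmodule →ₗ[K] g} (hF : IsHomog K p F) :
    envι K g ∘ₗ adX gm F = serMul (envι K g ∘ₗ XP gm) (envι K g ∘ₗ F) -
      serMul (envι K g ∘ₗ F) (envι K g ∘ₗ XP gm) := by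
  have h := envι_serBr (isHomog_XP (gm := gm)) hF
  rw [zero_mul, sgn_zero, one_smul] at h
  exact h

variable (gm) in
/-- The formal series `XP` with coefficients in `U(g)`. -/
def envX : SymAlg K gm.toSubmodule →ₗ[K] EnvAlg K g := envι K g ∘ₗ XP gm

theorem isHomog_envX : IsHomog K 0 (envX gm) := isHomog_XP.envι_comp

theorem envX_coder (A : SymAlg K gm.toSubmodule →ₗ[K] gm.toSubmodule) :
    envX gm ∘ₗ coder A = envι K g ∘ₗ gm.toSubmodule.subtype ∘ₗ A := by
  rw [envX, LinearMap.comp_assoc, XP_coder]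

variable (gm) in
/-- The powers of `XP` as a series with coefficients in `U(g)`. -/
def envPow : ℕ → SymAlg K gm.toSubmodule →ₗ[K] EnvAlg K g
  | 0 => constSeries 1
  | n + 1 => serMul (envX gm) (envPow n)

theorem envPow_eq_iterate (n : ℕ) : envPow gm n =
    (convProd (LinearMap.mul K (EnvAlg K g)) (envX gm))^[n] (constSeries 1) := by
  induction n with
  | zero => rfl
  | succ n ih => rw [Function.iterate_succ_apply', ← ih, envPow]

theorem envPow_vanish {m n : ℕ} (h : m < n) :
    ∀ s ∈ fil K gm.toSubmodule m, envPow gm n s = 0 := by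
  rw [envPow_eq_iterate]
  exact convProd_iterate_vanish (by simp [envX, XP_one]) _ _ h

theorem envPow_succ' (n : ℕ) : envPow gm (n + 1) = serMul (envPow gm n) (envX gm) := by
  induction n with
  | zero => exact (serMul_one_right _).trans (serMul_one_left _).symm
  | succ n ih => rw [envPow, ih, ← serMul_assoc, ← envPow]; rw [ih]

theorem isHomog_envPow (n : ℕ) : IsHomog K 0 (envPow gm n) := by
  induction n with
  | zero => exact isHomog_constSeries (isHomog_zero_iff.2 par_env_one)
  | succ n ih => exact (zero_add (0 : ZMod 2)) ▸ isHomog_serMul isHomog_envX ih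

variable (gm) in
/-- The term `XPⁿ / n!` of the exponential series, which is the coefficient of `tⁿ` in `e^{t XP}`.
-/
def symCoeff (n : ℕ) : SymAlg K gm.toSubmodule →ₗ[K] EnvAlg K g :=
  (n.factorial : K)⁻¹ • envPow gm n

theorem symCoeff_support (s : SymAlg K gm.toSubmodule) :
    (Function.support fun n => symCoeff gm n s).Finite := by
  obtain ⟨m, hm⟩ := exists_mem_fil s
  refine (Set.finite_Iic m).subset fun n hn => ?_
  by_contra hlt
  simp only [Set.mem_Iic, not_le] at hlt
  exact hn (by simp [symCoeff, envPow_vanish hlt s hm])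

variable (gm) in
/-- The exponential of `XP`; as a linear map `S(g₋) → U(g)` this is the symmetrization map. -/
noncomputable def symExp : SymAlg K gm.toSubmodule →ₗ[K] EnvAlg K g :=
  psum (symCoeff gm) symCoeff_support

theorem hasPointwiseSum_symCoeff : HasPointwiseSum (symCoeff gm) (symExp gm) :=
  hasPointwiseSum_psum _ _

theorem symCoeff_zero : symCoeff gm 0 = constSeries 1 := by simp [symCoeff, envPow]

theorem symCoeff_succ (n : ℕ) :
    ((n + 1 : ℕ) : K) • symCoeff gm (n + 1) = serMul (envX gm) (symCoeff gm n) := by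
  rw [symCoeff, symCoeff, serMul, convProd_smul_right, smul_smul, cast_mul_inv_factorial, envPow]

theorem symCoeff_succ' (n : ℕ) :
    ((n + 1 : ℕ) : K) • symCoeff gm (n + 1) = serMul (symCoeff gm n) (envX gm) := by
  rw [symCoeff, symCoeff, serMul, convProd_smul_left, smul_smul, cast_mul_inv_factorial,
    envPow_succ']

theorem isHomog_symCoeff (n : ℕ) : IsHomog K 0 (symCoeff gm n) := (isHomog_envPow n).smul _

theorem symExp_one : symExp gm 1 = 1 := by
  have h : symCoeff gm 0 1 = (1 : EnvAlg K g) := by rw [symCoeff_zero, constSeries_one]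
  rw [((hasPointwiseSum_symCoeff (gm := gm)) 1).2, finsum_eq_single _ 0, h]
  intro n hn
  have := envPow_vanish (gm := gm) (Nat.pos_of_ne_zero hn) 1 (one_mem_fil 0)
  rw [symCoeff, LinearMap.smul_apply, this, smul_zero]

theorem isHomog_symExp : IsHomog K 0 (symExp gm) := by
  rw [isHomog_zero_iff]
  refine HasPointwiseSum.unique (a := symCoeff gm) ?_ hasPointwiseSum_symCoeff
  have h := ((hasPointwiseSum_symCoeff (gm := gm)).map (par K)).comp (par K)
  have e : ∀ n, (par K ∘ₗ symCoeff gm n) ∘ₗ par K = symCoeff gm n := fun n =>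
    isHomog_zero_iff.1 (isHomog_symCoeff n)
  simp only [e] at h
  exact h

/-- A series satisfying the differential equation `u' = u XP + e^{t XP} A` is the product of
`e^{t XP}` with the solution of `φ' = A - [XP, φ]`. -/
theorem eq_symCoeff_mul {p : ZMod 2} {A : SymAlg K gm.toSubmodule →ₗ[K] g}
    {φ : ℕ → SymAlg K gm.toSubmodule →ₗ[K] g} {u : ℕ → SymAlg K gm.toSubmodule →ₗ[K] EnvAlg K g}
    (hφ : ∀ n, IsHomog K p (φ n)) (h0 : u 0 = envι K g ∘ₗ φ 0)
    (h1 : ∀ n : ℕ, ((n + 1 : ℕ) : K) • φ (n + 1) = atZero A n + (-1 : K) • adX gm (φ n))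
    (h2 : ∀ n : ℕ, ((n + 1 : ℕ) : K) • u (n + 1) =
      serMul (u n) (envX gm) + serMul (symCoeff gm n) (envι K g ∘ₗ A))
    {U : SymAlg K gm.toSubmodule →ₗ[K] EnvAlg K g} {Φ : SymAlg K gm.toSubmodule →ₗ[K] g}
    (hU : HasPointwiseSum u U) (hΦ : HasPointwiseSum φ Φ) :
    U = serMul (symExp gm) (envι K g ∘ₗ Φ) := by
  refine sub_eq_zero.1 ((hU.sub ((hasPointwiseSum_symCoeff (gm := gm)).cauchy
    (LinearMap.mul K (EnvAlg K g)) (hΦ.map (envι K g)))).eq_zero ?_)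
  -- The difference `D` of the two sides satisfies `D' = D XP`.
  refine seq_eq_zero (K := K) ?_ fun n ih => ?_
  · rw [cauchy_zero, symCoeff_zero, h0]
    exact sub_eq_zero.2 (serMul_one_left _).symm
  · have hz : ∀ n, envι K g ∘ₗ atZero A n = atZero (envι K g ∘ₗ A) n := fun n => by
      cases n <;> simp [atZero]
    have hn : ∀ Z : SymAlg K gm.toSubmodule →ₗ[K] EnvAlg K g, (-1 : K) • Z = -Z :=
      fun Z => neg_one_smul K Z
    have h3 : ∀ n : ℕ, ((n + 1 : ℕ) : K) • (envι K g ∘ₗ φ (n + 1)) =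
        (atZero (envι K g ∘ₗ A) n + serMul (envι K g ∘ₗ φ n) (envX gm)) -
          serMul (envX gm) (envι K g ∘ₗ φ n) := fun n => by
      rw [← LinearMap.comp_smul, h1, LinearMap.comp_add, hz, LinearMap.comp_smul,
        envι_adX (hφ n), hn, neg_sub, add_sub_assoc]
      rfl
    have e1 : cauchy (LinearMap.mul K (EnvAlg K g)) (fun n => serMul (symCoeff gm n) (envX gm))
        (fun n => envι K g ∘ₗ φ n) n = cauchy (LinearMap.mul K (EnvAlg K g)) (symCoeff gm)
        (fun n => serMul (envX gm) (envι K g ∘ₗ φ n)) n :=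
      Finset.sum_congr rfl fun _ _ => serMul_assoc _ _ _
    have e2 : cauchy (LinearMap.mul K (EnvAlg K g)) (symCoeff gm)
        (fun n => serMul (envι K g ∘ₗ φ n) (envX gm)) n =
        serMul (cauchy (LinearMap.mul K (EnvAlg K g)) (symCoeff gm)
        (fun n => envι K g ∘ₗ φ n) n) (envX gm) := by
      rw [cauchy, cauchy, serMul, ← conv₂_apply, map_sum, LinearMap.sum_apply]
      exact Finset.sum_congr rfl fun _ _ => (serMul_assoc _ _ _).symm
    rw [smul_sub, h2, cauchy_deriv _ symCoeff_succ' h3, cauchy_sub_right, cauchy_add_right, e1, e2,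
      cauchy_atZero_right, sub_eq_zero.1 ih]
    abel

/-- A series satisfying the differential equation `u' = XP u + A e^{t XP}` is the product of
the solution of `φ' = A + [XP, φ]` with `e^{t XP}`. -/
theorem eq_mul_symCoeff {p : ZMod 2} {A : SymAlg K gm.toSubmodule →ₗ[K] g}
    {φ : ℕ → SymAlg K gm.toSubmodule →ₗ[K] g} {u : ℕ → SymAlg K gm.toSubmodule →ₗ[K] EnvAlg K g}
    (hφ : ∀ n, IsHomog K p (φ n)) (h0 : u 0 = envι K g ∘ₗ φ 0)
    (h1 : ∀ n : ℕ, ((n + 1 : ℕ) : K) • φ (n + 1) = atZero A n + (1 : K) • adX gm (φ n))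
    (h2 : ∀ n : ℕ, ((n + 1 : ℕ) : K) • u (n + 1) =
      serMul (envX gm) (u n) + serMul (envι K g ∘ₗ A) (symCoeff gm n))
    {U : SymAlg K gm.toSubmodule →ₗ[K] EnvAlg K g} {Φ : SymAlg K gm.toSubmodule →ₗ[K] g}
    (hU : HasPointwiseSum u U) (hΦ : HasPointwiseSum φ Φ) :
    U = serMul (envι K g ∘ₗ Φ) (symExp gm) := by
  refine sub_eq_zero.1 ((hU.sub ((hΦ.map (envι K g)).cauchy
    (LinearMap.mul K (EnvAlg K g)) (hasPointwiseSum_symCoeff (gm := gm)))).eq_zero ?_)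
  -- The difference `D` of the two sides satisfies `D' = XP D`.
  refine seq_eq_zero (K := K) ?_ fun n ih => ?_
  · rw [cauchy_zero, symCoeff_zero, h0]
    exact sub_eq_zero.2 (serMul_one_right _).symm
  · have hz : ∀ n, envι K g ∘ₗ atZero A n = atZero (envι K g ∘ₗ A) n := fun n => by
      cases n <;> simp [atZero]
    have h3 : ∀ n : ℕ, ((n + 1 : ℕ) : K) • (envι K g ∘ₗ φ (n + 1)) =
        (atZero (envι K g ∘ₗ A) n + serMul (envX gm) (envι K g ∘ₗ φ n)) -
          serMul (envι K g ∘ₗ φ n) (envX gm) := fun n => by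
      rw [← LinearMap.comp_smul, h1, LinearMap.comp_add, hz, LinearMap.comp_smul,
        envι_adX (hφ n), one_smul, add_sub_assoc]
      rfl
    have e1 : cauchy (LinearMap.mul K (EnvAlg K g)) (fun n => serMul (envι K g ∘ₗ φ n) (envX gm))
        (symCoeff gm) n = cauchy (LinearMap.mul K (EnvAlg K g)) (fun n => envι K g ∘ₗ φ n)
        (fun n => serMul (envX gm) (symCoeff gm n)) n :=
      Finset.sum_congr rfl fun _ _ => serMul_assoc _ _ _
    have e2 : cauchy (LinearMap.mul K (EnvAlg K g))
        (fun n => serMul (envX gm) (envι K g ∘ₗ φ n)) (symCoeff gm) n =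
        serMul (envX gm) (cauchy (LinearMap.mul K (EnvAlg K g))
        (fun n => envι K g ∘ₗ φ n) (symCoeff gm) n) := by
      rw [cauchy, cauchy, serMul, ← conv₂_apply, map_sum]
      exact Finset.sum_congr rfl fun _ _ => serMul_assoc _ _ _
    rw [smul_sub, h2, cauchy_deriv _ h3 symCoeff_succ, cauchy_sub_left, cauchy_add_left, e1, e2,
      cauchy_atZero_left, sub_eq_zero.1 ih]
    abel

/-- `x e^{XP} = e^{XP} (e^{-ad XP} x)`. -/
theorem const_mul_symExp {p : ZMod 2} {x : g} (hx : IsHomog K p x) :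
    serMul (constSeries (envι K g x)) (symExp gm) =
      serMul (symExp gm) (envι K g ∘ₗ ser (expS (-1)) (constSeries x)) := by
  refine eq_symCoeff_mul (A := 0) (isHomog_expCoeff (-1) hx) ?_ (fun n => ?_) (fun n => ?_)
    ((hasPointwiseSum_symCoeff (gm := gm)).convProd_left _ _) (hasPointwiseSum_expCoeff (-1) x)
  · rw [symCoeff_zero, expCoeff_zero, envι_constSeries]
    exact serMul_one_right _
  · rw [expCoeff_succ]; simp [atZero]
  · rw [← convProd_smul_right, symCoeff_succ', LinearMap.comp_zero, serMul, serMul, serMul,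
      convProd_zero_right, add_zero]
    exact (serMul_assoc _ _ _).symm

/-- The derivative of `e^{XP}` along a vector field, in terms of the left logarithmic
derivative. -/
theorem symExp_coder {p : ZMod 2} {A : SymAlg K gm.toSubmodule →ₗ[K] gm.toSubmodule}
    (hA : IsHomog K p A) : symExp gm ∘ₗ coder A =
      serMul (symExp gm) (envι K g ∘ₗ ser (quotS (-1)) (gm.toSubmodule.subtype ∘ₗ A)) := by
  have hA' : IsHomog K p (gm.toSubmodule.subtype ∘ₗ A) :=
    (zero_add p) ▸ (subtype_even gm.toSuperSubmodule).comp_hom hA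
  refine eq_symCoeff_mul (A := gm.toSubmodule.subtype ∘ₗ A) (isHomog_formCoeff (-1) hA') ?_
    (formCoeff_succ (-1) _) (fun n => ?_)
    ((hasPointwiseSum_symCoeff (gm := gm)).comp (coder A)) (hasPointwiseSum_formCoeff (-1) _)
  · rw [symCoeff_zero, constSeries_coder, formCoeff, LinearMap.comp_zero]
  · rw [← LinearMap.smul_comp, symCoeff_succ', serMul, convProd_coder _ _ _ hA, envX_coder,
      tw_apply_eq_self isHomog_envX]

/-- `e^{XP} x = (e^{ad XP} x) e^{XP}`. -/
theorem symExp_mul_const {p : ZMod 2} {x : g} (hx : IsHomog K p x) :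
    serMul (symExp gm) (constSeries (envι K g x)) =
      serMul (envι K g ∘ₗ ser (expS 1) (constSeries x)) (symExp gm) := by
  refine eq_mul_symCoeff (A := 0) (isHomog_expCoeff 1 hx) ?_ (fun n => ?_) (fun n => ?_)
    ((hasPointwiseSum_symCoeff (gm := gm)).convProd_right _ _) (hasPointwiseSum_expCoeff 1 x)
  · rw [symCoeff_zero, expCoeff_zero, envι_constSeries]
    exact serMul_one_left _
  · rw [expCoeff_succ]; simp [atZero]
  · rw [← convProd_smul_left, symCoeff_succ, LinearMap.comp_zero, serMul, serMul, serMul,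
      convProd_zero_left, add_zero]
    exact serMul_assoc _ _ _

/-- The derivative of `e^{XP}` along a vector field, in terms of the right logarithmic
derivative. -/
theorem symExp_coder' {p : ZMod 2} {A : SymAlg K gm.toSubmodule →ₗ[K] gm.toSubmodule}
    (hA : IsHomog K p A) : symExp gm ∘ₗ coder A =
      serMul (envι K g ∘ₗ ser (quotS 1) (gm.toSubmodule.subtype ∘ₗ A)) (symExp gm) := by
  have hA' : IsHomog K p (gm.toSubmodule.subtype ∘ₗ A) :=
    (zero_add p) ▸ (subtype_even gm.toSuperSubmodule).comp_hom hA
  refine eq_mul_symCoeff (A := gm.toSubmodule.subtype ∘ₗ A) (isHomog_formCoeff 1 hA') ?_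
    (formCoeff_succ 1 _) (fun n => ?_)
    ((hasPointwiseSum_symCoeff (gm := gm)).comp (coder A)) (hasPointwiseSum_formCoeff 1 _)
  · rw [symCoeff_zero, constSeries_coder, formCoeff, LinearMap.comp_zero]
  · rw [← LinearMap.smul_comp, symCoeff_succ, serMul, convProd_coder _ _ _ hA, envX_coder,
      tw_apply_eq_self (isHomog_symCoeff n), add_comm]

end EnvSeries

/-! ### The substitution `X ↦ -X` -/

section NegX

variable {K : Type u} [Field K] [CharZero K] {E : Type v} [AddCommGroup E] [Module K E]
  [SuperSpace K E]
variable {W₁ W₂ W₃ : Type*}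
  [AddCommGroup W₁] [Module K W₁] [AddCommGroup W₂] [Module K W₂] [SuperSpace K W₂]
  [AddCommGroup W₃] [Module K W₃]

theorem symNeg_ι_mul (e : E) (s : SymAlg K E) :
    symNeg (symι K E e * s) = -(symι K E e * symNeg s) := by
  rw [map_mul, symNeg, symLift_ι, LinearMap.neg_apply, neg_mul]

theorem symNeg_symNeg (s : SymAlg K E) : symNeg (symNeg s) = s := by
  have h : (symNeg (K := K) (E := E)).comp symNeg = AlgHom.id K _ :=
    sym_hom_ext fun x => by simp [symNeg]
  exact DFunLike.congr_fun h s

theorem par_symNeg (s : SymAlg K E) : par K (symNeg s) = symNeg (par K s) := by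
  have h : (symPar (K := K) (g := E)).comp symNeg = symNeg.comp symPar :=
    sym_hom_ext fun x => by simp [symNeg]
  exact DFunLike.congr_fun h s

theorem symNeg_even : IsHomog K 0 (symNeg (K := K) (E := E)).toLinearMap := even_iff.2 par_symNeg

theorem negX_symL (F : SymAlg K E →ₗ[K] W₁) (e : E) :
    negX F ∘ₗ symL e = -negX (F ∘ₗ symL e) := by
  ext s
  simp [negX, symNeg_ι_mul]

theorem tw_negX (i : ZMod 2) (F : SymAlg K E →ₗ[K] W₂) : tw K i (negX F) = negX (tw K i F) := by
  rw [negX, tw_comp_hom, tw_apply_eq_self symNeg_even, negX]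

theorem IsHomog.negX {p : ZMod 2} {F : SymAlg K E →ₗ[K] W₂} (hF : IsHomog K p F) :
    IsHomog K p (negX F) := (add_zero p) ▸ hF.comp_hom symNeg_even

theorem par_negX (F : SymAlg K E →ₗ[K] W₂) : par K (negX F) = negX (par K F) := by
  simpa using tw_negX 1 F

/-- The substitution `X ↦ -X` is multiplicative. -/
theorem negX_convProd (β : W₁ →ₗ[K] W₂ →ₗ[K] W₃) (F : SymAlg K E →ₗ[K] W₁)
    (G : SymAlg K E →ₗ[K] W₂) : negX (convProd β F G) = convProd β (negX F) (negX G) := by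
  ext s
  induction s using sym_induction generalizing F G with
  | one =>
    rw [convProd_one, negX, LinearMap.comp_apply, AlgHom.toLinearMap_apply, map_one, convProd_one]
    simp [negX]
  | add a b ha hb => simp only [map_add, ha, hb]
  | smul c a ha => simp only [map_smul, ha]
  | mul i e s he ih =>
    have h1 := LinearMap.congr_fun (negX_symL (convProd β F G) e) s
    have h2 := LinearMap.congr_fun (convProd_symL β (negX F) (negX G) he) s
    rw [LinearMap.comp_apply, symL_apply] at h1 h2
    rw [h1, h2, convProd_symL _ _ _ he, negX_symL, negX_symL, tw_negX, convProd_neg_left,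
      convProd_neg_right]
    have h3 : ∀ F G : SymAlg K E →ₗ[K] W₃, negX (F + G) = negX F + negX G := fun F G => rfl
    simp only [h3, LinearMap.neg_apply, LinearMap.add_apply, ih, neg_add]

theorem negX_comp_map (f : W₁ →ₗ[K] W₃) (F : SymAlg K E →ₗ[K] W₁) :
    negX (f ∘ₗ F) = f ∘ₗ negX F := rfl

theorem negX_constSeries (x : W₁) : negX (constSeries (K := K) (E := E) x) = constSeries x := by
  have h : (counit (K := K) (E := E)).comp symNeg = counit :=
    sym_hom_ext fun x => by simp [symNeg]
  ext s
  exact congrArg (fun c : K => c • x) (DFunLike.congr_fun h s)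

theorem negX_coder (A : SymAlg K E →ₗ[K] E) :
    coder (negX A) = -(symNeg.toLinearMap ∘ₗ coder A ∘ₗ symNeg.toLinearMap) := by
  have hid : IsHomog K 0 (LinearMap.id (R := K) (M := SymAlg K E)) := even_iff.2 fun _ => rfl
  have h1 : coder A ∘ₗ symNeg.toLinearMap =
      convProd (LinearMap.mul K (SymAlg K E) ∘ₗ symι K E) (negX A) symNeg.toLinearMap := by
    rw [coder, ← convProd_of_even _ _ hid]
    exact negX_convProd _ _ _
  have h2 := convProd_natural (β := LinearMap.mul K (SymAlg K E) ∘ₗ symι K E)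
    (γ := (-1 : K) • (LinearMap.mul K (SymAlg K E) ∘ₗ symι K E)) (f := LinearMap.id)
    (g := symNeg.toLinearMap) (k := symNeg.toLinearMap) symNeg_even
    (fun x y => by
      rw [LinearMap.smul_apply, LinearMap.smul_apply, neg_one_smul K]
      exact symNeg_ι_mul x y) (negX A) symNeg.toLinearMap
  have h3 : symNeg.toLinearMap ∘ₗ symNeg.toLinearMap = LinearMap.id (R := K) (M := SymAlg K E) :=
    LinearMap.ext symNeg_symNeg
  rw [h1, h2, h3, LinearMap.id_comp, convProd_smul_bil, convProd_of_even _ _ hid, coder]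
  ext s
  simp

end NegX

/-! ### The maps `A` and `B` -/

section Projections

variable {K : Type u} [Field K] [CharZero K] {V : Type v} [AddCommGroup V] [Module K V]
  [SuperSpace K V]

theorem projectionOnto_even {P Q : SuperSubmodule K V}
    (hc : IsCompl P.toSubmodule Q.toSubmodule) :
    IsHomog K 0 (P.toSubmodule.projectionOnto Q.toSubmodule hc) := by
  refine even_iff.2 fun x => ?_
  have hx := Submodule.projection_add_projection_eq_self hc x
  conv_rhs => rw [← hx]
  rw [map_add, map_add, ← Submodule.coe_projectionOnto_apply, ← Submodule.coe_projectionOnto_apply,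
    Submodule.projectionOnto_apply_of_mem_right hc (Q.par_mem _ (Subtype.prop _)), add_zero,
    Submodule.projectionOnto_apply_of_mem_left hc (P.par_mem _ (Subtype.prop _))]
  rfl

end Projections

section AB

variable {K : Type u} [Field K] [CharZero K] {g : Type v} [AddCommGroup g] [Module K g]
  [SuperSpace K g] [LieSuper K g] {gm h : LieSuperSub K g}

variable (gm) in
/-- The series `e^{c ad XP} x`. -/
noncomputable def expMap (c : K) : g →ₗ[K] SymAlg K gm.toSubmodule →ₗ[K] g where
  toFun x := ser (expS c) (constSeries x)
  map_add' x y := by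
    rw [← map_add]; congr 1; ext s; simp [constSeries_apply]
  map_smul' a x := by
    rw [← map_smul]; congr 1; ext s; simp [constSeries_apply, smul_comm a]

theorem expMap_apply (c : K) (x : g) : expMap gm c x = ser (expS c) (constSeries x) := rfl

theorem par_expMap (c : K) (x : g) : par K (expMap gm c x) = expMap gm c (par K x) := by
  rw [expMap_apply, par_ser, par_constSeries, expMap_apply]

theorem isHomog_map_of_par {V W : Type*} [AddCommGroup V] [Module K V] [SuperSpace K V]
    [AddCommGroup W] [Module K W] [SuperSpace K W] {f : V →ₗ[K] W}
    (hf : ∀ x, f (par K x) = par K (f x)) {p : ZMod 2} {x : V} (hx : IsHomog K p x) :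
    IsHomog K p (f x) := by
  rw [IsHomog, ← hf, hx, map_smul]

variable (hc : IsCompl gm.toSubmodule h.toSubmodule)

/-- The morphism `x ↦ -(ad XP / (e^{-ad XP} - 1)) Π₋ e^{-ad XP} x`. -/
noncomputable def mapA : g →ₗ[K] SymAlg K gm.toSubmodule →ₗ[K] gm.toSubmodule where
  toFun x := gm.toSubmodule.projectionOnto h.toSubmodule hc ∘ₗ
    ser (toddSeries K) (gm.toSubmodule.projection h.toSubmodule hc ∘ₗ expMap gm (-1) x)
  map_add' x y := by simp only [map_add, LinearMap.comp_add]
  map_smul' a x := by simp only [map_smul, LinearMap.comp_smul, RingHom.id_apply]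

/-- The morphism `x ↦ Π e^{-ad XP} x`, where `Π` is the projection onto `h`. -/
noncomputable def mapB : g →ₗ[K] SymAlg K gm.toSubmodule →ₗ[K] h.toSubmodule where
  toFun x := h.toSubmodule.projectionOnto gm.toSubmodule hc.symm ∘ₗ expMap gm (-1) x
  map_add' x y := by simp only [map_add, LinearMap.comp_add]
  map_smul' a x := by simp only [map_smul, LinearMap.comp_smul, RingHom.id_apply]

theorem subtype_mapA (x : g) : gm.toSubmodule.subtype ∘ₗ mapA hc x =
    ser (toddSeries K) (gm.toSubmodule.projection h.toSubmodule hc ∘ₗ expMap gm (-1) x) := by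
  ext s
  have hm := ser_mem (toddSeries K) (F := gm.toSubmodule.projection h.toSubmodule hc ∘ₗ
    expMap gm (-1) x) (fun s => (gm.toSubmodule.projectionOnto h.toSubmodule hc _).2) s
  simp only [mapA, LinearMap.comp_apply, Submodule.subtype_apply, LinearMap.coe_mk, AddHom.coe_mk]
  rw [Submodule.projectionOnto_apply_of_mem_left hc hm]

theorem subtype_mapB (x : g) : h.toSubmodule.subtype ∘ₗ mapB hc x =
    h.toSubmodule.projection gm.toSubmodule hc.symm ∘ₗ expMap gm (-1) x := rfl

theorem quotS_mul_toddSeries : quotS (-1) * toddSeries K = 1 :=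
  PowerSeries.mul_inv_cancel _ (by
    change PowerSeries.constantCoeff (PowerSeries.mk _) ≠ 0
    simp)

theorem toddSeries_mul_quotS : toddSeries K * quotS (-1) = 1 := by
  rw [mul_comm, quotS_mul_toddSeries]

variable {hc} in
theorem ser_mapA (x : g) : ser (quotS (-1)) (gm.toSubmodule.subtype ∘ₗ mapA hc x) =
    gm.toSubmodule.projection h.toSubmodule hc ∘ₗ expMap gm (-1) x := by
  rw [subtype_mapA, ← ser_mul, quotS_mul_toddSeries, ser_one]

theorem projection_add_projection (F : SymAlg K gm.toSubmodule →ₗ[K] g) :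
    gm.toSubmodule.projection h.toSubmodule hc ∘ₗ F +
      h.toSubmodule.projection gm.toSubmodule hc.symm ∘ₗ F = F := by
  ext s
  exact Submodule.projection_add_projection_eq_self hc (F s)

/-- The decomposition of `e^{-ad XP} x` into the logarithmic derivative of `e^{XP}` along `A(x)`
and `B(x)`. -/
theorem ser_mapA_add_mapB (x : g) : ser (quotS (-1)) (gm.toSubmodule.subtype ∘ₗ mapA hc x) +
    h.toSubmodule.subtype ∘ₗ mapB hc x = expMap gm (-1) x := by
  rw [ser_mapA, subtype_mapB, projection_add_projection]

theorem mapB_par (x : g) : mapB hc (par K x) = par K (mapB hc x) := by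
  have h1 : mapB hc (par K x) = h.toSubmodule.projectionOnto gm.toSubmodule hc.symm ∘ₗ
      expMap gm (-1) (par K x) := rfl
  rw [h1, ← par_expMap]
  conv_lhs => rw [← isHomog_zero_iff.1 (projectionOnto_even (P := h.toSuperSubmodule) hc.symm),
    ← par_comp_hom]
  rfl

theorem mapA_par (x : g) : mapA hc (par K x) = par K (mapA hc x) := by
  have h0 := isHomog_zero_iff.1 (projectionOnto_even (P := gm.toSuperSubmodule)
    (Q := h.toSuperSubmodule) hc)
  have hp : par K (gm.toSubmodule.projection h.toSubmodule hc) =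
      gm.toSubmodule.projection h.toSubmodule hc := by
    have := par_comp_hom gm.toSubmodule.subtype (gm.toSubmodule.projectionOnto h.toSubmodule hc)
    rw [isHomog_zero_iff.1 (subtype_even gm.toSuperSubmodule), h0] at this
    exact this
  have h1 : ∀ x, mapA hc x = gm.toSubmodule.projectionOnto h.toSubmodule hc ∘ₗ
    ser (toddSeries K) (gm.toSubmodule.projection h.toSubmodule hc ∘ₗ expMap gm (-1) x) :=
    fun _ => rfl
  rw [h1, h1, par_comp_hom, par_ser, par_comp_hom, h0, hp, par_expMap]

theorem isHomog_mapA {p : ZMod 2} {x : g} (hx : IsHomog K p x) : IsHomog K p (mapA hc x) :=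
  isHomog_map_of_par (mapA_par hc) hx

theorem isHomog_mapB {p : ZMod 2} {x : g} (hx : IsHomog K p x) : IsHomog K p (mapB hc x) :=
  isHomog_map_of_par (mapB_par hc) hx

theorem isExplicit_mapA_mapB : IsExplicit hc (mapA hc) (mapB hc) := fun x =>
  ⟨expMap gm (-1) x, hasSeries_ser _ _, by rw [subtype_mapA]; exact hasSeries_ser _ _, rfl⟩

/-- The bracket of a Lie subsuperalgebra. -/
def subBr (h : LieSuperSub K g) : h.toSubmodule →ₗ[K] h.toSubmodule →ₗ[K] h.toSubmodule :=
  LinearMap.mk₂ K (fun x y => ⟨br K (x : g) (y : g), h.br_mem x x.2 y y.2⟩)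
    (fun _ _ _ => Subtype.ext (by simp)) (fun _ _ _ => Subtype.ext (by simp))
    (fun _ _ _ => Subtype.ext (by simp)) (fun _ _ _ => Subtype.ext (by simp))

theorem par_subBr (x y : h.toSubmodule) : par K (subBr h x y) = subBr h (par K x) (par K y) :=
  Subtype.ext (LieSuper.par_br (x : g) (y : g))

theorem subtype_subBr (F G : SymAlg K gm.toSubmodule →ₗ[K] h.toSubmodule) :
    h.toSubmodule.subtype ∘ₗ convProd (subBr h) F G =
      serBr (h.toSubmodule.subtype ∘ₗ F) (h.toSubmodule.subtype ∘ₗ G) :=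
  convProd_natural (subtype_even h.toSuperSubmodule) (fun _ _ => rfl) F G

/-- The structure equations of `A` and `B` before projection to the two subalgebras. The left side
results from differentiating `e^{-ad XP} x = θ(A(x)) + B(x)` along `A(y)`, where `θ` is the
logarithmic derivative, and symmetrizing in `x` and `y`; the right side is
`[e^{-ad XP} x, e^{-ad XP} y]`, because `e^{-ad XP}` is an automorphism. -/
theorem structure_equation {p q : ZMod 2} {x y : g} (hx : IsHomog K p x) (hy : IsHomog K q y) :
    ser (quotS (-1)) (gm.toSubmodule.subtype ∘ₗ (mapA hc x ∘ₗ coder (mapA hc y) -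
        sgn K (p * q) • (mapA hc y ∘ₗ coder (mapA hc x)))) +
      h.toSubmodule.subtype ∘ₗ (mapB hc x ∘ₗ coder (mapA hc y) -
        sgn K (p * q) • (mapB hc y ∘ₗ coder (mapA hc x)) +
        convProd (subBr h) (mapB hc x) (mapB hc y)) = expMap gm (-1) (br K x y) := by
  have hAx := isHomog_mapA hc hx
  have hAy := isHomog_mapA hc hy
  have hMC := maurer_cartan hAx hAy
  have e1 := exp_coder hAy hx
  have e2 := exp_coder hAx hy
  rw [← expMap_apply] at e1 e2
  have e3 := serBr_exp (gm := gm) (-1) x y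
  rw [← expMap_apply, ← expMap_apply, ← expMap_apply] at e3
  have sk : serBr (expMap gm (-1) y) (ser (quotS (-1)) (gm.toSubmodule.subtype ∘ₗ mapA hc x)) =
      -(sgn K (p * q) • serBr (ser (quotS (-1)) (gm.toSubmodule.subtype ∘ₗ mapA hc x))
        (expMap gm (-1) y)) := by
    have hθ : IsHomog K p (ser (quotS (-1)) (gm.toSubmodule.subtype ∘ₗ mapA hc x)) := by
      have := (subtype_even gm.toSuperSubmodule).comp_hom hAx
      rw [zero_add] at this
      rw [IsHomog, par_ser, this, map_smul]
    rw [serBr_skew (isHomog_map_of_par (fun x => (par_expMap (gm := gm) (-1) x).symm) hy) hθ,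
      mul_comm]
  have hx' := (ser_mapA_add_mapB hc x).symm
  have hy' := (ser_mapA_add_mapB hc y).symm
  rw [e3.symm, LinearMap.comp_add _ _ h.toSubmodule.subtype, LinearMap.comp_sub _ _ h.toSubmodule.subtype,
    LinearMap.comp_smul, subtype_subBr, ← LinearMap.comp_assoc _ _ h.toSubmodule.subtype,
    ← LinearMap.comp_assoc _ _ h.toSubmodule.subtype, ← sub_eq_of_eq_add hMC]
  rw [sk] at e2
  rw [hx'] at e1 ⊢
  rw [hy'] at e2 ⊢
  generalize ser (quotS (-1)) (gm.toSubmodule.subtype ∘ₗ mapA hc x) = θx at *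
  generalize ser (quotS (-1)) (gm.toSubmodule.subtype ∘ₗ mapA hc y) = θy at *
  generalize h.toSubmodule.subtype ∘ₗ mapB hc x = b₁ at *
  generalize h.toSubmodule.subtype ∘ₗ mapB hc y = b₂ at *
  rw [LinearMap.add_comp] at e1 e2
  rw [eq_sub_of_add_eq' e1, eq_sub_of_add_eq' e2]
  simp only [serBr, convProd_add_left, convProd_add_right, smul_sub, smul_neg, smul_add, smul_smul,
    sgn_mul_self, one_smul]
  abel

/-- The coderivations defined by `A(x)`, `x ∈ g`, form a representation of `g` on `S(g₋)`: this is
the `g₋`-component of the structure equation. -/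
theorem mapA_br {p q : ZMod 2} {x y : g} (hx : IsHomog K p x) (hy : IsHomog K q y) :
    mapA hc x ∘ₗ coder (mapA hc y) - sgn K (p * q) • (mapA hc y ∘ₗ coder (mapA hc x)) =
      mapA hc (br K x y) := by
  have h1 := congrArg (fun F => gm.toSubmodule.projection h.toSubmodule hc ∘ₗ F)
    (structure_equation hc hx hy)
  simp only [LinearMap.comp_add] at h1
  rw [← ser_mapA_add_mapB hc, LinearMap.comp_add] at h1
  have h2 : ∀ F : SymAlg K gm.toSubmodule →ₗ[K] h.toSubmodule,
      gm.toSubmodule.projection h.toSubmodule hc ∘ₗ h.toSubmodule.subtype ∘ₗ F = 0 := fun F => by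
    ext s
    exact congrArg Subtype.val (Submodule.projectionOnto_apply_right hc (F s))
  have h3 : ∀ F : SymAlg K gm.toSubmodule →ₗ[K] gm.toSubmodule,
      gm.toSubmodule.projection h.toSubmodule hc ∘ₗ
        ser (quotS (-1)) (gm.toSubmodule.subtype ∘ₗ F) =
      ser (quotS (-1)) (gm.toSubmodule.subtype ∘ₗ F) := fun F => by
    ext s
    exact congrArg Subtype.val (Submodule.projectionOnto_apply_of_mem_left hc
      (ser_mem _ (fun s => (F s).2) s))
  simp only [h2, h3, add_zero] at h1
  -- The logarithmic derivative is injective: its inverse is the series that defines `A`.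
  have h4 := congrArg (ser (toddSeries K)) h1
  rw [← ser_mul, ← ser_mul, toddSeries_mul_quotS, ser_one, ser_one] at h4
  ext s
  exact LinearMap.congr_fun h4 s

/-- The `h`-component of the structure equation. -/
theorem mapB_br {p q : ZMod 2} {x y : g} (hx : IsHomog K p x) (hy : IsHomog K q y) :
    mapB hc x ∘ₗ coder (mapA hc y) - sgn K (p * q) • (mapB hc y ∘ₗ coder (mapA hc x)) +
      convProd (subBr h) (mapB hc x) (mapB hc y) = mapB hc (br K x y) := by
  have h1 := structure_equation hc hx hy
  rw [mapA_br hc hx hy, ← ser_mapA_add_mapB hc (br K x y)] at h1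
  have h4 := add_left_cancel h1
  ext s
  exact LinearMap.congr_fun h4 s

theorem negX_adX (F : SymAlg K gm.toSubmodule →ₗ[K] g) :
    negX (adX gm F) = -adX gm (negX F) := by
  have hX : negX (XP gm) = -XP gm := by
    ext s
    induction s using sym_induction with
    | one => simp [negX, XP]
    | add a b ha hb => simp only [map_add, ha, hb]
    | smul c a ha => simp only [map_smul, ha]
    | mul i e s he ih =>
      have hc := LinearMap.congr_fun (negX_constSeries (K := K) (E := gm.toSubmodule) (e : g)) s
      simp only [negX, constSeries_apply, LinearMap.comp_apply, AlgHom.toLinearMap_apply] at hc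
      simp [negX, XP, symNeg_ι_mul, hc]
  rw [adX, conv₂_apply, negX_convProd, hX, convProd_neg_left, conv₂_apply]

theorem negX_adX_pow (F : SymAlg K gm.toSubmodule →ₗ[K] g) (n : ℕ) :
    negX ((adX gm ^ n) F) = (-1 : K) ^ n • (adX gm ^ n) (negX F) := by
  induction n with
  | zero => simp
  | succ n ih =>
    rw [pow_succ', Module.End.mul_apply, Module.End.mul_apply, negX_adX, ih, map_smul, pow_succ',
      mul_smul, neg_one_smul]

theorem negX_ser {q q' : PowerSeries K}
    (hq : ∀ n, PowerSeries.coeff n q' = (-1) ^ n * PowerSeries.coeff n q)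
    (F : SymAlg K gm.toSubmodule →ₗ[K] g) : negX (ser q F) = ser q' (negX F) := by
  refine HasPointwiseSum.unique ((hasPointwiseSum_ser q F).comp symNeg.toLinearMap) ?_
  have h := hasPointwiseSum_ser q' (negX F)
  have e : ∀ n, PowerSeries.coeff n q' • (adX gm ^ n) (negX F) =
      (PowerSeries.coeff n q • (adX gm ^ n) F) ∘ₗ symNeg.toLinearMap := fun n => by
    rw [LinearMap.smul_comp, show ((adX gm ^ n) F) ∘ₗ symNeg.toLinearMap = negX ((adX gm ^ n) F)
      from rfl, negX_adX_pow, smul_smul, hq, mul_comm]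
  simpa only [e] using h

theorem negX_expMap (x : g) : negX (expMap gm (-1) x) = expMap gm 1 x := by
  rw [expMap_apply, negX_ser (q' := expS 1), negX_constSeries, expMap_apply]
  intro n
  simp only [expS, PowerSeries.coeff_mk, ← mul_assoc, ← mul_pow]
  norm_num

/-- The decomposition of `e^{ad XP} x` into the right logarithmic derivative of `e^{XP}` along
`A(x)(-X)` and `B(x)(-X)`. -/
theorem ser_mapA_add_mapB_neg (x : g) :
    ser (quotS 1) (gm.toSubmodule.subtype ∘ₗ negX (mapA hc x)) +
      h.toSubmodule.subtype ∘ₗ negX (mapB hc x) = expMap gm 1 x := by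
  rw [← negX_expMap, ← ser_mapA_add_mapB hc]
  have h1 := negX_ser (q' := quotS 1) (q := quotS (-1)) (fun n => by
    simp only [quotS, PowerSeries.coeff_mk, ← mul_assoc, ← mul_pow]
    norm_num) (gm.toSubmodule.subtype ∘ₗ mapA hc x)
  rw [negX_comp_map] at h1
  rw [← h1]
  rfl

theorem negX_mapA_coder (y : g) {W : Type*} [AddCommGroup W] [Module K W]
    (F : SymAlg K gm.toSubmodule →ₗ[K] W) : negX F ∘ₗ coder (negX (mapA hc y)) =
      -negX (F ∘ₗ coder (mapA hc y)) := by
  rw [negX_coder]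
  ext s
  simp [negX, symNeg_symNeg]

theorem negX_mapA_br {p q : ZMod 2} {x y : g} (hx : IsHomog K p x) (hy : IsHomog K q y) :
    negX (mapA hc x) ∘ₗ coder (negX (mapA hc y)) -
      sgn K (p * q) • (negX (mapA hc y) ∘ₗ coder (negX (mapA hc x))) =
      -negX (mapA hc (br K x y)) := by
  rw [← mapA_br hc hx hy, negX_mapA_coder, negX_mapA_coder]
  ext s
  simp [negX]
  abel

theorem negX_mapB_br {p q : ZMod 2} {x y : g} (hx : IsHomog K p x) (hy : IsHomog K q y) :
    convProd (subBr h) (negX (mapB hc x)) (negX (mapB hc y)) -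
      (negX (mapB hc x) ∘ₗ coder (negX (mapA hc y)) -
      sgn K (p * q) • (negX (mapB hc y) ∘ₗ coder (negX (mapA hc x)))) =
      negX (mapB hc (br K x y)) := by
  rw [← mapB_br hc hx hy, negX_mapA_coder, negX_mapA_coder, ← negX_convProd]
  ext s
  simp [negX]
  abel

end AB

/-! ### The exponential identity -/

section ExpIdentity

variable {K : Type u} [Field K] [CharZero K] {g : Type v} [AddCommGroup g] [Module K g]
  [SuperSpace K g] [LieSuper K g] {gm h : LieSuperSub K g}

theorem hasPointwiseSum_single {ι M W : Type*} [AddCommGroup M] [Module K M] [AddCommGroup W]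
    [Module K W] {a : ι → M →ₗ[K] W} (i : ι) {F : M →ₗ[K] W} (hi : a i = F)
    (h : ∀ j, j ≠ i → a j = 0) : HasPointwiseSum a F := fun s => by
  constructor
  · refine (Set.finite_singleton i).subset fun j hj => ?_
    by_contra hne
    exact hj (by simp [h j hne])
  · rw [finsum_eq_single _ i fun j hj => by rw [h j hj, LinearMap.zero_apply], hi]

/-- The powers of `XP + ε A`: the coefficient of `ε` in `(XP + ε A)ⁿ` is the derivative of `XPⁿ`
along the vector field `A`. -/
theorem epsPow_envX {p : ZMod 2} {A : SymAlg K gm.toSubmodule →ₗ[K] gm.toSubmodule}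
    (hA : IsHomog K p A) (n : ℕ) :
    epsPow p (envX gm, envι K g ∘ₗ gm.toSubmodule.subtype ∘ₗ A) n =
      (envPow gm n, envPow gm n ∘ₗ coder A) := by
  induction n with
  | zero => rw [epsPow, envPow, constSeries_coder]
  | succ n ih =>
    rw [epsPow, ih, epsMul, envPow]
    refine Prod.ext rfl ?_
    dsimp only
    rw [(isHomog_envX (gm := gm)).sum_comp (fun i Y => sgn K (i * p) •
      convProd (LinearMap.mul K (EnvAlg K g)) Y (envPow gm n ∘ₗ coder A))
      (fun i => by rw [convProd_zero_left, smul_zero]), zero_mul, sgn_zero, one_smul, serMul,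
      convProd_coder _ _ _ hA, envX_coder, tw_apply_eq_self (isHomog_envPow n)]

theorem hasExp_envX {p : ZMod 2} {A : SymAlg K gm.toSubmodule →ₗ[K] gm.toSubmodule}
    (hA : IsHomog K p A) :
    HasExp p (envX gm, envι K g ∘ₗ gm.toSubmodule.subtype ∘ₗ A)
      (symExp gm, symExp gm ∘ₗ coder A) := by
  constructor
  · simp only [epsPow_envX hA]
    exact hasPointwiseSum_symCoeff
  · simp only [epsPow_envX hA]
    exact (hasPointwiseSum_symCoeff (gm := gm)).comp (coder A)

/-- Since `ε² = 0`, the exponential of `ε c` is `1 + ε c`. -/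
theorem hasExp_nilpotent {E : Type*} [AddCommGroup E] [Module K E] [SuperSpace K E] (p : ZMod 2)
    (c : SymAlg K E →ₗ[K] EnvAlg K g) : HasExp p (0, c) (constSeries 1, c) := by
  have h0 : epsPow p ((0 : SymAlg K E →ₗ[K] EnvAlg K g), c) 0 = (constSeries 1, 0) := rfl
  have h1 : epsPow p ((0 : SymAlg K E →ₗ[K] EnvAlg K g), c) 1 = (0, c) := by
    have : convProd (LinearMap.mul K (EnvAlg K g)) c (constSeries 1) = c := serMul_one_right c
    simp [epsPow, epsMul, convProd_zero_left, convProd_zero_right, this]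
  have h2 : ∀ n, epsPow p ((0 : SymAlg K E →ₗ[K] EnvAlg K g), c) (n + 2) = 0 := by
    intro n
    induction n with
    | zero =>
      rw [epsPow, h1]
      simp [epsMul, convProd_zero_left, convProd_zero_right]
    | succ n ih =>
      rw [epsPow, ih]
      simp [epsMul, convProd_zero_right]
  constructor
  · refine hasPointwiseSum_single 0 (by simp [h0]) fun j hj => ?_
    match j, hj with
    | 1, _ => rw [h1, smul_zero]
    | n + 2, _ => rw [h2, Prod.fst_zero, smul_zero]
  · refine hasPointwiseSum_single 1 (by simp [h1]) fun j hj => ?_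
    match j, hj with
    | 0, _ => rw [h0, smul_zero]
    | n + 2, _ => rw [h2, Prod.snd_zero, smul_zero]

/-- The identity `x e^{XP} = (e^{XP} ∘ coder A(x)) + e^{XP} B(x)`, which is the coefficient of `ε`
in the exponential identity and also the formula for the action of `x` on the induced module. -/
theorem const_mul_symExp_eq (hc : IsCompl gm.toSubmodule h.toSubmodule) {p : ZMod 2} {x : g}
    (hx : IsHomog K p x) : serMul (constSeries (envι K g x)) (symExp gm) =
      symExp gm ∘ₗ coder (mapA hc x) +
        serMul (symExp gm) (envι K g ∘ₗ h.toSubmodule.subtype ∘ₗ mapB hc x) := by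
  rw [const_mul_symExp hx, ← expMap_apply, ← ser_mapA_add_mapB hc, LinearMap.comp_add, serMul,
    convProd_add_right, symExp_coder (isHomog_mapA hc hx)]

theorem expIdentity_mapA_mapB (hc : IsCompl gm.toSubmodule h.toSubmodule) :
    ExpIdentity (mapA hc) (mapB hc) := by
  intro p x hx
  refine ⟨_, (symExp gm, 0), _, _, hasExp_nilpotent p _, ?_, hasExp_envX (isHomog_mapA hc hx),
    hasExp_nilpotent p _, ?_⟩
  · have h0 := hasExp_envX (gm := gm) (p := p) (IsHomog.zero p)
    have z : coder (0 : SymAlg K gm.toSubmodule →ₗ[K] gm.toSubmodule) = 0 := by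
      rw [← sub_self (0 : SymAlg K gm.toSubmodule →ₗ[K] gm.toSubmodule), coder_sub, sub_self]
    rw [z] at h0
    simp only [LinearMap.comp_zero] at h0
    exact h0
  · have h1 := serMul_one_left (symExp gm)
    have h2 := serMul_one_right (symExp gm)
    have h3 := serMul_one_right (symExp gm ∘ₗ coder (mapA hc x))
    have h4 := const_mul_symExp_eq hc hx
    simp only [epsMul, convProd_zero_right, smul_zero, Finset.sum_const_zero, add_zero]
    rw [(isHomog_symExp (gm := gm)).sum_comp (fun i Y => sgn K (i * p) •
      convProd (LinearMap.mul K (EnvAlg K g)) Y (envι K g ∘ₗ h.toSubmodule.subtype ∘ₗ mapB hc x))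
      (fun i => by rw [convProd_zero_left, smul_zero]), zero_mul, sgn_zero, one_smul]
    exact Prod.ext (h1.trans h2.symm) (h4.trans (congrArg (fun Y => Y + _) h3.symm))

end ExpIdentity

/-! ### The symmetrization map -/

section Symmetrization

variable {K : Type u} [Field K] [CharZero K] {g : Type v} [AddCommGroup g] [Module K g]
  [SuperSpace K g] [LieSuper K g] {gm : LieSuperSub K g}

/-- The sign of moving the factor with index `k` to the front of a product of homogeneous
factors. -/
def frontSign (K : Type u) [Field K] {n : ℕ} (p : Fin n → ZMod 2) (k : Fin n) : K :=
  ∏ l, if l < k then sgn K (p k * p l) else 1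

/-- The product of `XP` with a series, evaluated at a product of homogeneous elements. -/
theorem envX_mul_prod {n : ℕ} {q : ZMod 2} {F : SymAlg K gm.toSubmodule →ₗ[K] EnvAlg K g}
    (hF : IsHomog K q F) {p : Fin (n + 1) → ZMod 2} {e : Fin (n + 1) → gm.toSubmodule}
    (he : ∀ k, IsHomog K (p k) (e k)) :
    serMul (envX gm) F (List.ofFn fun k => symι K gm.toSubmodule (e k)).prod =
      ∑ k, (sgn K (p k * q) * frontSign K p k) • (envι K g (e k : g) *
        F (List.ofFn fun l => symι K gm.toSubmodule (e (k.succAbove l))).prod) := by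
  induction n generalizing q F with
  | zero =>
    have h := LinearMap.congr_fun (convProd_symL (LinearMap.mul K (EnvAlg K g)) (envX gm) F (he 0)) 1
    rw [LinearMap.comp_apply, symL_apply] at h
    have hX : envX gm ∘ₗ symL (e 0) = constSeries (envι K g (e 0 : g)) := by
      rw [envX, LinearMap.comp_assoc, XP_symL, envι_constSeries]
    simp only [List.ofFn_succ, List.ofFn_zero, List.prod_cons, List.prod_nil]
    rw [serMul, h, LinearMap.add_apply, convProd_one, convProd_one, hX, tw_of_homog hF]
    simp [frontSign, envX, XP_one]
  | succ n ih =>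
    have h := LinearMap.congr_fun (convProd_symL (LinearMap.mul K (EnvAlg K g)) (envX gm) F (he 0))
      (List.ofFn fun k : Fin (n + 1) => symι K gm.toSubmodule (e k.succ)).prod
    rw [LinearMap.comp_apply, symL_apply] at h
    have hX : envX gm ∘ₗ symL (e 0) = constSeries (envι K g (e 0 : g)) := by
      rw [envX, LinearMap.comp_assoc, XP_symL, envι_constSeries]
    have ih' := ih (hF.comp_hom (isHomog_symL (he 0))) (p := fun k => p k.succ)
      (e := fun k => e k.succ) fun k => he k.succ
    rw [Fin.sum_univ_succ, List.ofFn_succ, List.prod_cons, serMul, h, LinearMap.add_apply, ih', hX,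
      convProd_const_left, tw_of_homog hF]
    congr 1
    · simp [frontSign]
    · refine Finset.sum_congr rfl fun k _ => ?_
      have hs : sgn K (p k.succ * q) * frontSign K p k.succ =
          sgn K (p k.succ * (q + p 0)) * frontSign K (fun k => p k.succ) k := by
        rw [frontSign, Fin.prod_univ_succ, if_pos k.succ_pos, ← mul_assoc, ← sgn_add, ← mul_add]
        simp [frontSign]
      rw [hs]
      congr 2
      rw [List.ofFn_succ (f := fun l => symι K gm.toSubmodule (e (k.succ.succAbove l)))]
      simp

/-- The permutation of `{0, …, n}` sending `0` to `k` and acting as `τ` on the other elements. -/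
def consPerm {n : ℕ} (x : Fin (n + 1) × Equiv.Perm (Fin n)) : Equiv.Perm (Fin (n + 1)) :=
  x.1.cycleRange.symm * Equiv.Perm.decomposeFin.symm (0, x.2)

theorem consPerm_zero {n : ℕ} (x : Fin (n + 1) × Equiv.Perm (Fin n)) : consPerm x 0 = x.1 := by
  simp [consPerm, Fin.cycleRange_symm_zero]

theorem consPerm_succ {n : ℕ} (x : Fin (n + 1) × Equiv.Perm (Fin n)) (l : Fin n) :
    consPerm x l.succ = x.1.succAbove (x.2 l) := by
  simp [consPerm, Fin.cycleRange_symm_succ]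

theorem consPerm_bijective (n : ℕ) : Function.Bijective (consPerm (n := n)) := by
  rw [Fintype.bijective_iff_injective_and_card]
  refine ⟨?_, by simp [Fintype.card_perm, Nat.factorial_succ]⟩
  rintro ⟨k, τ⟩ ⟨k', τ'⟩ h
  have hk : k = k' := by
    have := congrArg (fun f : Equiv.Perm (Fin (n + 1)) => f 0) h
    simpa only [consPerm_zero] using this
  subst hk
  refine Prod.ext rfl (Equiv.ext fun l => ?_)
  have := congrArg (fun f : Equiv.Perm (Fin (n + 1)) => f l.succ) h
  simp only [consPerm_succ] at this
  exact Fin.succAbove_right_injective this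

/-- The sign of a permutation of homogeneous factors, when the new first factor is moved to the
front before the others are permuted. -/
theorem oddSign_consPerm {n : ℕ} (p : Fin (n + 1) → ZMod 2) (k : Fin (n + 1))
    (τ : Equiv.Perm (Fin n)) : oddSign K p (consPerm (k, τ)) =
      frontSign K p k * oddSign K (fun l => p (k.succAbove l)) τ := by
  rw [frontSign, Fin.prod_univ_succAbove _ k, oddSign, Fin.prod_univ_succ]
  congr 1
  · rw [Fin.prod_univ_succ]
    simp only [consPerm_zero, consPerm_succ, lt_self_iff_false, false_and, if_false, one_mul,
      Fin.succ_pos, true_and]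
    exact Equiv.prod_comp τ fun l => if k.succAbove l < k then sgn K (p k * p (k.succAbove l)) else 1
  · refine Finset.prod_congr rfl fun a _ => ?_
    rw [Fin.prod_univ_succ]
    simp [consPerm_succ, Fin.succAbove_lt_succAbove_iff]

/-- The sum of the products of homogeneous elements in all orders, with signs. -/
def symSum {n : ℕ} (p : Fin n → ZMod 2) (e : Fin n → gm.toSubmodule) : EnvAlg K g :=
  ∑ τ : Equiv.Perm (Fin n), oddSign K p τ • (List.ofFn fun k => envι K g (e (τ k) : g)).prod

theorem symSum_succ {n : ℕ} (p : Fin (n + 1) → ZMod 2) (e : Fin (n + 1) → gm.toSubmodule) :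
    symSum p e = ∑ k, frontSign K p k • (envι K g (e k : g) *
      symSum (fun l => p (k.succAbove l)) fun l => e (k.succAbove l)) := by
  rw [symSum, ← (consPerm_bijective n).sum_comp (fun τ : Equiv.Perm (Fin (n + 1)) =>
    oddSign K p τ • (List.ofFn fun k => envι K g (e (τ k) : g)).prod), Fintype.sum_prod_type]
  refine Finset.sum_congr rfl fun k _ => ?_
  rw [symSum, Finset.mul_sum, Finset.smul_sum]
  refine Finset.sum_congr rfl fun τ _ => ?_
  rw [oddSign_consPerm, List.ofFn_succ, List.prod_cons, consPerm_zero, mul_smul_comm, smul_smul]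
  simp only [consPerm_succ]

/-- On products of `n` elements of `g₋`, the series `XPᵐ` is zero for `m ≠ n`, and the signed sum
over all orders for `m = n`. -/
theorem envPow_prod {n : ℕ} (m : ℕ) {p : Fin n → ZMod 2} {e : Fin n → gm.toSubmodule}
    (he : ∀ k, IsHomog K (p k) (e k)) :
    envPow gm m (List.ofFn fun k => symι K gm.toSubmodule (e k)).prod =
      if m = n then symSum p e else 0 := by
  induction n generalizing m with
  | zero =>
    rw [List.ofFn_zero, List.prod_nil]
    cases m with
    | zero => simp [envPow, symSum, oddSign]
    | succ m => simp [envPow, serMul, convProd_one, envX, XP_one]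
  | succ n ih =>
    cases m with
    | zero => simp [envPow, constSeries_apply, List.ofFn_succ]
    | succ m =>
      rw [envPow, envX_mul_prod (isHomog_envPow m) he]
      simp only [ih m (fun l => he (Fin.succAbove _ l)), mul_zero, sgn_zero, one_mul]
      by_cases hmn : m = n
      · simp [hmn, symSum_succ]
      · simp [hmn]

/-- The symmetrization map is `e^{XP}`, read as a linear map `S(g₋) → U(g)`. -/
theorem isSymmetrization_symExp : IsSymmetrization gm.toSuperSubmodule (symExp gm) := by
  intro n p e he
  have h : ∀ m, symCoeff gm m (List.ofFn fun k => symι K gm.toSubmodule (e k)).prod =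
      if m = n then (n.factorial : K)⁻¹ • symSum p e else 0 := fun m => by
    rw [symCoeff, LinearMap.smul_apply, envPow_prod m he]
    by_cases hmn : m = n
    · simp [hmn]
    · simp [hmn]
  rw [(hasPointwiseSum_symCoeff (gm := gm) _).2, finsum_eq_single _ n]
  · rw [h, if_pos rfl]
    rfl
  · intro m hm
    rw [h, if_neg hm]

end Symmetrization

/-! ### Representations of `U(g)` -/

section EnvLift

variable {K : Type u} [Field K] {g : Type v} [AddCommGroup g] [Module K g]
  [SuperSpace K g] [LieSuper K g]

/-- Extension of a representation of `g` to `U(g)`. -/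
def envLift {A : Type w} [Ring A] [Algebra K A] (f : g →ₗ[K] A)
    (hf : ∀ x y, f x * f y - ∑ i : ZMod 2, ∑ j : ZMod 2,
      sgn K (i * j) • (f (comp K j y) * f (comp K i x)) = f (br K x y)) : EnvAlg K g →ₐ[K] A :=
  RingQuot.liftAlgHom K ⟨TensorAlgebra.lift K f, by
    rintro _ _ ⟨x, y⟩
    simpa using hf x y⟩

theorem envLift_ι {A : Type w} [Ring A] [Algebra K A] (f : g →ₗ[K] A) (hf) (x : g) :
    envLift f hf (envι K g x) = f x := by
  have h := RingQuot.liftAlgHom_mkAlgHom_apply K (s := EnvRel K g) (TensorAlgebra.lift K f)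
    (by rintro _ _ ⟨x, y⟩; simpa using hf x y) (TensorAlgebra.ι K x)
  rw [TensorAlgebra.lift_ι_apply] at h
  exact h

theorem env_adjoin : Algebra.adjoin K (Set.range (envι K g)) = ⊤ := by
  set B := Algebra.adjoin K (Set.range (envι K g))
  let f : g →ₗ[K] B := (envι K g).codRestrict B.toSubmodule
    fun e => Algebra.subset_adjoin ⟨e, rfl⟩
  have hf : ∀ x y, f x * f y - ∑ i : ZMod 2, ∑ j : ZMod 2,
      sgn K (i * j) • (f (comp K j y) * f (comp K i x)) = f (br K x y) := fun x y => by
    apply Subtype.ext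
    have h := envι_rel (K := K) x y
    simp only [sum_sgn] at h ⊢
    exact h
  have h : B.val.comp (envLift f hf) = AlgHom.id K _ := env_hom_ext fun x => by
    rw [AlgHom.comp_apply, envLift_ι]
    rfl
  rw [eq_top_iff]
  intro s _
  have := DFunLike.congr_fun h s
  rw [AlgHom.id_apply] at this
  rw [← this]
  exact (envLift f hf s).2

variable [CharZero K]

theorem env_induction_left {P : EnvAlg K g → Prop} (one : P 1)
    (add : ∀ a b, P a → P b → P (a + b)) (smul : ∀ (c : K) a, P a → P (c • a))
    (mul : ∀ (i : ZMod 2) (x : g) (u : EnvAlg K g), IsHomog K i x → P u → P (envι K g x * u))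
    (u : EnvAlg K g) : P u := by
  have key : ∀ a : EnvAlg K g, ∀ u, P u → P (a * u) := by
    intro a
    have ha : a ∈ Algebra.adjoin K (Set.range (envι K g)) := by rw [env_adjoin]; trivial
    induction ha using Algebra.adjoin_induction with
    | mem x hx =>
      obtain ⟨e, rfl⟩ := hx
      intro s hs
      rw [← comp_add (K := K) e, map_add, add_mul]
      exact add _ _ (mul 0 _ _ (isHomog_comp 0 e) hs) (mul 1 _ _ (isHomog_comp 1 e) hs)
    | algebraMap c =>
      intro s hs
      rw [← Algebra.smul_def]
      exact smul c s hs
    | add x y _ _ hx hy =>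
      intro s hs
      rw [add_mul]
      exact add _ _ (hx s hs) (hy s hs)
    | mul x y _ _ hx hy =>
      intro s hs
      rw [mul_assoc]
      exact hx _ (hy s hs)
  simpa using key u 1 one

theorem env_induction_right {P : EnvAlg K g → Prop} (one : P 1)
    (add : ∀ a b, P a → P b → P (a + b)) (smul : ∀ (c : K) a, P a → P (c • a))
    (mul : ∀ (i : ZMod 2) (x : g) (u : EnvAlg K g), IsHomog K i x → P u → P (u * envι K g x))
    (u : EnvAlg K g) : P u := by
  have key : ∀ a : EnvAlg K g, ∀ u, P u → P (u * a) := by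
    intro a
    have ha : a ∈ Algebra.adjoin K (Set.range (envι K g)) := by rw [env_adjoin]; trivial
    induction ha using Algebra.adjoin_induction with
    | mem x hx =>
      obtain ⟨e, rfl⟩ := hx
      intro s hs
      rw [← comp_add (K := K) e, map_add, mul_add]
      exact add _ _ (mul 0 _ _ (isHomog_comp 0 e) hs) (mul 1 _ _ (isHomog_comp 1 e) hs)
    | algebraMap c =>
      intro s hs
      rw [← Algebra.commutes, ← Algebra.smul_def]
      exact smul c s hs
    | add x y _ _ hx hy =>
      intro s hs
      rw [mul_add]
      exact add _ _ (hx s hs) (hy s hs)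
    | mul x y _ _ hx hy =>
      intro s hs
      rw [← mul_assoc]
      exact hy _ (hx s hs)
  simpa using key u 1 one

/-- The relations of a representation need only be checked on homogeneous elements. -/
theorem rep_of_homog {A : Type w} [Ring A] [Algebra K A] {f : g →ₗ[K] A}
    (hf : ∀ (p q : ZMod 2) (x y : g), IsHomog K p x → IsHomog K q y →
      f x * f y - sgn K (p * q) • (f y * f x) = f (br K x y)) (x y : g) :
    f x * f y - ∑ i : ZMod 2, ∑ j : ZMod 2,
      sgn K (i * j) • (f (comp K j y) * f (comp K i x)) = f (br K x y) := by
  have h := fun i j => hf i j _ _ (isHomog_comp i x) (isHomog_comp j y)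
  have h00 := h 0 0
  have h01 := h 0 1
  have h10 := h 1 0
  have h11 := h 1 1
  simp only [mul_zero, mul_one, sgn_zero, sgn_one, one_smul, neg_smul] at h00 h01 h10 h11
  rw [sum_sgn]
  conv_rhs => rw [← comp_add (K := K) x, ← comp_add (K := K) y]
  simp only [map_add, LinearMap.add_apply]
  rw [← h00, ← h01, ← h10, ← h11]
  have hx := congrArg f (comp_add (K := K) x)
  have hy := congrArg f (comp_add (K := K) y)
  rw [map_add] at hx hy
  rw [← hx, ← hy]
  noncomm_ring

/-- The action of `U(g)` on a representation of `g`. -/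
def endLift {M : Type*} [AddCommGroup M] [Module K M] (f : g →ₗ[K] Module.End K M)
    (hf : ∀ (p q : ZMod 2) (x y : g), IsHomog K p x → IsHomog K q y →
      f x * f y - sgn K (p * q) • (f y * f x) = f (br K x y)) : EnvAlg K g →ₐ[K] Module.End K M :=
  envLift f (rep_of_homog hf)

theorem endLift_ι {M : Type*} [AddCommGroup M] [Module K M] (f : g →ₗ[K] Module.End K M) (hf)
    (x : g) : endLift f hf (envι K g x) = f x := envLift_ι _ _ x

end EnvLift

/-! ### The induced module -/

section Ind

variable {K : Type u} [Field K] [CharZero K] {g : Type v} [AddCommGroup g] [Module K g]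
  [SuperSpace K g] [LieSuper K g] {gm h : LieSuperSub K g}
  {V : Type w} [AddCommGroup V] [Module K V] [SuperSpace K V] (ρ : SuperRepr h V)

/-- The right action `m ↦ m ∘ ρ(y)` of `h` on linear maps defined on `V`. -/
def precomp (W : Type*) [AddCommGroup W] [Module K W] :
    (V →ₗ[K] W) →ₗ[K] h.toSubmodule →ₗ[K] (V →ₗ[K] W) :=
  (LinearMap.llcomp K V V W).compl₂ ρ.act

theorem precomp_apply {W : Type*} [AddCommGroup W] [Module K W] (m : V →ₗ[K] W)
    (y : h.toSubmodule) : precomp ρ W m y = m ∘ₗ ρ.act y := rfl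

theorem precomp_br {W : Type*} [AddCommGroup W] [Module K W] (m : V →ₗ[K] W)
    (x y : h.toSubmodule) : precomp ρ W m (subBr h x y) = precomp ρ W (precomp ρ W m x) y -
      ∑ i : ZMod 2, ∑ j : ZMod 2,
        sgn K (i * j) • precomp ρ W (precomp ρ W m (comp K i y)) (comp K j x) := by
  ext v
  have h1 := congrArg m (ρ.act_br x y v)
  simp only [sum_sgn] at h1 ⊢
  simp only [map_sub, map_add] at h1
  exact h1

variable {E : Type v} [AddCommGroup E] [Module K E] [SuperSpace K E]

theorem lift_indOp {W : Type*} [AddCommGroup W] [Module K W]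
    (ψ : SymAlg K E →ₗ[K] V →ₗ[K] W) (H : SymAlg K E →ₗ[K] h.toSubmodule) (s : SymAlg K E) (v : V) :
    TensorProduct.lift ψ (indOp ρ H (s ⊗ₜ[K] v)) = convProd (precomp ρ W) ψ H s v := by
  have hid : IsHomog K 0 (LinearMap.id (R := K) (M := SymAlg K E)) := even_iff.2 fun _ => rfl
  have h1 : convProd (precomp ρ W) ψ H = convProd (precomp ρ W ∘ₗ ψ) LinearMap.id H := by
    have := convProd_natural (β := precomp ρ W ∘ₗ ψ) (γ := precomp ρ W) (f := ψ)
      (g := LinearMap.id) (k := LinearMap.id) (even_iff.2 fun _ => rfl) (fun _ _ => rfl)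
      LinearMap.id H
    simpa using this.symm
  rw [h1, ← convProd_superFlip_of_even_right _ _ hid, convProd_of_even _ _ hid, plainConv]
  simp only [indOp, TensorProduct.lift.tmul, LinearMap.comp_apply]
  induction comul (K := K) s using TensorProduct.induction_on with
  | zero => simp
  | add t t' ht ht' => simp only [map_add, LinearMap.add_apply, ht, ht']
  | tmul a b =>
    simp only [TensorProduct.lift.tmul, LinearMap.compl₁₂_apply, LinearMap.id_apply,
      superFlip_apply, sum_sgn]
    simp only [LinearMap.sum_apply, LinearMap.smul_apply, LinearMap.compl₁₂_apply,
      LinearMap.flip_apply, LinearMap.comp_apply, LinearMap.llcomp_apply, TensorProduct.mk_apply,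
      map_sum, map_smul, TensorProduct.lift.tmul]
    rw [sum_sgn (K := K) fun i j => ψ (comp K j b) (ρ.act (comp K i (H a)) v)]
    simp only [LinearMap.sub_apply, LinearMap.add_apply, precomp_apply, LinearMap.comp_apply]
    abel

/-- The right action `ψ ↦ ψ ∘ coder A(x) + ψ B(x)` of `g` on the linear maps `S(g₋) ⊗ V → W`,
written as series with coefficients in `Hom(V, W)`. -/
noncomputable def indDual (hc : IsCompl gm.toSubmodule h.toSubmodule) {W : Type*} [AddCommGroup W]
    [Module K W] (ψ : SymAlg K gm.toSubmodule →ₗ[K] V →ₗ[K] W) :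
    g →ₗ[K] SymAlg K gm.toSubmodule →ₗ[K] V →ₗ[K] W where
  toFun x := ψ ∘ₗ coder (mapA hc x) + convProd (precomp ρ W) ψ (mapB hc x)
  map_add' x y := by
    rw [map_add, map_add, coder_add, LinearMap.comp_add, convProd_add_right]; abel
  map_smul' c x := by
    rw [map_smul, map_smul, coder_smul, LinearMap.comp_smul, convProd_smul_right, smul_add,
      RingHom.id_apply]

theorem indDual_apply (hc : IsCompl gm.toSubmodule h.toSubmodule) {W : Type*} [AddCommGroup W]
    [Module K W] (ψ : SymAlg K gm.toSubmodule →ₗ[K] V →ₗ[K] W) (x : g) :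
    indDual ρ hc ψ x = ψ ∘ₗ coder (mapA hc x) + convProd (precomp ρ W) ψ (mapB hc x) := rfl

/-- The operators `indDual` form a right action of `g`, by the structure equations of `A` and `B`.
-/
theorem indDual_br (hc : IsCompl gm.toSubmodule h.toSubmodule) {W : Type*} [AddCommGroup W]
    [Module K W] (ψ : SymAlg K gm.toSubmodule →ₗ[K] V →ₗ[K] W) {p q : ZMod 2} {x y : g}
    (hx : IsHomog K p x) (hy : IsHomog K q y) :
    indDual ρ hc (indDual ρ hc ψ x) y - sgn K (p * q) • indDual ρ hc (indDual ρ hc ψ y) x =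
      indDual ρ hc ψ (br K x y) := by
  have hBx := isHomog_mapB hc hx
  have hBy := isHomog_mapB hc hy
  have e1 := convProd_right_action (precomp_br ρ (W := W)) hBx hBy par_subBr ψ
  have e2 := coder_commutator (isHomog_mapA hc hx) (isHomog_mapA hc hy)
  rw [mapA_br hc hx hy] at e2
  rw [indDual_apply ρ hc ψ (br K x y), ← mapB_br hc hx hy, ← e2]
  simp only [indDual_apply, convProd_add_left, convProd_add_right, convProd_sub_right,
    convProd_smul_right, LinearMap.add_comp, LinearMap.comp_sub, LinearMap.comp_smul, e1,
    convProd_coder _ _ _ (isHomog_mapA hc hx), convProd_coder _ _ _ (isHomog_mapA hc hy),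
    tw_of_homog hBx, tw_of_homog hBy, LinearMap.comp_assoc, smul_add, mul_comm q p, smul_smul,
    sgn_mul_self, one_smul]
  abel

/-- The action `x ↦ coder A(x) ⊗ 1 + ρ(B(x))` of `g` on `S(g₋) ⊗ V`, defined as the transpose of the
right action on the linear maps on `S(g₋) ⊗ V`. -/
noncomputable def indMap (hc : IsCompl gm.toSubmodule h.toSubmodule) :
    g →ₗ[K] Module.End K (SymAlg K gm.toSubmodule ⊗[K] V) :=
  (TensorProduct.uncurry (RingHom.id K) (SymAlg K gm.toSubmodule) V
    (SymAlg K gm.toSubmodule ⊗[K] V)).comp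
    (indDual ρ hc (TensorProduct.mk K (SymAlg K gm.toSubmodule) V))

theorem indMap_eq (hc : IsCompl gm.toSubmodule h.toSubmodule) (x : g)
    (t : SymAlg K gm.toSubmodule ⊗[K] V) :
    indMap ρ hc x t = (coder (mapA hc x)).rTensor V t + indOp ρ (mapB hc x) t := by
  induction t using TensorProduct.induction_on with
  | zero => simp
  | add t t' ht ht' => rw [map_add, ht, ht', map_add, map_add]; abel
  | tmul s v =>
    have h1 := lift_indOp ρ (TensorProduct.mk K (SymAlg K gm.toSubmodule) V) (mapB hc x) s v
    rw [TensorProduct.lift_mk, LinearMap.id_apply] at h1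
    rw [h1]
    rfl

theorem lift_indMap (hc : IsCompl gm.toSubmodule h.toSubmodule) {W : Type*} [AddCommGroup W]
    [Module K W] (ψ : SymAlg K gm.toSubmodule →ₗ[K] V →ₗ[K] W) (x : g) :
    TensorProduct.lift ψ ∘ₗ indMap ρ hc x = TensorProduct.lift (indDual ρ hc ψ x) := by
  refine TensorProduct.ext' fun s v => ?_
  rw [LinearMap.comp_apply, indMap_eq, map_add, lift_indOp]
  rfl

theorem indMap_br (hc : IsCompl gm.toSubmodule h.toSubmodule) {p q : ZMod 2} {x y : g}
    (hx : IsHomog K p x) (hy : IsHomog K q y) :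
    indMap ρ hc x * indMap ρ hc y - sgn K (p * q) • (indMap ρ hc y * indMap ρ hc x) =
      indMap ρ hc (br K x y) := by
  have h1 : ∀ x y, indMap ρ hc x * indMap ρ hc y = TensorProduct.lift (indDual ρ hc
      (indDual ρ hc (TensorProduct.mk K (SymAlg K gm.toSubmodule) V) x) y) := fun x y =>
    lift_indMap ρ hc _ y
  have h2 := congrArg TensorProduct.lift (indDual_br ρ hc
    (TensorProduct.mk K (SymAlg K gm.toSubmodule) V) hx hy)
  rw [h1, h1]
  refine Eq.trans ?_ h2
  refine TensorProduct.ext' fun s v => ?_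
  simp only [LinearMap.sub_apply, LinearMap.smul_apply, TensorProduct.lift.tmul]
  rfl

/-- The extension to `U(g)` of the action of `g` on `S(g₋) ⊗ V`. -/
noncomputable def indEnv (hc : IsCompl gm.toSubmodule h.toSubmodule) :
    EnvAlg K g →ₐ[K] Module.End K (SymAlg K gm.toSubmodule ⊗[K] V) :=
  endLift (indMap ρ hc) fun _ _ _ _ hx hy => indMap_br ρ hc hx hy

theorem indEnv_ι (hc : IsCompl gm.toSubmodule h.toSubmodule) (x : g) :
    indEnv ρ hc (envι K g x) = indMap ρ hc x := endLift_ι _ _ x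

theorem indAct_mk (x : g) (u : EnvAlg K g) (v : V) :
    indAct ρ x ((indRel ρ).mkQ (u ⊗ₜ[K] v)) = (indRel ρ).mkQ ((envι K g x * u) ⊗ₜ[K] v) := rfl

theorem mkQ_mul_tmul (u : EnvAlg K g) (y : h.toSubmodule) (v : V) :
    (indRel ρ).mkQ ((u * envι K g (y : g)) ⊗ₜ[K] v) = (indRel ρ).mkQ (u ⊗ₜ[K] ρ.act y v) := by
  refine sub_eq_zero.1 ?_
  rw [← map_sub]
  exact (Submodule.Quotient.mk_eq_zero _).2 (Submodule.subset_span ⟨u, y, v, rfl⟩)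

theorem indReal_tmul (σ : SymAlg K E →ₗ[K] EnvAlg K g) (s : SymAlg K E) (v : V) :
    indReal ρ σ (s ⊗ₜ[K] v) = (indRel ρ).mkQ (σ s ⊗ₜ[K] v) := rfl

/-- The realization of the induced module intertwines the actions, for homogeneous elements. -/
theorem indReal_intertwines_homog (hc : IsCompl gm.toSubmodule h.toSubmodule) {p : ZMod 2} {x : g}
    (hx : IsHomog K p x) : indReal ρ (symExp gm) ∘ₗ indMap ρ hc x =
      indAct ρ x ∘ₗ indReal ρ (symExp gm) := by
  let q : EnvAlg K g →ₗ[K] V →ₗ[K] Ind ρ :=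
    (TensorProduct.mk K (EnvAlg K g) V).compr₂ (indRel ρ).mkQ
  have hq : indReal ρ (symExp gm) = TensorProduct.lift (q ∘ₗ symExp gm) :=
    TensorProduct.ext' fun s v => rfl
  rw [hq, lift_indMap]
  refine TensorProduct.ext' fun s v => ?_
  have e1 := congrArg q (LinearMap.congr_fun (const_mul_symExp_eq hc hx) s)
  rw [serMul, convProd_const_left] at e1
  -- In the induced module the factor `B(x)` moves across the tensor product and acts on `V`.
  have e2 : q ∘ₗ serMul (symExp gm) (envι K g ∘ₗ h.toSubmodule.subtype ∘ₗ mapB hc x) =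
      convProd (precomp ρ (Ind ρ)) (q ∘ₗ symExp gm) (mapB hc x) := by
    let γ : EnvAlg K g →ₗ[K] h.toSubmodule →ₗ[K] V →ₗ[K] Ind ρ :=
      ((LinearMap.mul K (EnvAlg K g)).compl₂ (envι K g ∘ₗ h.toSubmodule.subtype)).compr₂ q
    have hid : IsHomog K 0 (LinearMap.id (R := K) (M := h.toSubmodule)) := even_iff.2 fun _ => rfl
    have hι : IsHomog K 0 (envι K g ∘ₗ h.toSubmodule.subtype) :=
      (zero_add (0 : ZMod 2)) ▸ envι_even.comp_hom (subtype_even h.toSuperSubmodule)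
    have a1 := convProd_natural (β := γ) (γ := precomp ρ (Ind ρ)) (f := q) (g := LinearMap.id)
      (k := LinearMap.id) hid (fun u y => LinearMap.ext fun v => mkQ_mul_tmul ρ u y v) (symExp gm)
      (mapB hc x)
    have a2 := convProd_natural (β := γ) (γ := (LinearMap.mul K (EnvAlg K g)).compr₂ q)
      (f := LinearMap.id) (g := envι K g ∘ₗ h.toSubmodule.subtype)
      (k := LinearMap.id) hι (fun u y => rfl) (symExp gm) (mapB hc x)
    have a3 := convProd_natural (β := LinearMap.mul K (EnvAlg K g))
      (γ := (LinearMap.mul K (EnvAlg K g)).compr₂ q) (f := LinearMap.id)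
      (g := LinearMap.id) (k := q) (even_iff.2 fun _ => rfl) (fun u y => rfl) (symExp gm)
      (envι K g ∘ₗ h.toSubmodule.subtype ∘ₗ mapB hc x)
    exact a3.trans (a2.symm.trans a1)
  rw [LinearMap.add_apply, map_add] at e1
  have e3 := LinearMap.congr_fun e2 s
  rw [LinearMap.comp_apply] at e3
  rw [e3] at e1
  exact (LinearMap.congr_fun e1 v).symm

theorem indReal_intertwines (hc : IsCompl gm.toSubmodule h.toSubmodule) (x : g)
    (t : SymAlg K gm.toSubmodule ⊗[K] V) : indReal ρ (symExp gm) (indMap ρ hc x t) =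
      indAct ρ x (indReal ρ (symExp gm) t) := by
  have ha : ∀ (x y : g) (m : Ind ρ), indAct ρ (x + y) m = indAct ρ x m + indAct ρ y m := by
    intro x y m
    obtain ⟨m, rfl⟩ := (indRel ρ).mkQ_surjective m
    induction m using TensorProduct.induction_on with
    | zero => simp
    | add t t' ht ht' => simp only [map_add, ht, ht']; abel
    | tmul u v => simp only [indAct_mk, map_add, add_mul, TensorProduct.add_tmul]
  have e := fun i => LinearMap.congr_fun (indReal_intertwines_homog ρ hc (isHomog_comp i x)) t
  simp only [LinearMap.comp_apply] at e
  rw [← comp_add (K := K) x, ha, map_add, LinearMap.add_apply, map_add, e, e]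

/-- The image of the realization contains `1 ⊗ V` and is stable under `g`. -/
theorem indReal_surjective (hc : IsCompl gm.toSubmodule h.toSubmodule) :
    Function.Surjective (indReal ρ (symExp gm)) := by
  have key : ∀ (u : EnvAlg K g) (v : V),
      (indRel ρ).mkQ (u ⊗ₜ[K] v) ∈ LinearMap.range (indReal ρ (symExp gm)) := by
    intro u v
    induction u using env_induction_left with
    | one => exact ⟨1 ⊗ₜ[K] v, by rw [indReal_tmul, symExp_one]⟩
    | add a b ha hb => rw [TensorProduct.add_tmul, map_add]; exact Submodule.add_mem _ ha hb
    | smul c a ha =>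
      rw [← TensorProduct.smul_tmul', map_smul]; exact Submodule.smul_mem _ c ha
    | mul i x u _ hu =>
      obtain ⟨t, ht⟩ := hu
      exact ⟨indMap ρ hc x t, by rw [indReal_intertwines, ht, indAct_mk]⟩
  intro m
  obtain ⟨m, rfl⟩ := (indRel ρ).mkQ_surjective m
  change _ ∈ LinearMap.range (indReal ρ (symExp gm))
  induction m using TensorProduct.induction_on with
  | zero => rw [map_zero]; exact Submodule.zero_mem _
  | add t t' ht ht' => rw [map_add]; exact Submodule.add_mem _ ht ht'
  | tmul u v => exact key u v

/-- The constant term of `e^{c ad XP} x`. -/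
theorem expMap_one (c : K) (x : g) : expMap gm c x 1 = x := by
  rw [expMap_apply, ser_apply_of_fil _ _ Nat.zero_lt_one (one_mem_fil 0)]
  simp [expS]

theorem mapB_one (hc : IsCompl gm.toSubmodule h.toSubmodule) (x : g) :
    mapB hc x 1 = h.toSubmodule.projectionOnto gm.toSubmodule hc.symm x :=
  congrArg (h.toSubmodule.projectionOnto gm.toSubmodule hc.symm) (expMap_one (gm := gm) (-1 : K) x)

theorem mapA_one (hc : IsCompl gm.toSubmodule h.toSubmodule) (x : g) :
    mapA hc x 1 = gm.toSubmodule.projectionOnto h.toSubmodule hc x := by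
  have h1 := LinearMap.congr_fun (subtype_mapA hc x) 1
  rw [ser_apply_of_fil _ _ Nat.zero_lt_one (one_mem_fil 0)] at h1
  apply Subtype.ext
  refine h1.trans ?_
  have h2 : PowerSeries.constantCoeff (toddSeries K) = 1 := by
    rw [toddSeries, PowerSeries.constantCoeff_inv]
    simp
  simp [h2, expMap_one]

theorem coder_mem_fil {A : SymAlg K E →ₗ[K] E} (hA : A 1 = 0) {n : ℕ} {s : SymAlg K E}
    (hs : s ∈ fil K E n) : coder A s ∈ fil K E n := by
  refine plainConv_mem hs fun i j hij a ha b hb => ?_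
  rcases Nat.eq_zero_or_pos i with rfl | hi
  · obtain ⟨c, rfl⟩ := mem_fil_zero.1 ha
    simp [hA]
  · exact fil_mono (by omega) (ι_mul_mem_fil (A a) hb)

/-- The coderivation defined by `A` is multiplication by `A(1)`, up to terms that do not raise
the degree. -/
theorem coder_sub_mul_mem_fil (A : SymAlg K E →ₗ[K] E) {n : ℕ} {s : SymAlg K E}
    (hs : s ∈ fil K E n) : coder A s - symι K E (A 1) * s ∈ fil K E n := by
  have h1 : coder (constSeries (A 1)) s = symι K E (A 1) * s := by
    have hid : IsHomog K 0 (LinearMap.id (R := K) (M := SymAlg K E)) := even_iff.2 fun _ => rfl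
    rw [coder, ← convProd_of_even _ _ hid, convProd_const_left]
    rfl
  rw [← h1, ← LinearMap.sub_apply, ← coder_sub]
  exact coder_mem_fil (by simp) hs

theorem indOp_mem {N : Submodule K (SymAlg K E ⊗[K] V)} {n : ℕ}
    (hN : ∀ s ∈ fil K E n, ∀ v : V, s ⊗ₜ[K] v ∈ N) (H : SymAlg K E →ₗ[K] h.toSubmodule)
    {s : SymAlg K E} (hs : s ∈ fil K E n) (v : V) : indOp ρ H (s ⊗ₜ[K] v) ∈ N := by
  have h1 := lift_indOp ρ (TensorProduct.mk K (SymAlg K E) V) H s v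
  rw [TensorProduct.lift_mk, LinearMap.id_apply] at h1
  rw [h1]
  let Q : Submodule K (V →ₗ[K] SymAlg K E ⊗[K] V) :=
    { carrier := {m | ∀ v, m v ∈ N}
      zero_mem' := fun v => N.zero_mem
      add_mem' := fun ha hb v => N.add_mem (ha v) (hb v)
      smul_mem' := fun c m hm v => N.smul_mem c (hm v) }
  have h2 : convProd (W₁ := V →ₗ[K] SymAlg K E ⊗[K] V) (precomp ρ (SymAlg K E ⊗[K] V))
      (TensorProduct.mk K (SymAlg K E) V) H s ∈ Q := by
    refine convProd_mem (W₁ := V →ₗ[K] SymAlg K E ⊗[K] V) (W₂ := h.toSubmodule)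
      (W₃ := V →ₗ[K] SymAlg K E ⊗[K] V) hs fun i j hij a ha b _ k => ?_
    intro v
    exact hN a (fil_mono (by omega) ha) _
  exact h2 v

/-- As a representation of `g`, the space `S(g₋) ⊗ V` is generated by `1 ⊗ V`: for `e ∈ g₋` one has
`A(e)(1) = e`, so `e` sends `s ⊗ v` to `e s ⊗ v` up to terms of lower degree in `S(g₋)`. -/
theorem indMap_generates (hc : IsCompl gm.toSubmodule h.toSubmodule)
    {N : Submodule K (SymAlg K gm.toSubmodule ⊗[K] V)} (h1 : ∀ v : V, 1 ⊗ₜ[K] v ∈ N)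
    (hN : ∀ (x : g), ∀ t ∈ N, indMap ρ hc x t ∈ N) : N = ⊤ := by
  have key : ∀ n, ∀ s ∈ fil K gm.toSubmodule n, ∀ v : V, s ⊗ₜ[K] v ∈ N := by
    intro n
    induction n with
    | zero =>
      intro s hs v
      obtain ⟨c, rfl⟩ := mem_fil_zero.1 hs
      rw [← TensorProduct.smul_tmul']
      exact N.smul_mem c (h1 v)
    | succ n ih =>
      intro s hs
      rw [fil, pow_succ'] at hs
      induction hs using Submodule.mul_induction_on' with
      | add a _ b _ ha hb => intro v; rw [TensorProduct.add_tmul]; exact N.add_mem (ha v) (hb v)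
      | mem_mul_mem a ha s hs =>
        intro v
        obtain ⟨b, hb, c, ⟨e, rfl⟩, rfl⟩ := Submodule.mem_sup.1 ha
        obtain ⟨k, rfl⟩ := Submodule.mem_one.1 hb
        rw [add_mul, TensorProduct.add_tmul, ← Algebra.smul_def, ← TensorProduct.smul_tmul']
        refine N.add_mem (N.smul_mem k (ih s hs v)) ?_
        have h2 := hN (e : g) _ (ih s hs v)
        rw [indMap_eq, LinearMap.rTensor_tmul] at h2
        have h3 := coder_sub_mul_mem_fil (mapA hc (e : g)) hs
        rw [mapA_one, Submodule.projectionOnto_apply_left] at h3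
        have h4 := N.sub_mem (N.sub_mem h2 (indOp_mem ρ ih (mapB hc (e : g)) hs v)) (ih _ h3 v)
        rwa [add_sub_cancel_right, ← TensorProduct.sub_tmul, sub_sub_cancel] at h4
  rw [eq_top_iff]
  intro t _
  induction t using TensorProduct.induction_on with
  | zero => exact N.zero_mem
  | add t t' ht ht' => exact N.add_mem (ht trivial) (ht' trivial)
  | tmul s v =>
    obtain ⟨n, hn⟩ := exists_mem_fil s
    exact key n s hn v

theorem indMap_one_tmul (hc : IsCompl gm.toSubmodule h.toSubmodule) (y : h.toSubmodule) (v : V) :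
    indMap ρ hc (y : g) (1 ⊗ₜ[K] v) = 1 ⊗ₜ[K] ρ.act y v := by
  have h1 := lift_indOp ρ (TensorProduct.mk K (SymAlg K gm.toSubmodule) V) (mapB hc (y : g)) 1 v
  rw [TensorProduct.lift_mk, LinearMap.id_apply, convProd_one, mapB_one,
    Submodule.projectionOnto_apply_left] at h1
  rw [indMap_eq, LinearMap.rTensor_tmul, coder_one, mapA_one, Submodule.projectionOnto_apply_right,
    map_zero, TensorProduct.zero_tmul, zero_add, h1]
  rfl

/-- The map `u ⊗ v ↦ u (1 ⊗ v)` from the induced module to `S(g₋) ⊗ V` is a left inverse of the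
realization: the composition commutes with `g` and fixes the generating subspace `1 ⊗ V`. -/
theorem indReal_injective (hc : IsCompl gm.toSubmodule h.toSubmodule) :
    Function.Injective (indReal ρ (symExp gm)) := by
  let j₀ : EnvAlg K g ⊗[K] V →ₗ[K] SymAlg K gm.toSubmodule ⊗[K] V :=
    TensorProduct.lift ((LinearMap.flip (indEnv ρ hc).toLinearMap ∘ₗ
      TensorProduct.mk K (SymAlg K gm.toSubmodule) V 1).flip)
  have hj₀ : ∀ u v, j₀ (u ⊗ₜ[K] v) = indEnv ρ hc u (1 ⊗ₜ[K] v) := fun u v => rfl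
  have hrel : indRel ρ ≤ LinearMap.ker j₀ := by
    rw [indRel, Submodule.span_le]
    rintro _ ⟨u, y, v, rfl⟩
    rw [SetLike.mem_coe, LinearMap.mem_ker, map_sub, hj₀, hj₀, map_mul, Module.End.mul_apply,
      indEnv_ι, indMap_one_tmul, sub_self]
  let j : Ind ρ →ₗ[K] SymAlg K gm.toSubmodule ⊗[K] V := (indRel ρ).liftQ j₀ hrel
  have hj : ∀ x m, j (indAct ρ x m) = indMap ρ hc x (j m) := by
    intro x m
    obtain ⟨m, rfl⟩ := (indRel ρ).mkQ_surjective m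
    induction m using TensorProduct.induction_on with
    | zero => simp
    | add t t' ht ht' => simp only [map_add, ht, ht']
    | tmul u v =>
      rw [indAct_mk]
      change indEnv ρ hc (envι K g x * u) (1 ⊗ₜ[K] v) = indMap ρ hc x (indEnv ρ hc u (1 ⊗ₜ[K] v))
      rw [map_mul, indEnv_ι, Module.End.mul_apply]
  have htop : LinearMap.eqLocus (j ∘ₗ indReal ρ (symExp gm)) LinearMap.id = ⊤ := by
    refine indMap_generates ρ hc (fun v => ?_) fun x t ht => ?_
    · change j (indReal ρ (symExp gm) (1 ⊗ₜ[K] v)) = 1 ⊗ₜ[K] v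
      rw [indReal_tmul, symExp_one]
      change indEnv ρ hc 1 (1 ⊗ₜ[K] v) = 1 ⊗ₜ[K] v
      rw [map_one, Module.End.one_apply]
    · change j (indReal ρ (symExp gm) (indMap ρ hc x t)) = indMap ρ hc x t
      rw [indReal_intertwines, hj]
      exact congrArg _ ht
  refine Function.LeftInverse.injective (g := j) fun t => ?_
  have ht : t ∈ LinearMap.eqLocus (j ∘ₗ indReal ρ (symExp gm)) LinearMap.id := by
    rw [htop]; trivial
  exact ht

end Ind

/-! ### The coinduced module -/

section CoindTools

variable {K : Type u} [Field K] [CharZero K] {E : Type v} [AddCommGroup E] [Module K E]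
  [SuperSpace K E]
variable {W₁ W₂ W₃ W₄ : Type*} [AddCommGroup W₁] [Module K W₁]
  [AddCommGroup W₂] [Module K W₂] [SuperSpace K W₂]
  [AddCommGroup W₃] [Module K W₃] [AddCommGroup W₄] [Module K W₄] [SuperSpace K W₄]

/-- A product of series whose second factor is composed with a homogeneous linear map. -/
theorem convProd_comp_right (β : W₁ →ₗ[K] W₄ →ₗ[K] W₃) (F : SymAlg K E →ₗ[K] W₁)
    {q : ZMod 2} {f : W₂ →ₗ[K] W₄} (hf : IsHomog K q f) (G : SymAlg K E →ₗ[K] W₂) :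
    convProd β F (f ∘ₗ G) = convProd (β.compl₂ f) (F ∘ₗ tw K q) G := by
  have hp : ∀ F G, plainConv (E := E) β F (f ∘ₗ G) = plainConv (β.compl₂ f) F G := fun F G => rfl
  rcases zmod_two_cases q with rfl | rfl
  · have h0 : F ∘ₗ tw K 0 = F := by ext s; simp
    rw [convProd_eq_plainConv, convProd_eq_plainConv, comp_comp_even 0 hf, comp_comp_even 1 hf, hp,
      hp, h0]
  · have h1 : F ∘ₗ tw K 1 = F ∘ₗ par K := by ext s; simp
    have h2 : (F ∘ₗ par K) ∘ₗ par K = F := by ext s; simp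
    have hc : ∀ i, comp K i (f ∘ₗ G) = f ∘ₗ comp K (i + 1) G := fun i => by
      have hpar : par K (f ∘ₗ G) = -(f ∘ₗ par K G) := by
        rw [par_comp_hom, isHomog_one_iff.1 hf, LinearMap.neg_comp]
      simp only [comp, LinearMap.smul_apply, LinearMap.add_apply, LinearMap.id_apply, hpar, sgn_add,
        sgn_one, LinearMap.comp_smul, LinearMap.comp_add, mul_neg, mul_one, smul_neg, neg_smul,
        LinearMap.comp_neg]
    rw [convProd_eq_plainConv, convProd_eq_plainConv, hc, hc, hp, hp, h1, h2, add_comm]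
    rfl

theorem negX_add (F G : SymAlg K E →ₗ[K] W₁) : negX (F + G) = negX F + negX G := rfl

theorem negX_smul (c : K) (F : SymAlg K E →ₗ[K] W₁) : negX (c • F) = c • negX F := rfl

end CoindTools

section Coind

variable {K : Type u} [Field K] [CharZero K] {g : Type v} [AddCommGroup g] [Module K g]
  [SuperSpace K g] [LieSuper K g] {gm h : LieSuperSub K g}
  {V : Type w} [AddCommGroup V] [Module K V] [SuperSpace K V] (ρ : SuperRepr h V)

theorem par_coind {f : EnvAlg K g →ₗ[K] V} (hf : f ∈ Coind ρ) : par K f ∈ Coind ρ := by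
  rw [mem_coind_iff] at hf ⊢
  intro y u
  have hp : ∀ v : V, ρ.act y (par K v) = par K (ρ.act (par K y) v) := fun v => by
    rw [ρ.par_act, SuperSpace.par_par]
  have pc : ((par K y : h.toSubmodule) : g) = par K (y : g) := rfl
  have p0 : comp K 0 (par K (y : g)) = comp K 0 (y : g) := by rw [← par_comp, par_comp_zero]
  have p1 : comp K 1 (par K (y : g)) = -comp K 1 (y : g) := by rw [← par_comp, par_comp_one]
  simp only [par_hom_apply, hp, hf, pc, p0, p1, par_env_mul, par_env_ι, par_comp_zero,
    par_comp_one, map_neg, map_sub, neg_mul, SuperSpace.par_par]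

theorem coind_of_homog {r : ZMod 2} {f : EnvAlg K g →ₗ[K] V} (hr : IsHomog K r f) :
    f ∈ Coind ρ ↔ ∀ (y : h.toSubmodule) (u : EnvAlg K g),
      ρ.act y (f u) = f (envι K g (tw K r (y : g)) * u) := by
  refine forall_congr' fun y => forall_congr' fun u => ?_
  rw [hr.sum_comp (fun i f => ∑ j : ZMod 2, sgn K (i * j) • f (envι K g (comp K j (y : g)) * u))
    (fun i => by simp), ← sum_sgn_comp]
  simp only [map_sum, map_smul, Finset.sum_mul, smul_mul_assoc]

theorem homAct_of_homog {p : ZMod 2} {x : g} (hx : IsHomog K p x) (f : EnvAlg K g →ₗ[K] V)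
    (u : EnvAlg K g) : homAct x f u = tw K p f (tw K p u * envι K g x) := by
  rw [homAct_apply]
  rcases zmod_two_cases p with rfl | rfl
  · have h1 : comp K 1 x = 0 := hx.comp_ne (by decide)
    rw [hx.comp_self, h1]
    simp
  · have h1 : comp K 0 x = 0 := hx.comp_ne (by decide)
    rw [hx.comp_self, h1, tw_one, tw_one, par_hom_apply, par_env_mul, par_env_ι,
      isHomog_one_iff.1 hx, SuperSpace.par_par]
    simp

theorem isHomog_homAct {p r : ZMod 2} {x : g} (hx : IsHomog K p x) {f : EnvAlg K g →ₗ[K] V}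
    (hr : IsHomog K r f) : IsHomog K (r + p) (homAct x f) := by
  have hx' : IsHomog K p (envι K g x) := (zero_add p) ▸ envι_even.apply hx
  have h1 : IsHomog K p (LinearMap.mulRight K (envι K g x)) := by
    ext u
    change par K (par K u * envι K g x) = _
    rw [par_env_mul, SuperSpace.par_par, hx', mul_smul_comm]
    rfl
  have h2 : IsHomog K 0 (tw K p : EnvAlg K g →ₗ[K] EnvAlg K g) :=
    even_iff.2 fun u => (tw_par p u).symm
  have h3 : homAct x f =
      sgn K (p * r) • (f ∘ₗ LinearMap.mulRight K (envι K g x) ∘ₗ tw K p) := by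
    ext u
    rw [homAct_of_homog hx, tw_of_homog hr]
    rfl
  rw [h3]
  have h4 := (hr.comp_hom (h1.comp_hom h2)).smul (sgn K (p * r))
  rwa [add_zero] at h4

variable (hc : IsCompl gm.toSubmodule h.toSubmodule)

/-- The action `ψ ↦ (-1)^{|x||ψ|} ψ ∘ coder A(x)(-X) + ρ(B(x)(-X)) ψ` of `g` on `V`-valued formal
series; the sum over the parity components of `x` spells out the sign. -/
noncomputable def coindMap : g →ₗ[K] Module.End K (SymAlg K gm.toSubmodule →ₗ[K] V) where
  toFun x :=
    { toFun := fun ψ => ∑ p : ZMod 2, tw K p ψ ∘ₗ coder (negX (mapA hc (comp K p x))) +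
        convProd ρ.act (negX (mapB hc x)) ψ
      map_add' := fun ψ ψ' => by
        simp only [map_add, LinearMap.add_comp, Finset.sum_add_distrib, convProd_add_right]
        abel
      map_smul' := fun c ψ => by
        simp only [map_smul, LinearMap.smul_comp, ← Finset.smul_sum, convProd_smul_right,
          RingHom.id_apply, smul_add] }
  map_add' x y := by
    ext1 ψ
    simp only [map_add, negX_add, coder_add, LinearMap.comp_add, Finset.sum_add_distrib,
      convProd_add_left, LinearMap.coe_mk, AddHom.coe_mk, LinearMap.add_apply]
    abel
  map_smul' c x := by
    ext1 ψ
    simp only [map_smul, negX_smul, coder_smul, LinearMap.comp_smul, ← Finset.smul_sum,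
      convProd_smul_left, LinearMap.coe_mk, AddHom.coe_mk, LinearMap.smul_apply, RingHom.id_apply,
      smul_add]

theorem coindMap_apply (x : g) (ψ : SymAlg K gm.toSubmodule →ₗ[K] V) : coindMap ρ hc x ψ =
    ∑ p : ZMod 2, tw K p ψ ∘ₗ coder (negX (mapA hc (comp K p x))) +
      convProd ρ.act (negX (mapB hc x)) ψ := rfl

theorem coindMap_of_homog {p : ZMod 2} {x : g} (hx : IsHomog K p x)
    (ψ : SymAlg K gm.toSubmodule →ₗ[K] V) : coindMap ρ hc x ψ =
      tw K p ψ ∘ₗ coder (negX (mapA hc x)) + convProd ρ.act (negX (mapB hc x)) ψ := by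
  have hz : negX (0 : SymAlg K gm.toSubmodule →ₗ[K] gm.toSubmodule) = 0 := rfl
  have hz' : coder (0 : SymAlg K gm.toSubmodule →ₗ[K] gm.toSubmodule) = 0 := by
    rw [← sub_self (0 : SymAlg K gm.toSubmodule →ₗ[K] gm.toSubmodule), coder_sub, sub_self]
  rw [coindMap_apply, hx.sum_comp (fun p x => tw K p ψ ∘ₗ coder (negX (mapA hc x)))
    (fun p => by rw [map_zero, hz, hz', LinearMap.comp_zero])]

/-- The operators `coindMap` form a representation of `g`, by the structure equations of `A` and `B`
with `-X` in place of `X`. -/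
theorem coindMap_br {p q : ZMod 2} {x y : g} (hx : IsHomog K p x) (hy : IsHomog K q y) :
    coindMap ρ hc x * coindMap ρ hc y - sgn K (p * q) • (coindMap ρ hc y * coindMap ρ hc x) =
      coindMap ρ hc (br K x y) := by
  ext1 ψ
  have hAx := (isHomog_mapA hc hx).negX
  have hAy := (isHomog_mapA hc hy).negX
  have hBx := (isHomog_mapB hc hx).negX
  have hBy := (isHomog_mapB hc hy).negX
  have e1 := convProd_left_action ρ.par_act (b := subBr h) (fun x y z => ρ.act_br x y z) hBx hBy ψ
  have e2 := coder_commutator hAx hAy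
  rw [negX_mapA_br hc hx hy] at e2
  have e2' : coder (negX (mapA hc (br K x y))) = -(coder (negX (mapA hc x)) ∘ₗ
      coder (negX (mapA hc y)) - sgn K (p * q) • (coder (negX (mapA hc y)) ∘ₗ
        coder (negX (mapA hc x)))) := by
    rw [e2]
    have : -negX (mapA hc (br K x y)) = (-1 : K) • negX (mapA hc (br K x y)) :=
      (neg_one_smul K _).symm
    rw [this, coder_smul]
    ext s
    simp
  rw [LinearMap.sub_apply, LinearMap.smul_apply, Module.End.mul_apply, Module.End.mul_apply,
    coindMap_of_homog ρ hc (hx.br hy), e2', ← negX_mapB_br hc hx hy,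
    coindMap_of_homog ρ hc hx, coindMap_of_homog ρ hc hx, coindMap_of_homog ρ hc hy,
    coindMap_of_homog ρ hc hy]
  have hact : ∀ (x : h.toSubmodule) (v : V), par K (ρ.act x v) = ρ.act (par K x) (par K v) :=
    ρ.par_act
  simp only [map_add, tw_comp_of_homog _ _ (isHomog_coder hAx),
    tw_comp_of_homog _ _ (isHomog_coder hAy), tw_convProd hact, tw_of_homog hBx, tw_of_homog hBy,
    tw_tw, convProd_add_right, convProd_smul_left, convProd_sub_left, LinearMap.add_comp,
    LinearMap.smul_comp, convProd_coder _ _ _ hAx, convProd_coder _ _ _ hAy, e1,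
    LinearMap.comp_neg, LinearMap.comp_sub, LinearMap.comp_smul, LinearMap.comp_assoc, smul_add,
    mul_comm q p, add_comm q p, smul_smul, sgn_mul_self, one_smul, CharTwo.add_self_eq_zero,
    tw_zero]
  abel

/-- The realization of the coinduced module intertwines the actions, for homogeneous elements. -/
theorem homAct_comp_symExp {p r : ZMod 2} {x : g} (hx : IsHomog K p x) {f : EnvAlg K g →ₗ[K] V}
    (hr : IsHomog K r f) (hf : f ∈ Coind ρ) :
    homAct x f ∘ₗ symExp gm = coindMap ρ hc x (f ∘ₗ symExp gm) := by
  have hA := (isHomog_mapA hc hx).negX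
  have hB := (isHomog_mapB hc hx).negX
  have e1 : homAct x f ∘ₗ symExp gm = tw K p f ∘ₗ serMul (symExp gm) (constSeries (envι K g x)) := by
    have hx' : IsHomog K p (envι K g x) := (zero_add p) ▸ envι_even.apply hx
    rw [serMul, convProd_const_right _ hx']
    ext s
    rw [LinearMap.comp_apply, homAct_of_homog hx, even_tw isHomog_symExp]
    rfl
  have e2 : serMul (symExp gm) (constSeries (envι K g x)) =
      symExp gm ∘ₗ coder (negX (mapA hc x)) +
        serMul (envι K g ∘ₗ h.toSubmodule.subtype ∘ₗ negX (mapB hc x)) (symExp gm) := by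
    rw [symExp_mul_const hx, ← expMap_apply, ← ser_mapA_add_mapB_neg hc, LinearMap.comp_add, serMul,
      convProd_add_left, symExp_coder' hA]
  have e3 : convProd ρ.act (negX (mapB hc x)) (f ∘ₗ symExp gm) =
      tw K p f ∘ₗ serMul (envι K g ∘ₗ h.toSubmodule.subtype ∘ₗ negX (mapB hc x)) (symExp gm) := by
    rw [convProd_comp_right _ _ hr]
    have hid : IsHomog K 0 (LinearMap.id (R := K) (M := EnvAlg K g)) := even_iff.2 fun _ => rfl
    let γ : h.toSubmodule →ₗ[K] EnvAlg K g →ₗ[K] V :=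
      ((LinearMap.mul K (EnvAlg K g)).compr₂ f) ∘ₗ envι K g ∘ₗ h.toSubmodule.subtype
    have a1 := convProd_natural (β := ρ.act.compl₂ f) (γ := γ) (f := tw K r)
      (g := LinearMap.id) (k := LinearMap.id) hid
      (fun y u => ((coind_of_homog ρ hr).1 hf y u).trans (by
        rw [show tw K r (y : g) = ((tw K r y : h.toSubmodule) : g) from
          even_tw (subtype_even h.toSuperSubmodule) r y]
        rfl)) (negX (mapB hc x) ∘ₗ tw K r) (symExp gm)
    have a2 := convProd_natural (β := LinearMap.mul K (EnvAlg K g))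
      (γ := (LinearMap.mul K (EnvAlg K g)).compr₂ f) (f := LinearMap.id) (g := LinearMap.id)
      (k := f) hid (fun _ _ => rfl)
      (envι K g ∘ₗ h.toSubmodule.subtype ∘ₗ negX (mapB hc x)) (symExp gm)
    have a3 := convProd_natural (β := γ)
      (γ := (LinearMap.mul K (EnvAlg K g)).compr₂ f) (f := envι K g ∘ₗ h.toSubmodule.subtype)
      (g := LinearMap.id)
      (k := LinearMap.id) hid (fun _ _ => rfl) (negX (mapB hc x)) (symExp gm)
    have a4 : tw K r ∘ₗ negX (mapB hc x) ∘ₗ tw K r = sgn K (r * p) • negX (mapB hc x) := by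
      rw [← tw_of_homog hB]
      ext s
      have := tw_hom_tw r (negX (mapB hc x)) (tw K r s)
      rw [tw_tw, CharTwo.add_self_eq_zero, tw_zero] at this
      exact congrArg Subtype.val this.symm
    rw [LinearMap.id_comp, LinearMap.id_comp] at a1
    rw [a1, a4, convProd_smul_left, tw_of_homog hr, LinearMap.smul_comp, mul_comm]
    congr 1
    exact a3.trans a2.symm
  rw [e1, e2, LinearMap.comp_add, coindMap_of_homog ρ hc hx, e3, tw_comp_hom,
    tw_apply_eq_self isHomog_symExp]
  rfl

theorem comp_mem_coind (i : ZMod 2) {f : EnvAlg K g →ₗ[K] V} (hf : f ∈ Coind ρ) :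
    comp K i f ∈ Coind ρ :=
  (Coind ρ).smul_mem _ ((Coind ρ).add_mem hf ((Coind ρ).smul_mem _ (par_coind ρ hf)))

theorem coindReal_intertwines (x : g) (f : Coind ρ) :
    coindReal ρ (symExp gm) (coindAct ρ x f) = coindMap ρ hc x (coindReal ρ (symExp gm) f) := by
  obtain ⟨f, hf⟩ := f
  change homAct x f ∘ₗ symExp gm = coindMap ρ hc x (f ∘ₗ symExp gm)
  have hadd : ∀ x y : g, homAct (V := V) (x + y) f = homAct x f + homAct y f := fun x y => by
    ext u
    simp only [homAct_apply, map_add, mul_add, LinearMap.add_apply]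
    abel
  have e := fun i j => homAct_comp_symExp ρ hc (isHomog_comp i x) (isHomog_comp j f)
    (comp_mem_coind ρ j hf)
  conv_lhs => rw [← comp_add (K := K) x, hadd, ← comp_add (K := K) f]
  conv_rhs => rw [← comp_add (K := K) x, ← comp_add (K := K) f]
  simp only [map_add, LinearMap.add_comp, LinearMap.add_apply, e]
  abel

/-- The extension to `U(g)` of the action of `g` on `V`-valued formal series. -/
noncomputable def coindEnv : EnvAlg K g →ₐ[K] Module.End K (SymAlg K gm.toSubmodule →ₗ[K] V) :=
  endLift (coindMap ρ hc) fun _ _ _ _ hx hy => coindMap_br ρ hc hx hy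

theorem coindEnv_ι (x : g) : coindEnv ρ hc (envι K g x) = coindMap ρ hc x := endLift_ι _ _ x

theorem par_coindMap (x : g) (ψ : SymAlg K gm.toSubmodule →ₗ[K] V) :
    par K (coindMap ρ hc x ψ) = coindMap ρ hc (par K x) (par K ψ) := by
  have hact : ∀ (x : h.toSubmodule) (v : V), par K (ρ.act x v) = ρ.act (par K x) (par K v) :=
    ρ.par_act
  have e := tw_convProd hact 1 (negX (mapB hc x)) ψ
  simp only [tw_one] at e
  simp only [coindMap_apply, map_add, map_sum, par_comp_hom, ← coder_par, e, par_negX, ← mapA_par,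
    ← mapB_par, par_comp, tw_par]

theorem par_coindEnv (u : EnvAlg K g) (ψ : SymAlg K gm.toSubmodule →ₗ[K] V) :
    par K (coindEnv ρ hc u ψ) = coindEnv ρ hc (par K u) (par K ψ) := by
  induction u using env_induction_left with
  | one => rw [par_env_one, map_one]; rfl
  | add a b ha hb => simp only [map_add, LinearMap.add_apply, ha, hb]
  | smul c a ha => simp only [map_smul, LinearMap.smul_apply, ha]
  | mul i x u _ hu =>
    rw [par_env_mul, map_mul, map_mul, Module.End.mul_apply, Module.End.mul_apply, par_env_ι,
      coindEnv_ι, coindEnv_ι, par_coindMap, hu]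

/-- An element `f` of the coinduced module is recovered from its realization: up to a sign, `f(u)`
is the value at `1` of the series obtained from `f ∘ σ` by the action of `u`. -/
theorem coindEnv_apply_one (u : EnvAlg K g) {r : ZMod 2} {f : EnvAlg K g →ₗ[K] V}
    (hr : IsHomog K r f) (hf : f ∈ Coind ρ) :
    coindEnv ρ hc u (f ∘ₗ symExp gm) 1 = f (tw K r u) := by
  induction u using env_induction_right generalizing r f with
  | one =>
    rw [map_one (coindEnv ρ hc), Module.End.one_apply, LinearMap.comp_apply, symExp_one,
      tw_apply_eq_self (isHomog_zero_iff.2 par_env_one)]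
  | add a b ha hb => simp only [map_add, LinearMap.add_apply, ha hr hf, hb hr hf]
  | smul c a ha => simp only [map_smul, LinearMap.smul_apply, ha hr hf]
  | mul p x u hx hu =>
    have htw : ∀ (i : ZMod 2) (a b : EnvAlg K g), tw K i (a * b) = tw K i a * tw K i b := by
      intro i a b
      rcases zmod_two_cases i with rfl | rfl
      · simp
      · simp [par_env_mul]
    have hx' : IsHomog K p (envι K g x) := (zero_add p) ▸ envι_even.apply hx
    have hr' := isHomog_homAct hx hr
    rw [map_mul, Module.End.mul_apply, coindEnv_ι, ← homAct_comp_symExp ρ hc hx hr hf,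
      hu hr' (homAct_mem ρ x f hf), homAct_of_homog hx, tw_of_homog hr, tw_tw, htw r,
      tw_of_homog hx', LinearMap.smul_apply, mul_smul_comm, map_smul, mul_comm p r]
    have : p + (r + p) = r := by rw [add_comm r p, ← add_assoc, CharTwo.add_self_eq_zero, zero_add]
    rw [this]

theorem coindReal_injective (hc : IsCompl gm.toSubmodule h.toSubmodule) :
    Function.Injective (coindReal ρ (symExp gm)) := by
  rw [injective_iff_map_eq_zero]
  rintro ⟨f, hf⟩ h0
  change f ∘ₗ symExp gm = 0 at h0
  have key : ∀ i, comp K i f = 0 := fun i => by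
    have h1 : comp K i f ∘ₗ symExp gm = 0 := by
      rw [← comp_even_comp i f isHomog_symExp, h0, map_zero]
    ext u
    have h2 := coindEnv_apply_one ρ hc (tw K i u) (isHomog_comp i f) (comp_mem_coind ρ i hf)
    rw [h1, map_zero, tw_tw, CharTwo.add_self_eq_zero, tw_zero] at h2
    exact h2.symm
  apply Subtype.ext
  change f = 0
  rw [← comp_add (K := K) f, key, key, add_zero]

/-- A series annihilated by all the functionals `ψ ↦ (u ψ)(1)`, `u ∈ U(g)`, is zero. By induction on
the degree: for `e ∈ g₋` the value of `e φ` at `s` is `± φ(e s)` up to values of `φ` in lower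
degree. -/
theorem eq_zero_of_coindEnv {φ : SymAlg K gm.toSubmodule →ₗ[K] V}
    (hφ : ∀ u, coindEnv ρ hc u φ 1 = 0) : φ = 0 := by
  have key : ∀ n, ∀ φ : SymAlg K gm.toSubmodule →ₗ[K] V, (∀ u, coindEnv ρ hc u φ 1 = 0) →
      ∀ s ∈ fil K gm.toSubmodule n, φ s = 0 := by
    intro n
    induction n with
    | zero =>
      intro φ hφ s hs
      obtain ⟨c, rfl⟩ := mem_fil_zero.1 hs
      have h1 := hφ 1
      rw [map_one (coindEnv ρ hc), Module.End.one_apply] at h1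
      rw [map_smul, h1, smul_zero]
    | succ n ih =>
      intro φ hφ
      have hmul : ∀ (p : ZMod 2) (e : gm.toSubmodule), IsHomog K p e →
          ∀ s ∈ fil K gm.toSubmodule n, φ (symι K gm.toSubmodule e * s) = 0 := by
        intro p e he s hs
        have he' : IsHomog K p (e : g) := congrArg Subtype.val he
        have h1 := ih (coindMap ρ hc (e : g) φ) (fun u => by
          have := hφ (u * envι K g (e : g))
          rwa [map_mul, Module.End.mul_apply, coindEnv_ι] at this) (tw K p s) (tw_mem_fil p hs)
        have hA : negX (mapA hc (e : g)) 1 = e := by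
          rw [negX, LinearMap.comp_apply, AlgHom.toLinearMap_apply, map_one, mapA_one,
            Submodule.projectionOnto_apply_left]
        have h2 := coder_sub_mul_mem_fil (negX (mapA hc (e : g))) (tw_mem_fil (K := K) p hs)
        rw [hA] at h2
        have htw : ∀ s ∈ fil K gm.toSubmodule n, tw K p φ s = 0 := fun s hs => by
          have := tw_hom_tw p φ (tw K p s)
          rw [tw_tw, CharTwo.add_self_eq_zero, tw_zero, ih φ hφ _ (tw_mem_fil p hs),
            map_zero] at this
          exact this
        have h3 : convProd ρ.act (negX (mapB hc (e : g))) φ (tw K p s) = 0 := by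
          refine (Submodule.mem_bot K).1 (convProd_mem (tw_mem_fil p hs)
            fun i j hij a _ b hb k => ?_)
          rw [comp_eq_zero_of_fil (ih φ hφ) k b (fil_mono (by omega) hb), map_zero]
          exact Submodule.zero_mem _
        rw [coindMap_of_homog ρ hc he', LinearMap.add_apply, h3, add_zero, LinearMap.comp_apply,
          ← sub_add_cancel (coder _ _) (symι K gm.toSubmodule e * tw K p s), map_add, htw _ h2,
          zero_add] at h1
        have h4 := tw_hom_tw p φ (symι K gm.toSubmodule e * s)
        have h5 : tw K p (symι K gm.toSubmodule e * s) =
            sgn K p • (symι K gm.toSubmodule e * tw K p s) := by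
          rcases zmod_two_cases p with rfl | rfl
          · simp
          · rw [tw_one, par_sym_mul, par_sym_ι, isHomog_one_iff.1 he]
            simp
        rw [h5, map_smul, h1, smul_zero] at h4
        have h6 := congrArg (tw K p) h4
        rw [tw_tw, CharTwo.add_self_eq_zero, tw_zero, map_zero] at h6
        exact h6.symm
      intro s hs
      rw [fil, pow_succ'] at hs
      induction hs using Submodule.mul_induction_on' with
      | add a _ b _ ha hb => rw [map_add, ha, hb, add_zero]
      | mem_mul_mem a ha s hs =>
        obtain ⟨b, hb, c, ⟨e, rfl⟩, rfl⟩ := Submodule.mem_sup.1 ha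
        obtain ⟨k, rfl⟩ := Submodule.mem_one.1 hb
        rw [add_mul, ← Algebra.smul_def, map_add, map_smul, ih φ hφ s hs, smul_zero, zero_add,
          ← comp_add (K := K) e, map_add, add_mul, map_add, hmul 0 _ (isHomog_comp 0 e) s hs,
          hmul 1 _ (isHomog_comp 1 e) s hs, add_zero]
  ext s
  obtain ⟨n, hn⟩ := exists_mem_fil s
  exact key n φ hφ s hn

/-- The element `u ↦ (-1)^{r|u|} (u ψ)(1)` of the coinduced module, whose realization is the
homogeneous series `ψ` of parity `r`. -/
noncomputable def coindOf (r : ZMod 2) (ψ : SymAlg K gm.toSubmodule →ₗ[K] V) :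
    EnvAlg K g →ₗ[K] V :=
  LinearMap.applyₗ 1 ∘ₗ LinearMap.applyₗ ψ ∘ₗ (coindEnv ρ hc).toLinearMap ∘ₗ tw K r

theorem coindOf_apply (r : ZMod 2) (ψ : SymAlg K gm.toSubmodule →ₗ[K] V) (u : EnvAlg K g) :
    coindOf ρ hc r ψ u = coindEnv ρ hc (tw K r u) ψ 1 := rfl

theorem isHomog_coindOf {r : ZMod 2} {ψ : SymAlg K gm.toSubmodule →ₗ[K] V} (hψ : IsHomog K r ψ) :
    IsHomog K r (coindOf ρ hc r ψ) := by
  ext u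
  have h1 := par_coindEnv ρ hc (tw K r (par K u)) ψ
  have h2 := LinearMap.congr_fun h1 1
  rw [par_hom_apply', par_sym_one] at h2
  rw [par_hom_apply, coindOf_apply, h2, hψ, tw_par, SuperSpace.par_par, map_smul]
  rfl

theorem coindOf_mem {r : ZMod 2} {ψ : SymAlg K gm.toSubmodule →ₗ[K] V} (hψ : IsHomog K r ψ) :
    coindOf ρ hc r ψ ∈ Coind ρ := by
  rw [coind_of_homog ρ (isHomog_coindOf ρ hc hψ)]
  intro y u
  have htw : ∀ (i : ZMod 2) (a b : EnvAlg K g), tw K i (a * b) = tw K i a * tw K i b := by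
    intro i a b
    rcases zmod_two_cases i with rfl | rfl
    · simp
    · simp [par_env_mul]
  have hA : ∀ p, coder (negX (mapA hc (comp K p (y : g)))) 1 = 0 := fun p => by
    rw [coder_one, negX, LinearMap.comp_apply, AlgHom.toLinearMap_apply, map_one, mapA_one,
      show comp K p (y : g) = ((comp K p y : h.toSubmodule) : g) from
        even_comp (subtype_even h.toSuperSubmodule) p y,
      Submodule.projectionOnto_apply_right, map_zero]
  have hB : negX (mapB hc (y : g)) 1 = y := by
    rw [negX, LinearMap.comp_apply, AlgHom.toLinearMap_apply, map_one, mapB_one,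
      Submodule.projectionOnto_apply_left]
  rw [coindOf_apply, coindOf_apply, htw, even_tw envι_even, tw_tw, CharTwo.add_self_eq_zero,
    tw_zero, map_mul, Module.End.mul_apply, coindEnv_ι, coindMap_apply, LinearMap.add_apply,
    convProd_one, hB, LinearMap.sum_apply]
  simp only [LinearMap.comp_apply, hA, map_zero, Finset.sum_const_zero, zero_add]

/-- The realization of `coindOf ψ` and the series `ψ` have the same values under all the functionals
`ψ ↦ (u ψ)(1)`, hence are equal. -/
theorem coindReal_surjective (hc : IsCompl gm.toSubmodule h.toSubmodule) :
    Function.Surjective (coindReal ρ (symExp gm)) := by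
  have key : ∀ (r : ZMod 2) (ψ : SymAlg K gm.toSubmodule →ₗ[K] V), IsHomog K r ψ →
      ψ ∈ LinearMap.range (coindReal ρ (symExp gm)) := by
    intro r ψ hψ
    refine ⟨⟨coindOf ρ hc r ψ, coindOf_mem ρ hc hψ⟩, ?_⟩
    change coindOf ρ hc r ψ ∘ₗ symExp gm = ψ
    refine sub_eq_zero.1 (eq_zero_of_coindEnv ρ hc fun u => ?_)
    rw [map_sub, LinearMap.sub_apply, coindEnv_apply_one ρ hc u (isHomog_coindOf ρ hc hψ)
      (coindOf_mem ρ hc hψ), coindOf_apply, tw_tw, CharTwo.add_self_eq_zero, tw_zero, sub_self]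
  intro ψ
  change ψ ∈ LinearMap.range (coindReal ρ (symExp gm))
  rw [← comp_add (K := K) ψ]
  exact Submodule.add_mem _ (key 0 _ (isHomog_comp 0 ψ)) (key 1 _ (isHomog_comp 1 ψ))

end Coind

/-! ### The formulas in a homogeneous basis -/

section BasisFormulas

variable {K : Type u} [Field K] [CharZero K] {E : Type v} [AddCommGroup E] [Module K E]
  [SuperSpace K E] {W₂ W₃ : Type*} [AddCommGroup W₂] [Module K W₂] [AddCommGroup W₃] [Module K W₃]
  {ι : Type*} (P : Module.Basis ι K E) {p : ι → ZMod 2}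

/-- Expansion of a product of series in a basis of the space of values of the first factor. -/
theorem hasPointwiseSum_plainConv_coord (β : E →ₗ[K] W₂ →ₗ[K] W₃) (F : SymAlg K E →ₗ[K] E)
    (G : SymAlg K E →ₗ[K] W₂) :
    HasPointwiseSum (fun i => plainConv ((LinearMap.lsmul K W₃).compl₁₂ (P.coord i) (β (P i))) F G)
      (plainConv β F G) := by
  intro s
  simp only [plainConv, LinearMap.comp_apply]
  induction comul (K := K) s using TensorProduct.induction_on with
  | zero => simp
  | add t t' ht ht' =>
    simp only [map_add]
    refine ⟨(ht.1.union ht'.1).subset (Function.support_add _ _), ?_⟩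
    rw [finsum_add_distrib ht.1 ht'.1, ht.2, ht'.2]
  | tmul a b =>
    have hs : (Function.support fun i => TensorProduct.lift
        (((LinearMap.lsmul K W₃).compl₁₂ (P.coord i) (β (P i))).compl₁₂ F G) (a ⊗ₜ[K] b)) ⊆
        ((P.repr (F a)).support : Set ι) := fun i hi => by
      simp only [Finset.mem_coe, Finsupp.mem_support_iff]
      intro h0
      apply hi
      simp [h0]
    refine ⟨(Finset.finite_toSet _).subset hs, ?_⟩
    rw [finsum_eq_sum_of_support_subset _ hs]
    have h1 := P.linearCombination_repr (F a)
    rw [Finsupp.linearCombination_apply, Finsupp.sum] at h1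
    simp only [TensorProduct.lift.tmul, LinearMap.compl₁₂_apply, LinearMap.lsmul_apply,
      Module.Basis.coord_apply]
    conv_lhs => rw [← h1]
    simp only [map_sum, map_smul, LinearMap.sum_apply, LinearMap.smul_apply]

theorem isHomog_coord (hp : ∀ i, IsHomog K (p i) (P i)) (i : ι) :
    IsHomog K (p i) (P.coord i) := by
  have h1 : par K (P.coord i) = P.coord i ∘ₗ par K := rfl
  rw [IsHomog, h1]
  refine P.ext fun j => ?_
  rw [LinearMap.comp_apply, hp j, map_smul, LinearMap.smul_apply]
  by_cases hij : j = i
  · rw [hij]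
  · simp [Finsupp.single_eq_of_ne, Ne.symm hij]

/-- The coefficients `φⁱ` in `A = ∑ φⁱ ⊗ Pᵢ` differ from the coordinates of `A` by the sign of
moving `Pᵢ` to the right. -/
theorem coef_eq (F : SymAlg K E →ₗ[K] E) (i : ι) :
    coef P p F i = tw K (p i) (P.coord i ∘ₗ F) := sum_sgn_comp _ _

theorem contract_eq_plainConv (f : SymAlg K E →ₗ[K] K) :
    contract f = plainConv (LinearMap.lsmul K (SymAlg K E)) f LinearMap.id := by
  ext s
  simp only [contract, plainConv, LinearMap.comp_apply]
  induction comul (K := K) s using TensorProduct.induction_on with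
  | zero => simp
  | add t t' ht ht' => simp only [map_add, ht, ht']
  | tmul a b => simp

/-- In a basis, the coderivation defined by `A` is the sum of the operators `Pᵢ φⁱ(∂/∂P)`. -/
theorem hasPointwiseSum_contract_coef (A : SymAlg K E →ₗ[K] E) :
    HasPointwiseSum (fun i => ∑ j : ZMod 2, sgn K (j * p i) •
      (LinearMap.mulLeft K (symι K E (P i)) ∘ₗ contract (comp K j (coef P p A i)))) (coder A) := by
  have h := hasPointwiseSum_plainConv_coord P (LinearMap.mul K (SymAlg K E) ∘ₗ symι K E) A
    LinearMap.id
  refine Eq.mp (congrArg (fun u => HasPointwiseSum u (coder A)) (funext fun i => ?_)) h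
  have h1 : ∑ j : ZMod 2, sgn K (j * p i) •
      (LinearMap.mulLeft K (symι K E (P i)) ∘ₗ contract (comp K j (coef P p A i))) =
      LinearMap.mulLeft K (symι K E (P i)) ∘ₗ
        contract (∑ j : ZMod 2, sgn K (p i * j) • comp K j (coef P p A i)) := by
    simp only [sum_zmod_two, contract_eq_plainConv, plainConv_add_left, plainConv_smul_left,
      LinearMap.comp_add, LinearMap.comp_smul, mul_comm]
  rw [h1, sum_sgn_comp, coef_eq, tw_tw, CharTwo.add_self_eq_zero, tw_zero, contract_eq_plainConv]
  ext s
  simp only [plainConv, LinearMap.comp_apply]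
  induction comul (K := K) s using TensorProduct.induction_on with
  | zero => simp
  | add t t' ht ht' => simp only [map_add, ht, ht']
  | tmul a b => simp

variable {V : Type w} [AddCommGroup V] [Module K V] [SuperSpace K V]

theorem dualMul_of_homog {r : ZMod 2} {e : E} (he : IsHomog K r e) (ψ : SymAlg K E →ₗ[K] V) :
    dualMul e ψ = tw K r ψ ∘ₗ symL e := by
  have h1 : ∀ i, ∑ j : ZMod 2, sgn K (i * j) •
      (comp K i ψ ∘ₗ LinearMap.mulLeft K (symι K E (comp K j e))) =
      sgn K (r * i) • (comp K i ψ ∘ₗ symL e) := fun i => by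
    rw [he.sum_comp (fun j e => sgn K (i * j) • (comp K i ψ ∘ₗ LinearMap.mulLeft K (symι K E e)))
      (fun j => by ext; simp), mul_comm]
    rfl
  rw [dualMul, Finset.sum_congr rfl fun i _ => h1 i, ← sum_sgn_comp]
  simp only [sum_zmod_two, LinearMap.add_comp, LinearMap.smul_comp]

/-- The product of a homogeneous scalar series with a series. -/
theorem convProd_lsmul_of_homog {r : ZMod 2} {φ : SymAlg K E →ₗ[K] K} (hφ : IsHomog K r φ)
    (G : SymAlg K E →ₗ[K] V) : convProd (LinearMap.lsmul K V) φ G =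
      plainConv (LinearMap.lsmul K V) φ (tw K r G) := by
  have h1 : φ ∘ₗ par K = sgn K r • φ := hφ
  rw [convProd_eq_plainConv, h1, plainConv_smul_left, ← plainConv_smul_right, ← plainConv_add_right,
    ← sum_sgn_comp, sum_zmod_two]
  simp

/-- In a basis, the vector field with components `A` is the sum of the operators `φⁱ Pᵢ^*`. -/
theorem hasPointwiseSum_dualMul (hp : ∀ i, IsHomog K (p i) (P i)) {q : ZMod 2}
    {F : SymAlg K E →ₗ[K] E} (hF : IsHomog K q F) (ψ : SymAlg K E →ₗ[K] V) :
    HasPointwiseSum (fun i => convProd (LinearMap.lsmul K V) (coef P p F i) (dualMul (P i) ψ))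
      (tw K q ψ ∘ₗ coder F) := by
  have h := hasPointwiseSum_plainConv_coord P
    ((LinearMap.mul K (SymAlg K E) ∘ₗ symι K E).compr₂ (tw K q ψ)) F LinearMap.id
  have h0 : plainConv ((LinearMap.mul K (SymAlg K E) ∘ₗ symι K E).compr₂ (tw K q ψ)) F
      LinearMap.id = tw K q ψ ∘ₗ coder F := by
    ext s
    simp only [coder, plainConv, LinearMap.comp_apply]
    induction comul (K := K) s using TensorProduct.induction_on with
    | zero => simp
    | add t t' ht ht' => simp only [map_add, ht, ht']
    | tmul a b => simp
  rw [h0] at h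
  refine Eq.mp (congrArg (fun u => HasPointwiseSum u (tw K q ψ ∘ₗ coder F))
    (funext fun i => ?_)) h
  have hc : IsHomog K (p i + q) (P.coord i ∘ₗ F) := (isHomog_coord P hp i).comp_hom hF
  rw [coef_eq, tw_of_homog hc, convProd_smul_left, convProd_lsmul_of_homog hc,
    dualMul_of_homog (hp i), tw_comp_of_homog _ _ (isHomog_symL (hp i)), plainConv_smul_right,
    smul_smul, mul_comm (p i + q), sgn_mul_self, one_smul, tw_tw, add_right_comm,
    CharTwo.add_self_eq_zero, zero_add]
  ext s
  simp only [plainConv, LinearMap.comp_apply]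
  induction comul (K := K) s using TensorProduct.induction_on with
  | zero => simp
  | add t t' ht ht' => simp only [map_add, ht, ht']
  | tmul a b => simp

end BasisFormulas

section Formulas

variable {K : Type u} [Field K] [CharZero K] {g : Type v} [AddCommGroup g] [Module K g]
  [SuperSpace K g] [LieSuper K g] {gm h : LieSuperSub K g}
  {V : Type w} [AddCommGroup V] [Module K V] [SuperSpace K V] (ρ : SuperRepr h V)
  (hc : IsCompl gm.toSubmodule h.toSubmodule)
  {ι : Type*} (P : Module.Basis ι K gm.toSubmodule) {p : ι → ZMod 2}

theorem indFormula_mapA_mapB : IndFormula ρ (symExp gm) (mapA hc) (mapB hc) P p := fun x =>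
  ⟨coder (mapA hc x), hasPointwiseSum_contract_coef P _, fun t => by
    rw [← indMap_eq, indReal_intertwines]⟩

theorem coindFormula_mapA_mapB (hp : ∀ i, IsHomog K (p i) (P i)) :
    CoindFormula ρ (symExp gm) (mapA hc) (mapB hc) P p := by
  intro x
  refine ⟨coindMap ρ hc x - conv₂ ρ.act (negX (mapB hc x)), fun ψ => ?_, fun f => ?_⟩
  · have e := fun q => hasPointwiseSum_dualMul P hp
      (isHomog_mapA hc (isHomog_comp (K := K) q x)).negX ψ
    have h1 := (e 0).add (e 1)
    have h2 : (coindMap ρ hc x - conv₂ ρ.act (negX (mapB hc x))) ψ =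
        tw K 0 ψ ∘ₗ coder (negX (mapA hc (comp K 0 x))) +
          tw K 1 ψ ∘ₗ coder (negX (mapA hc (comp K 1 x))) := by
      rw [LinearMap.sub_apply, coindMap_apply, conv₂_apply, add_sub_cancel_right, sum_zmod_two]
    rw [h2]
    refine Eq.mp (congrArg (fun u => HasPointwiseSum u _) (funext fun i => ?_)) h1
    conv_rhs => rw [← comp_add (K := K) x, map_add, negX_add]
    simp only [coef_eq, LinearMap.comp_add, map_add, convProd_add_left]
  · rw [coindReal_intertwines ρ hc, LinearMap.sub_apply, conv₂_apply, sub_add_cancel]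

end Formulas

/-! ### Polynomial series -/

section Poly

variable {K : Type u} [Field K] [CharZero K] {E : Type v} [AddCommGroup E] [Module K E]
  [SuperSpace K E] {ι : Type*} {P : Module.Basis ι K E} {p : ι → ZMod 2}
  {W W' : Type*} [AddCommGroup W] [Module K W] [AddCommGroup W'] [Module K W']

theorem polyLE_mono {M N : ℤ} (h : M ≤ N) : polyLE P W M ≤ polyLE P W N :=
  Submodule.span_mono fun _ ⟨t, x, ht, e⟩ => ⟨t, x, ht.trans h, e⟩

theorem monom_smulRight_mem {N : ℤ} {t : List ι} (ht : (t.length : ℤ) ≤ N) (x : W) :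
    (monom P t).smulRight x ∈ polyLE P W N := Submodule.subset_span ⟨t, x, ht, rfl⟩

theorem constSeries_mem_polyLE (x : W) : constSeries x ∈ polyLE P W 0 :=
  monom_smulRight_mem (t := []) (by simp) x

theorem comp_mem_polyLE {N : ℤ} (f : W →ₗ[K] W') {F : SymAlg K E →ₗ[K] W}
    (hF : F ∈ polyLE P W N) : f ∘ₗ F ∈ polyLE P W' N := by
  induction hF using Submodule.span_induction with
  | mem F hF =>
    obtain ⟨t, x, ht, rfl⟩ := hF
    have : f ∘ₗ (monom P t).smulRight x = (monom P t).smulRight (f x) := by ext s; simp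
    rw [this]
    exact monom_smulRight_mem ht _
  | zero => rw [LinearMap.comp_zero]; exact Submodule.zero_mem _
  | add F G _ _ hF hG => rw [LinearMap.comp_add]; exact Submodule.add_mem _ hF hG
  | smul c F _ hF => rw [LinearMap.comp_smul]; exact Submodule.smul_mem _ c hF

theorem negX_coord_symOne (i : ι) : negX (P.coord i ∘ₗ symOne) = -(P.coord i ∘ₗ symOne) := by
  ext s
  induction s using sym_induction with
  | one => simp [negX]
  | add a b ha hb => simp only [map_add, ha, hb]
  | smul c a ha => simp only [map_smul, ha]
  | mul j e s he ih =>
    have hc := LinearMap.congr_fun (negX_constSeries (K := K) (E := E) e) s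
    simp only [negX, constSeries_apply, LinearMap.comp_apply, AlgHom.toLinearMap_apply] at hc
    simp only [negX, LinearMap.comp_apply, AlgHom.toLinearMap_apply, symNeg_ι_mul, map_neg,
      symOne_ι_mul, hc, LinearMap.neg_apply]

theorem negX_monom (t : List ι) : negX (monom P t) = (-1 : K) ^ t.length • monom P t := by
  induction t with
  | nil =>
    have h := negX_constSeries (K := K) (E := E) (1 : K)
    have h1 : constSeries (K := K) (E := E) (1 : K) = monom P [] := by
      ext s; simp [constSeries_apply, monom]
    rw [h1] at h
    simpa using h
  | cons i t ih =>
    rw [monom, negX_convProd, ih, negX_coord_symOne, convProd_neg_left, convProd_smul_right,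
      List.length_cons, pow_succ, mul_neg_one]
    ext s
    simp

theorem negX_mem_polyLE {N : ℤ} {F : SymAlg K E →ₗ[K] W} (hF : F ∈ polyLE P W N) :
    negX F ∈ polyLE P W N := by
  induction hF using Submodule.span_induction with
  | mem F hF =>
    obtain ⟨t, x, ht, rfl⟩ := hF
    have : negX ((monom P t).smulRight x) = (-1 : K) ^ t.length • (monom P t).smulRight x := by
      have h := negX_monom (P := P) t
      ext s
      have hs := LinearMap.congr_fun h s
      simp only [negX, LinearMap.comp_apply, LinearMap.smul_apply, smul_eq_mul,
        AlgHom.toLinearMap_apply] at hs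
      simp [negX, hs, mul_smul]
    rw [this]
    exact Submodule.smul_mem _ _ (monom_smulRight_mem ht _)
  | zero => exact Submodule.zero_mem _
  | add F G _ _ hF hG => exact Submodule.add_mem _ hF hG
  | smul c F _ hF => exact Submodule.smul_mem _ c hF

theorem isHomog_coord_symOne (hp : ∀ i, IsHomog K (p i) (P i)) (i : ι) :
    IsHomog K (p i) (P.coord i ∘ₗ symOne) :=
  (add_zero (p i)) ▸ (isHomog_coord P hp i).comp_hom symOne_even

theorem isHomog_monom (hp : ∀ i, IsHomog K (p i) (P i)) (t : List ι) :
    IsHomog K (t.map p).sum (monom P t) := by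
  induction t with
  | nil => exact isHomog_zero_iff.2 (LinearMap.ext counit_par)
  | cons i t ih =>
    rw [List.map_cons, List.sum_cons]
    exact (isHomog_coord_symOne hp i).convProd (fun _ _ => rfl) ih

theorem tw_mem_polyLE (hp : ∀ i, IsHomog K (p i) (P i)) {N : ℤ} {F : SymAlg K E →ₗ[K] K}
    (hF : F ∈ polyLE P K N) (r : ZMod 2) : tw K r F ∈ polyLE P K N := by
  induction hF using Submodule.span_induction with
  | mem F hF =>
    obtain ⟨t, x, ht, rfl⟩ := hF
    have : (monom P t).smulRight x = x • monom P t := by ext s; simp [mul_comm]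
    have h : IsHomog K (t.map p).sum ((monom P t).smulRight x) :=
      this ▸ (isHomog_monom hp t).smul x
    rw [tw_of_homog h]
    exact Submodule.smul_mem _ _ (monom_smulRight_mem ht _)
  | zero => rw [map_zero]; exact Submodule.zero_mem _
  | add F G _ _ hF hG => rw [map_add]; exact Submodule.add_mem _ hF hG
  | smul c F _ hF => rw [map_smul]; exact Submodule.smul_mem _ c hF

theorem coef_mem_polyLE (hp : ∀ i, IsHomog K (p i) (P i)) {N : ℤ} {F : SymAlg K E →ₗ[K] E}
    (hF : F ∈ polyLE P E N) (i : ι) : coef P p F i ∈ polyLE P K N := by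
  rw [coef_eq]
  exact tw_mem_polyLE hp (comp_mem_polyLE _ hF) _

theorem convProd_smulRight {W₁ : Type*} [AddCommGroup W₁] [Module K W₁] [SuperSpace K W]
    (β : W₁ →ₗ[K] W →ₗ[K] W')
    (φ M : SymAlg K E →ₗ[K] K) (a : W₁) {r : ZMod 2} {x : W} (hx : IsHomog K r x) :
    convProd β (φ.smulRight a) (M.smulRight x) =
      (convProd (LinearMap.mul K K) (tw K r φ) M).smulRight (β a x) := by
  have hf : IsHomog K r (LinearMap.toSpanSingleton K W x) := by
    ext
    change par K ((1 : K) • x) = _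
    rw [one_smul, hx]
    simp
  have h1 : M.smulRight x = LinearMap.toSpanSingleton K W x ∘ₗ M := rfl
  have h2 : φ.smulRight a ∘ₗ tw K r = LinearMap.toSpanSingleton K W₁ a ∘ₗ tw K r φ := by
    rcases zmod_two_cases r with rfl | rfl
    · ext s; simp
    · ext s; rw [tw_one]; simp [par_hom_apply']; rfl
  have hid : IsHomog K 0 (LinearMap.id (R := K) (M := K)) := even_iff.2 fun _ => rfl
  have h3 := convProd_natural (β := LinearMap.mul K K)
    (γ := β.compl₂ (LinearMap.toSpanSingleton K W x)) (f := LinearMap.toSpanSingleton K W₁ a)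
    (g := LinearMap.id) (k := LinearMap.toSpanSingleton K W' (β a x)) hid
    (fun c c' => by simp [mul_smul]) (tw K r φ) M
  rw [h1, convProd_comp_right _ _ hf, h2]
  exact h3.symm

end Poly

/-! ### The graded case -/

section Graded

variable {K : Type u} [Field K] [CharZero K] {g : Type v} [AddCommGroup g] [Module K g]
  [SuperSpace K g] [LieSuper K g] {gm h : LieSuperSub K g}

/-- In finite dimension `ad XP` raises the degree of polynomial series by at most one. -/
theorem adX_mem_polyLE {ι : Type*} {P : Module.Basis ι K gm.toSubmodule} {p : ι → ZMod 2}
    (hp : ∀ i, IsHomog K (p i) (P i)) [Fintype ι] {N : ℤ}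
    {F : SymAlg K gm.toSubmodule →ₗ[K] g} (hF : F ∈ polyLE P g N) :
    adX gm F ∈ polyLE P g (N + 1) := by
  induction hF using Submodule.span_induction with
  | mem F hF =>
    obtain ⟨t, x, ht, rfl⟩ := hF
    have hX : XP gm = ∑ i, (P.coord i ∘ₗ symOne).smulRight (P i : g) := by
      ext s
      have := congrArg gm.toSubmodule.subtype (P.sum_repr (symOne s))
      rw [map_sum] at this
      simp only [map_smul] at this
      rw [LinearMap.sum_apply]
      exact this.symm
    have key : ∀ (r : ZMod 2) (x : g), IsHomog K r x →
        adX gm ((monom P t).smulRight x) ∈ polyLE P g (N + 1) := by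
      intro r x hx
      rw [adX, hX, map_sum, LinearMap.sum_apply]
      refine Submodule.sum_mem _ fun i _ => ?_
      rw [conv₂_apply, convProd_smulRight _ _ _ _ hx, tw_of_homog (isHomog_coord_symOne hp i),
        convProd_smul_left]
      have : (sgn K (r * p i) • convProd (LinearMap.mul K K) (P.coord i ∘ₗ symOne)
          (monom P t)).smulRight (br K (P i : g) x) =
          sgn K (r * p i) • (monom P (i :: t)).smulRight (br K (P i : g) x) := by
        ext s; simp [monom, mul_smul]
      rw [this]
      exact Submodule.smul_mem _ _ (monom_smulRight_mem (by simpa using ht) _)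
    have hx : (monom P t).smulRight x =
        (monom P t).smulRight (comp K 0 x) + (monom P t).smulRight (comp K 1 x) := by
      ext s
      conv_lhs => rw [← comp_add (K := K) x]
      simp
    rw [hx, map_add]
    exact Submodule.add_mem _ (key 0 _ (isHomog_comp 0 x)) (key 1 _ (isHomog_comp 1 x))
  | zero => rw [map_zero]; exact Submodule.zero_mem _
  | add F G _ _ hF hG => rw [map_add]; exact Submodule.add_mem _ hF hG
  | smul c F _ hF => rw [map_smul]; exact Submodule.smul_mem _ c hF

theorem adX_pow_mem_polyLE {ι : Type*} {P : Module.Basis ι K gm.toSubmodule} {p : ι → ZMod 2}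
    (hp : ∀ i, IsHomog K (p i) (P i)) [Fintype ι] {N : ℤ}
    {F : SymAlg K gm.toSubmodule →ₗ[K] g} (hF : F ∈ polyLE P g N) (n : ℕ) :
    (adX gm ^ n) F ∈ polyLE P g (N + n) := by
  induction n with
  | zero => simpa using hF
  | succ n ih =>
    rw [pow_succ', Module.End.mul_apply, Nat.cast_succ, ← add_assoc]
    exact adX_mem_polyLE hp ih

/-- A power series in `ad XP` that terminates on `F` stays in every subspace containing all
`(ad XP)ⁿ F`. -/
theorem ser_mem_submodule (q : PowerSeries K) {F : SymAlg K gm.toSubmodule →ₗ[K] g}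
    {Q : Submodule K (SymAlg K gm.toSubmodule →ₗ[K] g)} (hQ : ∀ n, (adX gm ^ n) F ∈ Q) {N : ℕ}
    (hN : ∀ n, N ≤ n → (adX gm ^ n) F = 0) : ser q F ∈ Q := by
  have h : ser q F = ∑ n ∈ Finset.range N, PowerSeries.coeff n q • (adX gm ^ n) F := by
    ext s
    rw [(hasPointwiseSum_ser q F s).2, LinearMap.sum_apply]
    refine finsum_eq_sum_of_support_subset _ fun i hi => ?_
    by_contra hlt
    simp only [Finset.coe_range, Set.mem_Iio, not_lt] at hlt
    exact hi (by simp [hN i hlt])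
  rw [h]
  exact Submodule.sum_mem _ fun n _ => Submodule.smul_mem _ _ (hQ n)

/-- The subspace of elements of degree at most `m`. The operator `ad XP` maps series with values in
`degLE 𝒢 m` to series with values in `degLE 𝒢 (m - 1)`, and `degLE 𝒢 m` vanishes for `m < -l`. -/
def degLE (𝒢 : ℤ → Submodule K g) (m : ℤ) : Submodule K g := ⨆ k : ℤ, ⨆ _ : k ≤ m, 𝒢 k

theorem degLE_induction {𝒢 : ℤ → Submodule K g} {m : ℤ} {Q : Submodule K g}
    (hQ : ∀ k, k ≤ m → 𝒢 k ≤ Q) : degLE 𝒢 m ≤ Q := iSup₂_le hQ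

theorem le_degLE {𝒢 : ℤ → Submodule K g} {k m : ℤ} (hk : k ≤ m) : 𝒢 k ≤ degLE 𝒢 m :=
  le_iSup₂_of_le k hk le_rfl

variable {l : ℕ} {𝒢 : ℤ → Submodule K g} (hG : IsDepthGrading gm h l 𝒢)
include hG

theorem degLE_eq_bot {m : ℤ} (hm : m < -l) : degLE 𝒢 m = ⊥ :=
  le_bot_iff.1 (degLE_induction fun k hk => (hG.eq_bot k (by omega)).le)

theorem par_mem_degLE {m : ℤ} {x : g} (hx : x ∈ degLE 𝒢 m) : par K x ∈ degLE 𝒢 m :=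
  (degLE_induction (Q := (degLE 𝒢 m).comap (par K))
    fun k hk x hx => le_degLE hk (hG.par_mem k x hx)) hx

theorem br_mem_degLE {a b : ℤ} {x y : g} (hx : x ∈ degLE 𝒢 a) (hy : y ∈ degLE 𝒢 b) :
    br K x y ∈ degLE 𝒢 (a + b) := by
  refine (degLE_induction (Q := (degLE 𝒢 (a + b)).comap ((br K).flip y)) fun k hk x hx => ?_) hx
  refine (degLE_induction (Q := (degLE 𝒢 (a + b)).comap (br K x)) fun j hj y hy => ?_) hy
  exact le_degLE (add_le_add hk hj) (hG.br_mem k j x hx y hy)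

theorem le_degLE_neg_one : gm.toSubmodule ≤ degLE 𝒢 (-1) := by
  rw [hG.neg_eq]
  exact iSup₂_le fun n hn => le_degLE (by omega)

theorem projection_mem_degLE (hc : IsCompl gm.toSubmodule h.toSubmodule) {m : ℤ} {x : g}
    (hx : x ∈ degLE 𝒢 m) : gm.toSubmodule.projection h.toSubmodule hc x ∈ degLE 𝒢 m := by
  refine (degLE_induction (Q := (degLE 𝒢 m).comap
    (gm.toSubmodule.projection h.toSubmodule hc)) fun k hk x hx => ?_) hx
  rw [Submodule.mem_comap, ← Submodule.coe_projectionOnto_apply]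
  rcases lt_or_ge k 0 with h0 | h0
  · have hx' : x ∈ gm.toSubmodule := by
      rw [hG.neg_eq]
      exact Submodule.mem_iSup_of_mem k (Submodule.mem_iSup_of_mem h0 hx)
    rw [Submodule.projectionOnto_apply_of_mem_left hc hx']
    exact le_degLE hk hx
  · have hx' : x ∈ h.toSubmodule := by
      rw [hG.nonneg_eq]
      exact Submodule.mem_iSup_of_mem k (Submodule.mem_iSup_of_mem h0 hx)
    rw [Submodule.projectionOnto_apply_of_mem_right hc hx']
    exact Submodule.zero_mem _

theorem adX_pow_mem_degLE {F : SymAlg K gm.toSubmodule →ₗ[K] g} {m : ℤ}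
    (hF : ∀ s, F s ∈ degLE 𝒢 m) (n : ℕ) (s : SymAlg K gm.toSubmodule) :
    (adX gm ^ n) F s ∈ degLE 𝒢 (m - n) := by
  induction n generalizing s with
  | zero => simpa using hF s
  | succ n ih =>
    rw [pow_succ', Module.End.mul_apply]
    have e : m - ((n + 1 : ℕ) : ℤ) = -1 + (m - n) := by push_cast; ring
    rw [e]
    exact convProd_mem_of_forall (fun x hx => par_mem_degLE hG hx)
      (fun x hx y hy => br_mem_degLE hG (le_degLE_neg_one hG hx) hy) XP_mem ih s

theorem adX_pow_const_mem {d : ℤ} {x : g} (hx : x ∈ 𝒢 d) (n : ℕ) (s : SymAlg K gm.toSubmodule) :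
    (adX gm ^ n) (constSeries x) s ∈ degLE 𝒢 (d - n) :=
  adX_pow_mem_degLE hG (fun _ => Submodule.smul_mem _ _ (le_degLE le_rfl hx)) n s

theorem adX_pow_const_eq_zero {d : ℤ} {x : g} (hx : x ∈ 𝒢 d) {n : ℕ} (hn : (l : ℤ) + d < n) :
    (adX gm ^ n) (constSeries x) = 0 := by
  ext s
  have h1 := adX_pow_const_mem hG hx n s
  rw [degLE_eq_bot hG (by omega)] at h1
  exact (Submodule.mem_bot K).1 h1

theorem adX_pow_projection_eq_zero (hc : IsCompl gm.toSubmodule h.toSubmodule) {d : ℤ} {x : g}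
    (hx : x ∈ 𝒢 d) {n k : ℕ} (hn : (l : ℤ) + d < (n : ℤ) + k) :
    (adX gm ^ k) (gm.toSubmodule.projection h.toSubmodule hc ∘ₗ
      (adX gm ^ n) (constSeries x)) = 0 := by
  ext s
  have h1 := adX_pow_mem_degLE hG (F := gm.toSubmodule.projection h.toSubmodule hc ∘ₗ
      (adX gm ^ n) (constSeries x))
    (fun s => projection_mem_degLE hG hc (adX_pow_const_mem hG hx n s)) k s
  rw [degLE_eq_bot hG (by omega)] at h1
  exact (Submodule.mem_bot K).1 h1

variable {ι : Type*} {P : Module.Basis ι K gm.toSubmodule} {p : ι → ZMod 2}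
  (hp : ∀ i, IsHomog K (p i) (P i)) [Fintype ι] (hc : IsCompl gm.toSubmodule h.toSubmodule)
  {d : ℤ} {x : g} (hx : x ∈ 𝒢 d)
include hp hx

theorem expMap_mem_polyLE : expMap gm (-1) x ∈ polyLE P g (l + d) := by
  refine ser_mem_submodule _ (fun n => ?_) (N := (l + d + 1).toNat) fun n hn =>
    adX_pow_const_eq_zero hG hx (by omega)
  by_cases hn : (l : ℤ) + d < n
  · rw [adX_pow_const_eq_zero hG hx hn]
    exact Submodule.zero_mem _
  · have h1 := adX_pow_mem_polyLE hp (constSeries_mem_polyLE (P := P) x) n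
    exact polyLE_mono (by omega) h1

theorem mapB_mem_polyLE : mapB hc x ∈ polyLE P h.toSubmodule (l + d) :=
  comp_mem_polyLE _ (expMap_mem_polyLE hG hp hx)

theorem mapA_mem_polyLE : mapA hc x ∈ polyLE P gm.toSubmodule (l + d) := by
  refine comp_mem_polyLE _ ?_
  -- The operator `(ad XP / (1 - e^{-ad XP})) Π₋`; its linearity allows both series to be bounded
  -- term by term.
  let T : (SymAlg K gm.toSubmodule →ₗ[K] g) →ₗ[K] (SymAlg K gm.toSubmodule →ₗ[K] g) :=
    ser (toddSeries K) ∘ₗ LinearMap.llcomp K (SymAlg K gm.toSubmodule) g g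
      (gm.toSubmodule.projection h.toSubmodule hc)
  have hT : ∀ F, T F = ser (toddSeries K) (gm.toSubmodule.projection h.toSubmodule hc ∘ₗ F) :=
    fun F => rfl
  have key : expMap gm (-1) x ∈ (polyLE P g (l + d)).comap T := by
    refine ser_mem_submodule _ (fun n => ?_) (N := (l + d + 1).toNat) fun n hn =>
      adX_pow_const_eq_zero hG hx (by omega)
    rw [Submodule.mem_comap, hT]
    refine ser_mem_submodule _ (fun k => ?_) (N := (l + d + 1).toNat) fun k hk =>
      adX_pow_projection_eq_zero hG hc hx (by omega)
    by_cases hn : (l : ℤ) + d < (n : ℤ) + k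
    · rw [adX_pow_projection_eq_zero hG hc hx hn]
      exact Submodule.zero_mem _
    · have h1 := adX_pow_mem_polyLE hp (constSeries_mem_polyLE (P := P) x) n
      have h2 := adX_pow_mem_polyLE hp
        (comp_mem_polyLE (gm.toSubmodule.projection h.toSubmodule hc) h1) k
      exact polyLE_mono (by omega) h2
  exact key

end Graded

end SuperRep

theorem mainTheorem3 {K : Type*} [Field K] [CharZero K] {g : Type*} [AddCommGroup g] [Module K g]
    [SuperSpace K g] [LieSuper K g] (gm h : LieSuperSub K g)
    (hc : IsCompl gm.toSubmodule h.toSubmodule) :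
    ∃ (σ : SymAlg K gm.toSubmodule →ₗ[K] EnvAlg K g)
      (A : g →ₗ[K] SymAlg K gm.toSubmodule →ₗ[K] gm.toSubmodule)
      (B : g →ₗ[K] SymAlg K gm.toSubmodule →ₗ[K] h.toSubmodule),
      -- `σ` is the supersymmetrization map; `A`, `B` are the explicit morphisms of superspaces
      IsSymmetrization gm.toSuperSubmodule σ ∧
      (∀ x, A (par K x) = par K (A x)) ∧ (∀ x, B (par K x) = par K (B x)) ∧
      IsExplicit hc A B ∧
      -- the exponential identity
      ExpIdentity A B ∧
      -- the realizations of the coinduced and induced modules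
      (∀ (V : Type*) [AddCommGroup V] [Module K V] [SuperSpace K V] (ρ : SuperRepr h V),
        Function.Bijective (coindReal ρ σ) ∧ Function.Bijective (indReal ρ σ) ∧
        ∀ (ι : Type*) (P : Module.Basis ι K gm.toSubmodule) (p : ι → ZMod 2),
          (∀ i, IsHomog K (p i) (P i)) → CoindFormula ρ σ A B P p ∧ IndFormula ρ σ A B P p) ∧
      -- the graded case
      ∀ (l : ℕ) (𝒢 : ℤ → Submodule K g), IsDepthGrading gm h l 𝒢 →
        Module.Finite K gm.toSubmodule → ∀ (d : ℤ), ∀ x ∈ 𝒢 d,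
        (∀ n : ℕ, (l : ℤ) + d < n → (adXP gm)^[n] (constSeries x) = 0) ∧
        (∀ n k : ℕ, (l : ℤ) + d < (n : ℤ) + k → (adXP gm)^[k]
          (gm.toSubmodule.projection h.toSubmodule hc ∘ₗ (adXP gm)^[n] (constSeries x)) = 0) ∧
        ∀ (ι : Type*) (P : Module.Basis ι K gm.toSubmodule) (p : ι → ZMod 2),
          (∀ i, IsHomog K (p i) (P i)) →
          (∀ i, coef P p (A x) i ∈ polyLE P K (l + d) ∧
            coef P p (negX (A x)) i ∈ polyLE P K (l + d)) ∧
          B x ∈ polyLE P h.toSubmodule (l + d) ∧ negX (B x) ∈ polyLE P h.toSubmodule (l + d) := by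
  refine ⟨symExp gm, mapA hc, mapB hc, isSymmetrization_symExp, mapA_par hc, mapB_par hc,
    isExplicit_mapA_mapB hc, expIdentity_mapA_mapB hc, fun V _ _ _ ρ =>
    ⟨⟨coindReal_injective ρ hc, coindReal_surjective ρ hc⟩,
      ⟨indReal_injective ρ hc, indReal_surjective ρ hc⟩, fun ι P p hp =>
      ⟨coindFormula_mapA_mapB ρ hc P hp, indFormula_mapA_mapB ρ hc P⟩⟩,
    fun l 𝒢 hG hfin d x hx => ⟨fun n hn => ?_, fun n k hn => ?_, fun ι P p hp => ?_⟩⟩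
  · rw [← adX_pow]
    exact adX_pow_const_eq_zero hG hx hn
  · rw [← adX_pow, ← adX_pow]
    exact adX_pow_projection_eq_zero hG hc hx hn
  · have := Module.Finite.finite_basis P
    have := Fintype.ofFinite ι
    have hA := mapA_mem_polyLE hG hp hc hx
    have hB := mapB_mem_polyLE hG hp hc hx
    exact ⟨fun i => ⟨coef_mem_polyLE hp hA i, coef_mem_polyLE hp (negX_mem_polyLE hA) i⟩, hB,
      negX_mem_polyLE hB⟩
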